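/- Let $\{\mathbf Z_i\}_{i\in\mathbb Z}$ be a centered, (strictly) stationary Gaussian process with values in $\mathbb R^J$ such that for every $m\ge 1$ the covariance matrix of $(\mathbf Z_1,\dots,\mathbf Z_m)$ is non-singular. For $U\in\mathbb R^p$, $V\in\mathbb R^q$ square-integrable random vectors put $\rho(U,V)=\sup_{x\in\mathbb R^p,\,y\in\mathbb R^q}|\mathrm{Corr}(\langle x,U\rangle,\langle y,V\rangle)|$ (a correlation with a degenerate variable being $0$), and let $$\rho_{k,m}=\rho\big((\mathbf Z_1,\dots,\mathbf Z_m),(\mathbf Z_{k+1},\dots,\mathbf Z_{k+m})\big).$$ Assume: **A1.** $X_i=G(\mathbf Z_i,\mathbf Z_{i-1},\dots,\mathbf Z_{i-l})$, $i\in\mathbb Z$, where $l\ge 0$ is a fixed integer and $G$ is measurable, and $X_i$ is integrable with mean $\mu=\mathbb E X_i$. **A2.** With $S_{j,k}=\sum_{i=j}^kX_i$ ($S_{1,0}=0$), one has $$\Big\{\frac{1}{n^{H}\ell(n)}\big(S_{1,\lfloor nt\rfloor}-\lfloor nt\rfloor\mu\big),\ 0\le t\le 1\Big\}\Rightarrow\{Y(t),\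 0\le t\le 1\}$$ weakly in the space $D[0,1]$ of càdlàg functions with Skorokhod's $M_2$ topology (the topology of the Hausdorff distance between completed graphs), where $0<H<1$, $\ell$ is slowly varying at infinity, and $\{Y(t),t\ge 0\}$ is an $H$-self-similar process with stationary increments, with paths in $D[0,1]$ on $[0,1]$, which is nonzero, i.e. almost surely not identically zero on $[0,1]$. **A3.** The integers $b_n\ge1$ satisfy $b_n\to\infty$, $b_n=o(n)$ and $\sum_{k=0}^n\rho_{k,l+b_n}=o(n)$ as $n\to\infty$. Let $$T_n^*=\frac{S_{1,n}-n\mu}{D_n},\qquad D_n=\Big\{n^{-1}\sum_{k=1}^n\big(S_{1,k}-\tfrac kn S_{1,n}\big)^2\Big\}^{1/2},$$ let $\bar X_n=n^{-1}S_{1,n}$ and, for $1\le i\le n-b_n+1$, $$T_{i,b_n}=\frac{S_{i,i+b_n-1}-b_n\bar X_n}{\big\{b_n^{-1}\sum_{k=i}^{i+b_n-1}\big(S_{i,k}-b_n^{-1}(k-i+1)S_{i,i+b_n-1}\big)^2\big\}^{1/2}},$$ $$\widehat F_{n,b_n}(x)=\frac1{n-b_n+1}\sum_{i=1}^{n-b_n+1}\mathrm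 I(T_{i,b_n}\le x)$$ (a ratio with zero denominator being read as $0$). Let $F(x)=P(T\le x)$, where $$T=\frac{Y(1)}{\big[\int_0^1\{Y(s)-sY(1)\}^2ds\big]^{1/2}}.$$ Then, for every continuity point $x$ of $F$, as $n\to\infty$, $$\big|\widehat F_{n,b_n}(x)-P(T_n^*\le x)\big|\to0\quad\text{in probability}.$$ If moreover $F$ is continuous, then $$\sup_{x\in\mathbb R}\big|\widehat F_{n,b_n}(x)-P(T_n^*\le x)\big|\to0\quad\text{in probability}.$$ -/

import Mathlib

open MeasureTheory ProbabilityTheory Filter Topology Set Asymptotics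
open scoped unitInterval NNReal ENNReal

namespace BlockSampling

noncomputable section

/-! ### The space `D[0,1]` with Skorokhod's `M₂` topology -/

/-- The space `D[0,1]` of càdlàg functions: right continuous on `[0,1]`, with left limits
(the condition is void at the left end point). -/
@[ext]
structure CadlagSpace where
  toFun : I → ℝ
  rightContinuous : ∀ t, ContinuousWithinAt toFun (Ici t) t
  leftLimits : ∀ t, ∃ L, Tendsto toFun (𝓝[<] t) (𝓝 L)

instance : CoeFun CadlagSpace (fun _ => I → ℝ) := ⟨CadlagSpace.toFun⟩

/-- The completed graph of `f`: the graph of `f` together with the vertical segments joining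
`f (t-)` and `f t` at the jumps of `f`. (By Mathlib's convention `leftLim f 0 = f 0`.) -/
def completedGraph (f : CadlagSpace) : Set (I × ℝ) :=
  {p | p.2 ∈ uIcc (Function.leftLim f.toFun p.1) (f p.1)}

/-- Skorokhod's `M₂` topology on `D[0,1]`: the Hausdorff distance between completed graphs. -/
instance : PseudoEMetricSpace CadlagSpace where
  edist f g := Metric.hausdorffEDist (completedGraph f) (completedGraph g)
  edist_self _ := Metric.hausdorffEDist_self
  edist_comm _ _ := Metric.hausdorffEDist_comm
  edist_triangle _ _ _ := Metric.hausdorffEDist_triangle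

/-- The Borel `σ`-algebra of the `M₂` topology. -/
instance : MeasurableSpace CadlagSpace := borel CadlagSpace

instance : BorelSpace CadlagSpace := ⟨rfl⟩

/-- The càdlàg step function `t ↦ g ⌊n t⌋` on `[0,1]`. -/
def stepPath (n : ℕ) (g : ℤ → ℝ) : CadlagSpace where
  toFun t := g ⌊(n : ℝ) * (t : ℝ)⌋
  rightContinuous t := by
    have h1 : Tendsto (fun s : I => (n : ℝ) * (s : ℝ)) (𝓝[≥] t) (𝓝[≥] ((n : ℝ) * (t : ℝ))) := by
      refine tendsto_nhdsWithin_iff.2 ⟨?_, ?_⟩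
      · have hc : Continuous (fun s : I => (n : ℝ) * (s : ℝ)) := by fun_prop
        exact (hc.tendsto t).mono_left nhdsWithin_le_nhds
      · filter_upwards [self_mem_nhdsWithin] with s hs
        exact mul_le_mul_of_nonneg_left (show (t : ℝ) ≤ (s : ℝ) from hs) (Nat.cast_nonneg n)
    have h2 := (tendsto_floor_right_pure_floor ((n : ℝ) * (t : ℝ))).comp h1
    exact ((tendsto_pure_pure g _).comp h2).mono_right (pure_le_nhds _)
  leftLimits t := by
    rcases Nat.eq_zero_or_pos n with rfl | hn
    · exact ⟨g 0, by simpa using tendsto_const_nhds⟩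
    · refine ⟨g (⌈(n : ℝ) * (t : ℝ)⌉ - 1), ?_⟩
      have h1 : Tendsto (fun s : I => (n : ℝ) * (s : ℝ)) (𝓝[<] t)
          (𝓝[<] ((n : ℝ) * (t : ℝ))) := by
        refine tendsto_nhdsWithin_iff.2 ⟨?_, ?_⟩
        · have hc : Continuous (fun s : I => (n : ℝ) * (s : ℝ)) := by fun_prop
          exact (hc.tendsto t).mono_left nhdsWithin_le_nhds
        · filter_upwards [self_mem_nhdsWithin] with s hs
          exact mul_lt_mul_of_pos_left (show (s : ℝ) < (t : ℝ) from hs) (Nat.cast_pos.2 hn)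
      have h2 := (tendsto_floor_left_pure_ceil_sub_one ((n : ℝ) * (t : ℝ))).comp h1
      exact ((tendsto_pure_pure g _).comp h2).mono_right (pure_le_nhds _)

/-! ### Partial sums, self-normalized statistics, block-sampling distribution -/

variable {Ω Ω' : Type*}

/-- `S_{j,k} = ∑_{i=j}^k X_i` (zero when `k < j`). -/
def partialSum (X : ℤ → Ω → ℝ) (j k : ℤ) (ω : Ω) : ℝ := ∑ i ∈ Finset.Icc j k, X i ω

/-- The block normalizer
`D_{i,b} = { b⁻¹ ∑_{k=i}^{i+b-1} (S_{i,k} - b⁻¹ (k-i+1) S_{i,i+b-1})² }^{1/2}`. -/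
def normalizer (X : ℤ → Ω → ℝ) (i : ℤ) (b : ℕ) (ω : Ω) : ℝ :=
  Real.sqrt ((b : ℝ)⁻¹ * ∑ k ∈ Finset.Icc i (i + b - 1),
    (partialSum X i k ω - (b : ℝ)⁻¹ * ((k : ℝ) - i + 1) * partialSum X i (i + b - 1) ω) ^ 2)

/-- The self-normalized statistic `(S_{i,i+b-1} - b c) / D_{i,b}` of the block of length `b`
starting at time `i`, centered at `c`. -/
def blockStat (X : ℤ → Ω → ℝ) (c : ℝ) (i : ℤ) (b : ℕ) (ω : Ω) : ℝ :=
  (partialSum X i (i + b - 1) ω - b * c) / normalizer X i b ω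

/-- `T_n^* = (S_{1,n} - n μ) / D_n`. -/
def selfNormStat (X : ℤ → Ω → ℝ) (μ : ℝ) (n : ℕ) (ω : Ω) : ℝ := blockStat X μ 1 n ω

/-- The average of `X_1, …, X_n`. -/
def sampleMean (X : ℤ → Ω → ℝ) (n : ℕ) (ω : Ω) : ℝ := (n : ℝ)⁻¹ * partialSum X 1 n ω

/-- The block-sampling empirical distribution function
`F̂_{n,b}(x) = (n-b+1)⁻¹ ∑_{i=1}^{n-b+1} 1(T_{i,b} ≤ x)`,
where `T_{i,b}` is centered at the sample mean of `X_1, …, X_n` (meaningful for `1 ≤ b ≤ n`). -/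
def blockCDF (X : ℤ → Ω → ℝ) (n b : ℕ) (x : ℝ) (ω : Ω) : ℝ :=
  ((n : ℝ) - b + 1)⁻¹ * ∑ i ∈ Finset.Icc (1 : ℤ) ((n : ℤ) - b + 1),
    (Iic x).indicator (fun _ => (1 : ℝ)) (blockStat X (sampleMean X n ω) i b ω)

/-- The normalized partial sum process
`t ↦ (n^H ℓ(n))⁻¹ (S_{1,⌊nt⌋} - ⌊nt⌋ μ)` as a random element of `D[0,1]`. -/
def partialSumPath (X : ℤ → Ω → ℝ) (μ H : ℝ) (ℓ : ℝ → ℝ) (n : ℕ) (ω : Ω) : CadlagSpace :=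
  stepPath n (fun m => ((n : ℝ) ^ H * ℓ n)⁻¹ * (partialSum X 1 m ω - m * μ))

/-- The functional `f ↦ f(1) / { ∫₀¹ (f(s) - s f(1))² ds }^{1/2}` on `D[0,1]`. -/
def limitFunctional (f : CadlagSpace) : ℝ :=
  f 1 / Real.sqrt (∫ s : I, (f s - (s : ℝ) * f 1) ^ 2)

/-- The cumulative distribution function `F(x) = P(T ≤ x)` of
`T = Y(1) / { ∫₀¹ (Y(s) - s Y(1))² ds }^{1/2}`, for a random element `Y` of `D[0,1]`. -/
def limitCDF [MeasurableSpace Ω'] (P' : Measure Ω') (Y : Ω' → CadlagSpace) (x : ℝ) : ℝ :=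
  P'.real {ω | limitFunctional (Y ω) ≤ x}

/-! ### Stationarity, self-similarity, slow variation -/

/-- Strict stationarity of a process indexed by `ℤ`. -/
def IsStationary [MeasurableSpace Ω] {E : Type*} [MeasurableSpace E] (Z : ℤ → Ω → E)
    (P : Measure Ω) : Prop :=
  ∀ (h : ℤ) (J : Finset ℤ),
    IdentDistrib (fun ω (i : J) => Z (i + h) ω) (fun ω (i : J) => Z i ω) P P

/-- `H`-sssi processes: self-similar with index `H`, with stationary increments
(equalities of all finite-dimensional distributions). -/
structure IsSSSI [MeasurableSpace Ω'] (Y : ℝ≥0 → Ω' → ℝ) (H : ℝ) (P' : Measure Ω') : Prop where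
  selfSimilar : ∀ (c : ℝ≥0), 0 < c → ∀ J : Finset ℝ≥0,
    IdentDistrib (fun ω (t : J) => Y (c * t) ω) (fun ω (t : J) => (c : ℝ) ^ H * Y t ω) P' P'
  stationaryIncrements : ∀ (h : ℝ≥0) (J : Finset ℝ≥0),
    IdentDistrib (fun ω (t : J) => Y (t + h) ω - Y h ω) (fun ω (t : J) => Y t ω - Y 0 ω) P' P'

/-- Slowly varying functions at infinity: measurable, eventually positive, and
`ℓ(λ x) / ℓ(x) → 1` as `x → ∞` for every `λ > 0`. -/
structure IsSlowlyVarying (ℓ : ℝ → ℝ) : Prop where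
  measurable : Measurable ℓ
  eventually_pos : ∀ᶠ x in atTop, 0 < ℓ x
  tendsto_ratio : ∀ a : ℝ, 0 < a → Tendsto (fun x => ℓ (a * x) / ℓ x) atTop (𝓝 1)

/-! ### Covariances and canonical correlations -/

/-- The block `(Z_{p+1}, …, Z_{p+m})`, seen as a random vector of dimension `m J`. -/
def block {J : ℕ} (Z : ℤ → Ω → Fin J → ℝ) (p : ℤ) (m : ℕ) (ω : Ω) : Fin m × Fin J → ℝ :=
  fun r => Z (p + 1 + (r.1 : ℕ)) ω r.2

/-- The covariance matrix `Σ_m` of `(Z_1, …, Z_m)`. -/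
def blockCovMatrix {J : ℕ} [MeasurableSpace Ω] (Z : ℤ → Ω → Fin J → ℝ) (P : Measure Ω) (m : ℕ) :
    Matrix (Fin m × Fin J) (Fin m × Fin J) ℝ :=
  fun r s => cov[fun ω => block Z 0 m ω r, fun ω => block Z 0 m ω s; P]

/-- The correlation coefficient (it is `0` when one of the variances vanishes). -/
def corr [MeasurableSpace Ω] (U V : Ω → ℝ) (P : Measure Ω) : ℝ :=
  cov[U, V; P] / (Real.sqrt (Var[U; P]) * Real.sqrt (Var[V; P]))

/-- The canonical correlation `ρ(U, V) = sup_{x,y} |Corr(⟨x,U⟩, ⟨y,V⟩)|` of two square integrable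
random vectors. -/
def canonicalCorr {ι κ : Type*} [Fintype ι] [Fintype κ] [MeasurableSpace Ω]
    (U : Ω → ι → ℝ) (V : Ω → κ → ℝ) (P : Measure Ω) : ℝ :=
  ⨆ p : (ι → ℝ) × (κ → ℝ),
    |corr (fun ω => ∑ i, p.1 i * U ω i) (fun ω => ∑ j, p.2 j * V ω j) P|

/-- The between-block canonical correlation
`ρ_{k,m} = ρ((Z_1, …, Z_m), (Z_{k+1}, …, Z_{k+m}))`. -/
def blockCorr {J : ℕ} [MeasurableSpace Ω] (Z : ℤ → Ω → Fin J → ℝ) (P : Measure Ω)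
    (k m : ℕ) : ℝ :=
  canonicalCorr (block Z 0 m) (block Z k m) P

/-! ### The assumptions -/

/-- `Z` is a centered `ℝ^J`-valued stationary Gaussian process with non-singular block covariance
matrices, and `X_i = G(Z_i, …, Z_{i-l})` with `G` measurable has finite mean `μ`. -/
structure GaussianSubordination [MeasurableSpace Ω] (P : Measure Ω) {J : ℕ}
    (Z : ℤ → Ω → Fin J → ℝ) (l : ℕ) (G : (Fin (l + 1) → Fin J → ℝ) → ℝ)
    (X : ℤ → Ω → ℝ) (μ : ℝ) : Prop where
  gaussian : IsGaussianProcess Z P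
  stationary : IsStationary Z P
  centered : ∀ i j, ∫ ω, Z i ω j ∂P = 0
  nonsingular : ∀ m : ℕ, (blockCovMatrix Z P m).det ≠ 0
  measurable_G : Measurable G
  eq_G : ∀ i ω, X i ω = G (fun r => Z (i - (r : ℕ)) ω)
  integrable : ∀ i, Integrable (X i) P
  mean : ∀ i, ∫ ω, X i ω ∂P = μ

/-- Weak convergence, in `D[0,1]` with the `M₂` topology, of the partial sum process normalized by
`n^H ℓ(n)` to the restriction `path` to `[0,1]` of an `H`-sssi process `Y` which almost surely is
not identically zero on `[0,1]`, where `0 < H < 1` and `ℓ` is slowly varying. -/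
structure FunctionalLimit [MeasurableSpace Ω] (P : Measure Ω) [IsProbabilityMeasure P]
    [MeasurableSpace Ω'] (P' : Measure Ω') [IsProbabilityMeasure P']
    (X : ℤ → Ω → ℝ) (μ H : ℝ) (ℓ : ℝ → ℝ) (Y : ℝ≥0 → Ω' → ℝ) (path : Ω' → CadlagSpace) :
    Prop where
  H_pos : 0 < H
  H_lt_one : H < 1
  slowlyVarying : IsSlowlyVarying ℓ
  sssi : IsSSSI Y H P'
  path_eq : ∀ᵐ ω ∂P', ∀ t : I, path ω t = Y (unitInterval.toNNReal t) ω
  nonzero : ∀ᵐ ω ∂P', ∃ t : I, path ω t ≠ 0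
  weakLimit : TendstoInDistribution (fun n : ℕ => partialSumPath X μ H ℓ n) atTop path
    (fun _ => P) P'

/-- The block sizes satisfy `b_n → ∞`, `b_n = o(n)` and `∑_{k=0}^n ρ_{k,l+b_n} = o(n)`. -/
structure BlockSizeCondition [MeasurableSpace Ω] (P : Measure Ω) {J : ℕ}
    (Z : ℤ → Ω → Fin J → ℝ) (l : ℕ) (b : ℕ → ℕ) : Prop where
  tendsto_atTop : Tendsto b atTop atTop
  isLittleO : (fun n : ℕ => (b n : ℝ)) =o[atTop] (fun n : ℕ => (n : ℝ))
  sum_blockCorr : (fun n : ℕ => ∑ k ∈ Finset.range (n + 1), blockCorr Z P k (l + b n))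
    =o[atTop] (fun n : ℕ => (n : ℝ))

end

end BlockSampling

/-! Centre the block statistics at `μ` instead of the sample mean. Each of them is then the same
measurable function of the Gaussian block of `l + b` vectors that feeds it, so the indicators of
`T_{i,b} ≤ x` have a common mean, and their covariance at lag `k` is at most `ρ_{k,l+b}` by
Gebelein's inequality. The variance of their average is therefore `O(n⁻¹ ∑ ρ_{k,l+b})`, which tends
to zero, and Chebyshev's inequality puts the average close to `P(T_b^* ≤ x)`.

Gebelein's inequality is obtained without Hermite expansions. The functions `e^{Var X / 2} (cos X +
sin X)` of centered jointly Gaussian variables have covariances `exp(cov) - 1`, a power series in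
`cov` with nonnegative coefficients and no constant term. The Schur product theorem, applied to each
power of the block matrix with diagonal blocks `ρA`, `ρB` and off-diagonal block `C`, bounds the
covariance of linear combinations (`abs_sum_exp_sub_one_le`). Such combinations are dense enough in
`L²` to approximate indicators, by uniqueness of characteristic functions.

The law of `T_n^*` converges because `T_n^*` is a functional of the partial sum path. `M₂`
convergence gives convergence at continuity points of the limit together with a uniform bound, so
value at `1` and normalizer both converge when the limit path is continuous at `1`. Two facts about
`Y` complete the mapping argument. Stationarity of increments transports right continuity at `0` to
left continuity at `1`. Self-similarity with `H < 1` excludes linear paths, so the limiting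
normalizer is almost surely positive.

Recentering shifts a block statistic by `b (X̄_n - μ)` divided by the normalizer. The numerator has
order `(b/n) n^H ℓ(n)`, which by Potter's bound and `H < 1` is negligible against `b^H ℓ(b)`, while
few blocks have a normalizer below a small multiple of `b^H ℓ(b)`. The empirical distribution at `x`
is thus squeezed between its `μ`-centered versions at nearby continuity points of `F`. For
continuous `F`, monotonicity upgrades convergence at finitely many points to uniform convergence. -/

namespace BlockSampling

noncomputable section

variable {Ω Ω' : Type*}

/-! ### Gebelein's inequality -/

lemma posSemidef_hadamard_pow {ι : Type*} {M : Matrix ι ι ℝ} (hM : M.PosSemidef) (m : ℕ) :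
    (Matrix.of fun i j => M i j ^ (m + 1)).PosSemidef := by
  induction m with
  | zero =>
    have : (Matrix.of fun i j => M i j ^ (0 + 1)) = M := by ext i j; simp
    rwa [this]
  | succ m ih =>
    have e : (Matrix.of fun i j => M i j ^ (m + 1 + 1))
        = (Matrix.of fun i j => M i j ^ (m + 1)).hadamard M := by
      ext i j; simp [pow_succ]
    rw [e]
    exact ih.hadamard hM

lemma posSemidef_quadratic_nonneg {ι : Type*} [Fintype ι] {M : Matrix ι ι ℝ} (hM : M.PosSemidef)
    (x : ι → ℝ) : 0 ≤ ∑ i, ∑ j, x i * x j * M i j := by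
  have h := hM.dotProduct_mulVec_nonneg x
  simp only [dotProduct, Matrix.mulVec, Finset.mul_sum, Pi.star_apply, star_trivial] at h
  refine h.trans_eq (Finset.sum_congr rfl fun i _ => Finset.sum_congr rfl fun j _ => by ring)

lemma hasSum_exp_sub_one (c : ℝ) :
    HasSum (fun m : ℕ => c ^ (m + 1) / (m + 1).factorial) (Real.exp c - 1) := by
  have h := NormedSpace.expSeries_div_hasSum_exp c
  rw [← Real.exp_eq_exp_ℝ] at h
  have h2 := (hasSum_nat_add_iff' 1).2 h
  simpa using h2

/-- Expand `exp` in its power series and compare term by term. By the Schur product theorem the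
entrywise `(m + 1)`-st power of the block matrix is positive semidefinite, which bounds the mixed
form of order `m + 1` by `ρ ^ (m + 1)` times the mean of the two diagonal forms. Here `A`, `B` play
the role of covariance matrices and `C` that of the cross-covariance. -/
lemma abs_sum_exp_sub_one_le {p q : Type*} [Fintype p] [Fintype q]
    {A : Matrix p p ℝ} {C : Matrix p q ℝ} {B : Matrix q q ℝ} {ρ : ℝ} (h0 : 0 ≤ ρ) (h1 : ρ ≤ 1)
    (hA : A.PosSemidef) (hB : B.PosSemidef)
    (hM : (Matrix.fromBlocks (ρ • A) C C.transpose (ρ • B)).PosSemidef) (x : p → ℝ) (y : q → ℝ) :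
    |∑ i, ∑ k, x i * y k * (Real.exp (C i k) - 1)| ≤
      ρ / 2 * (∑ i, ∑ j, x i * x j * (Real.exp (A i j) - 1)
        + ∑ i, ∑ j, y i * y j * (Real.exp (B i j) - 1)) := by
  set a : ℕ → ℝ := fun m => ∑ i, ∑ j, x i * x j * (A i j ^ (m + 1) / (m + 1).factorial)
  set b : ℕ → ℝ := fun m => ∑ i, ∑ j, y i * y j * (B i j ^ (m + 1) / (m + 1).factorial)
  set c : ℕ → ℝ := fun m => ∑ i, ∑ j, x i * y j * (C i j ^ (m + 1) / (m + 1).factorial)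
  have ha : HasSum a (∑ i, ∑ j, x i * x j * (Real.exp (A i j) - 1)) :=
    hasSum_sum fun i _ => hasSum_sum fun j _ => (hasSum_exp_sub_one _).mul_left _
  have hb : HasSum b (∑ i, ∑ j, y i * y j * (Real.exp (B i j) - 1)) :=
    hasSum_sum fun i _ => hasSum_sum fun j _ => (hasSum_exp_sub_one _).mul_left _
  have hc : HasSum c (∑ i, ∑ j, x i * y j * (Real.exp (C i j) - 1)) :=
    hasSum_sum fun i _ => hasSum_sum fun j _ => (hasSum_exp_sub_one _).mul_left _
  have key : ∀ m, |c m| ≤ ρ / 2 * (a m + b m) := by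
    intro m
    have hf : (0 : ℝ) < ((m + 1).factorial : ℝ) := by positivity
    set a' := ∑ i, ∑ j, x i * x j * A i j ^ (m + 1)
    set b' := ∑ i, ∑ j, y i * y j * B i j ^ (m + 1)
    set c' := ∑ i, ∑ j, x i * y j * C i j ^ (m + 1)
    have ea : a m = a' / (m + 1).factorial := by
      simp only [a, a', Finset.sum_div, mul_div_assoc]
    have eb : b m = b' / (m + 1).factorial := by
      simp only [b, b', Finset.sum_div, mul_div_assoc]
    have ec : c m = c' / (m + 1).factorial := by
      simp only [c, c', Finset.sum_div, mul_div_assoc]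
    have pa : 0 ≤ a' := posSemidef_quadratic_nonneg (posSemidef_hadamard_pow hA m) x
    have pb : 0 ≤ b' := posSemidef_quadratic_nonneg (posSemidef_hadamard_pow hB m) y
    -- The factor `ρ` survives in every term because subtracting `1` removed the term of order zero.
    have pow_le : ρ ^ (m + 1) ≤ ρ := pow_le_of_le_one h0 h1 (by simp)
    -- The quadratic form is evaluated at `(x, s y)`; the signs `s = 1` and `s = -1` give the two
    -- halves of the absolute value bound.
    have main : ∀ s : ℝ, s ^ 2 = 1 → 0 ≤ ρ ^ (m + 1) * a' + 2 * s * c' + ρ ^ (m + 1) * b' := by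
      intro s hs
      have h := posSemidef_quadratic_nonneg (posSemidef_hadamard_pow hM m)
        (Sum.elim x (fun k => s * y k))
      simp only [Fintype.sum_sum_type, Sum.elim_inl, Sum.elim_inr, Matrix.of_apply,
        Matrix.fromBlocks_apply₁₁, Matrix.fromBlocks_apply₁₂, Matrix.fromBlocks_apply₂₁,
        Matrix.fromBlocks_apply₂₂, Matrix.smul_apply, smul_eq_mul, Matrix.transpose_apply,
        mul_pow, Finset.sum_add_distrib] at h
      have e1 : ∑ i, ∑ j, x i * x j * (ρ ^ (m + 1) * A i j ^ (m + 1)) = ρ ^ (m + 1) * a' := by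
        simp only [a', Finset.mul_sum]
        exact Finset.sum_congr rfl fun i _ => Finset.sum_congr rfl fun j _ => by ring
      have e2 : ∑ i, ∑ j, s * y i * (s * y j) * (ρ ^ (m + 1) * B i j ^ (m + 1))
          = ρ ^ (m + 1) * b' := by
        simp only [b', Finset.mul_sum]
        refine Finset.sum_congr rfl fun i _ => Finset.sum_congr rfl fun j _ => ?_
        linear_combination (y i * y j * ρ ^ (m + 1) * B i j ^ (m + 1)) * hs
      have e3 : ∑ i, ∑ j, x i * (s * y j) * C i j ^ (m + 1) = s * c' := by
        simp only [c', Finset.mul_sum]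
        exact Finset.sum_congr rfl fun i _ => Finset.sum_congr rfl fun j _ => by ring
      have e4 : ∑ j, ∑ i, s * y j * x i * C i j ^ (m + 1) = s * c' := by
        rw [Finset.sum_comm]
        simp only [c', Finset.mul_sum]
        exact Finset.sum_congr rfl fun i _ => Finset.sum_congr rfl fun j _ => by ring
      rw [e1, e2, e3, e4] at h
      linarith
    have m1 := main 1 (by norm_num)
    have m2 := main (-1) (by norm_num)
    rw [ea, eb, ec, abs_div, abs_of_pos hf, ← add_div, ← mul_div_assoc]
    refine div_le_div_of_nonneg_right ?_ hf.le
    have := mul_le_mul_of_nonneg_right pow_le (add_nonneg pa pb)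
    rw [abs_le]
    constructor <;> linarith
  have hab := (ha.add hb).mul_left (ρ / 2)
  rw [abs_le]
  constructor
  · exact neg_le_of_neg_le (hasSum_le (fun m => (neg_le_abs _).trans (key m)) hc.neg hab)
  · exact hasSum_le (fun m => (le_abs_self _).trans (key m)) hc hab

/-! ### Hartley functions of Gaussian variables -/

lemma integral_cos_sin_of_hasGaussianLaw [MeasurableSpace Ω] {P : Measure Ω} {W : Ω → ℝ}
    (hW : HasGaussianLaw W P) (h0 : ∫ ω, W ω ∂P = 0) :
    ∫ ω, Real.cos (W ω) ∂P = Real.exp (-Var[W; P] / 2) ∧ ∫ ω, Real.sin (W ω) ∂P = 0 := by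
  have hp := hW.isProbabilityMeasure
  have h := hW.charFun_map_eq 1
  have hI : Integrable (fun ω => Complex.exp (((W ω : ℝ) : ℂ) * Complex.I)) P := by
    refine Integrable.of_bound (C := 1) ?_ (ae_of_all _ fun ω => ?_)
    · have := hW.aemeasurable
      exact (by fun_prop : AEMeasurable (fun ω => Complex.exp ((W ω : ℂ) * Complex.I))
        P).aestronglyMeasurable
    · simp [Complex.norm_exp_ofReal_mul_I]
  rw [charFun_apply, integral_map hW.aemeasurable (by fun_prop)] at h
  simp only [RCLike.inner_apply, conj_trivial, one_mul, mul_one, h0, Complex.ofReal_zero, zero_mul,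
    zero_sub] at h
  have hr : Complex.exp (-((Var[W; P] : ℝ) / 2 : ℂ)) = ((Real.exp (-Var[W; P] / 2) : ℝ) : ℂ) := by
    push_cast; congr 1; ring
  rw [hr] at h
  have h1 := congrArg RCLike.re h
  have h2 := congrArg RCLike.im h
  rw [← integral_re hI] at h1
  rw [← integral_im hI] at h2
  constructor
  · simpa only [RCLike.re_eq_complex_re, Complex.exp_ofReal_mul_I_re, Complex.ofReal_re] using h1
  · simpa only [RCLike.im_eq_complex_im, Complex.exp_ofReal_mul_I_im, Complex.ofReal_im] using h2

/-- The normalized Hartley function `e^{Var X / 2} (cos X + sin X)` of a random variable. -/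
def hartley [MeasurableSpace Ω] (P : Measure Ω) (X : Ω → ℝ) (ω : Ω) : ℝ :=
  Real.exp (Var[X; P] / 2) * (Real.cos (X ω) + Real.sin (X ω))

lemma memLp_hartley [MeasurableSpace Ω] {P : Measure Ω} [IsFiniteMeasure P] {X : Ω → ℝ}
    (hX : AEMeasurable X P) (p : ℝ≥0∞) : MemLp (hartley P X) p P := by
  refine MemLp.of_bound (C := Real.exp (Var[X; P] / 2) * 2) ?_ (ae_of_all _ fun ω => ?_)
  · unfold hartley; exact (by fun_prop : AEMeasurable _ P).aestronglyMeasurable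
  · rw [hartley, norm_mul, Real.norm_eq_abs, abs_of_pos (Real.exp_pos _)]
    gcongr
    refine (norm_add_le _ _).trans ?_
    have h1 := Real.abs_cos_le_one (X ω)
    have h2 := Real.abs_sin_le_one (X ω)
    rw [Real.norm_eq_abs, Real.norm_eq_abs]; linarith

lemma integral_hartley [MeasurableSpace Ω] {P : Measure Ω} {X : Ω → ℝ}
    (hX : HasGaussianLaw X P) (h0 : ∫ ω, X ω ∂P = 0) : ∫ ω, hartley P X ω ∂P = 1 := by
  have hp := hX.isProbabilityMeasure
  have hm := hX.aemeasurable
  obtain ⟨h1, h2⟩ := integral_cos_sin_of_hasGaussianLaw hX h0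
  unfold hartley
  rw [integral_const_mul, integral_add, h1, h2, add_zero, ← Real.exp_add]
  · ring_nf; simp
  · exact Integrable.of_bound (C := 1) (by fun_prop : AEMeasurable _ P).aestronglyMeasurable
      (ae_of_all _ fun ω => Real.abs_cos_le_one _)
  · exact Integrable.of_bound (C := 1) (by fun_prop : AEMeasurable _ P).aestronglyMeasurable
      (ae_of_all _ fun ω => Real.abs_sin_le_one _)

/-- The product `(cos X + sin X)(cos Y + sin Y)` equals `cos (X - Y) + sin (X + Y)`. The sine has
mean zero by symmetry, and the cosine contributes `exp(-Var(X - Y)/2)`, whose variance terms cancel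
against the normalizing factors. A real-valued function thus does the work of the complex
exponential. -/
lemma integral_hartley_mul [MeasurableSpace Ω] {P : Measure Ω} {X Y : Ω → ℝ}
    (hXY : HasGaussianLaw (fun ω => (X ω, Y ω)) P) (hX0 : ∫ ω, X ω ∂P = 0)
    (hY0 : ∫ ω, Y ω ∂P = 0) :
    ∫ ω, hartley P X ω * hartley P Y ω ∂P = Real.exp cov[X, Y; P] := by
  have hp := hXY.isProbabilityMeasure
  have hX := hXY.fst
  have hY := hXY.snd
  have hmX := hX.aemeasurable
  have hmY := hY.aemeasurable
  have hs : ∫ ω, (X ω + Y ω) ∂P = 0 := by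
    rw [integral_add hX.integrable hY.integrable, hX0, hY0, add_zero]
  have hd : ∫ ω, (X ω - Y ω) ∂P = 0 := by
    rw [integral_sub hX.integrable hY.integrable, hX0, hY0, sub_zero]
  have h1 := (integral_cos_sin_of_hasGaussianLaw hXY.fun_sub hd).1
  have h2 := (integral_cos_sin_of_hasGaussianLaw hXY.fun_add hs).2
  have hv : Var[fun ω => X ω - Y ω; P] = Var[X; P] - 2 * cov[X, Y; P] + Var[Y; P] :=
    variance_fun_sub hX.memLp_two hY.memLp_two
  have e : ∀ ω, hartley P X ω * hartley P Y ω = Real.exp (Var[X; P] / 2) *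
      Real.exp (Var[Y; P] / 2) * (Real.cos (X ω - Y ω) + Real.sin (X ω + Y ω)) := by
    intro ω
    rw [hartley, hartley, Real.cos_sub, Real.sin_add]; ring
  simp_rw [e]
  rw [integral_const_mul, integral_add, h1, h2, add_zero, hv, ← Real.exp_add, ← Real.exp_add]
  · congr 1; ring
  · exact Integrable.of_bound (C := 1) (by fun_prop : AEMeasurable _ P).aestronglyMeasurable
      (ae_of_all _ fun ω => Real.abs_cos_le_one _)
  · exact Integrable.of_bound (C := 1) (by fun_prop : AEMeasurable _ P).aestronglyMeasurable
      (ae_of_all _ fun ω => Real.abs_sin_le_one _)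

lemma cov_hartley [MeasurableSpace Ω] {P : Measure Ω} {X Y : Ω → ℝ}
    (hXY : HasGaussianLaw (fun ω => (X ω, Y ω)) P) (hX0 : ∫ ω, X ω ∂P = 0)
    (hY0 : ∫ ω, Y ω ∂P = 0) :
    cov[hartley P X, hartley P Y; P] = Real.exp cov[X, Y; P] - 1 := by
  have hp := hXY.isProbabilityMeasure
  rw [covariance_eq_sub (memLp_hartley hXY.fst.aemeasurable 2)
    (memLp_hartley hXY.snd.aemeasurable 2), integral_hartley hXY.fst hX0,
    integral_hartley hXY.snd hY0, mul_one]
  congr 1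
  exact integral_hartley_mul hXY hX0 hY0

lemma cov_sum_hartley [MeasurableSpace Ω] {P : Measure Ω} {p q : Type*} [Fintype p] [Fintype q]
    {X : p → Ω → ℝ} {Y : q → Ω → ℝ} (hXY : ∀ i j, HasGaussianLaw (fun ω => (X i ω, Y j ω)) P)
    (hX0 : ∀ i, ∫ ω, X i ω ∂P = 0) (hY0 : ∀ i, ∫ ω, Y i ω ∂P = 0)
    [IsFiniteMeasure P] (hX : ∀ i, AEMeasurable (X i) P) (hY : ∀ i, AEMeasurable (Y i) P)
    (x : p → ℝ) (y : q → ℝ) :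
    cov[fun ω => ∑ i, x i * hartley P (X i) ω, fun ω => ∑ i, y i * hartley P (Y i) ω; P]
      = ∑ i, ∑ j, x i * y j * (Real.exp cov[X i, Y j; P] - 1) := by
  rw [covariance_fun_sum_fun_sum (fun i => (memLp_hartley (hX i) 2).const_mul _)
    (fun i => (memLp_hartley (hY i) 2).const_mul _)]
  refine Finset.sum_congr rfl fun i _ => Finset.sum_congr rfl fun j _ => ?_
  rw [covariance_const_mul_left, covariance_const_mul_right,
    cov_hartley (hXY i j) (hX0 i) (hY0 j)]
  ring

lemma posSemidef_of_symm_of_quadratic {ι : Type*} [Fintype ι] {M : Matrix ι ι ℝ}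
    (hs : ∀ i j, M i j = M j i) (h : ∀ x : ι → ℝ, 0 ≤ ∑ i, ∑ j, x i * x j * M i j) :
    M.PosSemidef := by
  refine Matrix.PosSemidef.of_dotProduct_mulVec_nonneg ?_ fun x => ?_
  · ext i j; simpa using hs j i
  · simp only [dotProduct, Matrix.mulVec, Finset.mul_sum, Pi.star_apply, star_trivial]
    refine (h x).trans_eq (Finset.sum_congr rfl fun i _ => Finset.sum_congr rfl fun j _ => by ring)

lemma cov_sum_mul_sum_mul [MeasurableSpace Ω] {P : Measure Ω} {p q : Type*} [Fintype p] [Fintype q]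
    {X : p → Ω → ℝ} {Y : q → Ω → ℝ} [IsFiniteMeasure P] (hX : ∀ i, MemLp (X i) 2 P)
    (hY : ∀ i, MemLp (Y i) 2 P) (x : p → ℝ) (y : q → ℝ) :
    cov[fun ω => ∑ i, x i * X i ω, fun ω => ∑ i, y i * Y i ω; P]
      = ∑ i, ∑ j, x i * y j * cov[X i, Y j; P] := by
  rw [covariance_fun_sum_fun_sum (fun i => (hX i).const_mul _) (fun i => (hY i).const_mul _)]
  refine Finset.sum_congr rfl fun i _ => Finset.sum_congr rfl fun j _ => ?_
  rw [covariance_const_mul_left, covariance_const_mul_right, mul_assoc]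

universe u

/-- Gebelein's inequality for linear combinations of Hartley functions. -/
lemma abs_cov_sum_hartley_le [MeasurableSpace Ω] {P : Measure Ω} {E : Type*}
    [NormedAddCommGroup E] [NormedSpace ℝ E] [MeasurableSpace E] [BorelSpace E]
    {W : Ω → E} (hW : HasGaussianLaw W P) (hW0 : ∀ L : StrongDual ℝ E, ∫ ω, L (W ω) ∂P = 0)
    {p q : Type u} [Fintype p] [Fintype q] (L : p → StrongDual ℝ E) (M : q → StrongDual ℝ E)
    {ρ : ℝ} (h0 : 0 ≤ ρ) (h1 : ρ ≤ 1)
    (hρ : ∀ (x : p → ℝ) (y : q → ℝ), |cov[fun ω => ∑ i, x i * L i (W ω), fun ω => ∑ i, y i * M i (W ω); P]| ≤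
      ρ * (√Var[fun ω => ∑ i, x i * L i (W ω); P] * √Var[fun ω => ∑ i, y i * M i (W ω); P]))
    (x : p → ℝ) (y : q → ℝ) :
    |cov[fun ω => ∑ i, x i * hartley P (fun ω => L i (W ω)) ω,
        fun ω => ∑ i, y i * hartley P (fun ω => M i (W ω)) ω; P]| ≤
      ρ / 2 * (Var[fun ω => ∑ i, x i * hartley P (fun ω => L i (W ω)) ω; P] +
        Var[fun ω => ∑ i, y i * hartley P (fun ω => M i (W ω)) ω; P]) := by
  have hp := hW.isProbabilityMeasure
  have hG : ∀ A B : StrongDual ℝ E, HasGaussianLaw (fun ω => (A (W ω), B (W ω))) P :=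
    fun A B => hW.map_fun (A.prod B)
  have hm : ∀ A : StrongDual ℝ E, AEMeasurable (fun ω => A (W ω)) P := fun A =>
    (hW.map_fun A).aemeasurable
  have hL2 : ∀ A : StrongDual ℝ E, MemLp (fun ω => A (W ω)) 2 P := fun A =>
    (hW.map_fun A).memLp_two
  have hH : ∀ {r : Type u} [Fintype r] (A : r → StrongDual ℝ E) (z : r → ℝ),
      AEMeasurable (fun ω => ∑ i, z i * hartley P (fun ω => A i (W ω)) ω) P := by
    intro r _ A z
    have : ∀ i, AEMeasurable (fun ω => hartley P (fun ω => A i (W ω)) ω) P := fun i =>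
      (memLp_hartley (hm (A i)) 2).aemeasurable
    fun_prop
  have hS : ∀ {r : Type u} [Fintype r] (A : r → StrongDual ℝ E) (z : r → ℝ),
      AEMeasurable (fun ω => ∑ i, z i * A i (W ω)) P := by
    intro r _ A z
    have : ∀ i, AEMeasurable (fun ω => A i (W ω)) P := fun i => hm _
    fun_prop
  rw [← covariance_self (hH L x), ← covariance_self (hH M y),
    cov_sum_hartley (fun i j => hG _ _) (fun i => hW0 _) (fun i => hW0 _) (fun i => hm _)
      (fun i => hm _),
    cov_sum_hartley (fun i j => hG _ _) (fun i => hW0 _) (fun i => hW0 _) (fun i => hm _)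
      (fun i => hm _),
    cov_sum_hartley (fun i j => hG _ _) (fun i => hW0 _) (fun i => hW0 _) (fun i => hm _)
      (fun i => hm _)]
  have hq : ∀ {r : Type u} [Fintype r] (A : r → StrongDual ℝ E) (z : r → ℝ),
      ∑ i, ∑ j, z i * z j * cov[fun ω => A i (W ω), fun ω => A j (W ω); P]
        = Var[fun ω => ∑ i, z i * A i (W ω); P] := by
    intro r _ A z
    rw [← cov_sum_mul_sum_mul (fun i => hL2 (A i)) (fun i => hL2 (A i)), covariance_self (hS A z)]
  have hpsd : ∀ {r : Type u} [Fintype r] (A : r → StrongDual ℝ E),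
      (Matrix.of fun i j => cov[fun ω => A i (W ω), fun ω => A j (W ω); P]).PosSemidef := by
    intro r _ A
    refine posSemidef_of_symm_of_quadratic (fun i j => covariance_comm _ _) fun z => ?_
    simp only [Matrix.of_apply]
    rw [hq A z]
    exact variance_nonneg _ _
  refine abs_sum_exp_sub_one_le
    (A := Matrix.of fun i j => cov[fun ω => L i (W ω), fun ω => L j (W ω); P])
    (C := Matrix.of fun i j => cov[fun ω => L i (W ω), fun ω => M j (W ω); P])
    (B := Matrix.of fun i j => cov[fun ω => M i (W ω), fun ω => M j (W ω); P])
    h0 h1 (hpsd L) (hpsd M) ?_ x y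
  refine posSemidef_of_symm_of_quadratic ?_ fun z => ?_
  · rintro (i | i) (j | j) <;> simp [covariance_comm]
  · simp only [Fintype.sum_sum_type, Matrix.of_apply, Matrix.fromBlocks_apply₁₁,
      Matrix.fromBlocks_apply₁₂, Matrix.fromBlocks_apply₂₁, Matrix.fromBlocks_apply₂₂,
      Matrix.smul_apply, smul_eq_mul, Matrix.transpose_apply, Finset.sum_add_distrib]
    set u : p → ℝ := fun i => z (Sum.inl i)
    set v : q → ℝ := fun i => z (Sum.inr i)
    have a1 : ∑ i, ∑ j, u i * u j * (ρ * cov[fun ω => L i (W ω), fun ω => L j (W ω); P])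
        = ρ * Var[fun ω => ∑ i, u i * L i (W ω); P] := by
      rw [← hq]
      simp only [Finset.mul_sum]
      exact Finset.sum_congr rfl fun i _ => Finset.sum_congr rfl fun j _ => by ring
    have a2 : ∑ i, ∑ j, v i * v j * (ρ * cov[fun ω => M i (W ω), fun ω => M j (W ω); P])
        = ρ * Var[fun ω => ∑ i, v i * M i (W ω); P] := by
      rw [← hq]
      simp only [Finset.mul_sum]
      exact Finset.sum_congr rfl fun i _ => Finset.sum_congr rfl fun j _ => by ring
    have a3 : ∑ i, ∑ j, u i * v j * cov[fun ω => L i (W ω), fun ω => M j (W ω); P]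
        = cov[fun ω => ∑ i, u i * L i (W ω), fun ω => ∑ i, v i * M i (W ω); P] := by
      rw [← cov_sum_mul_sum_mul (fun i => hL2 (L i)) (fun i => hL2 (M i))]
    have a4 : ∑ j, ∑ i, v j * u i * cov[fun ω => L i (W ω), fun ω => M j (W ω); P]
        = cov[fun ω => ∑ i, u i * L i (W ω), fun ω => ∑ i, v i * M i (W ω); P] := by
      rw [← a3, Finset.sum_comm]
      exact Finset.sum_congr rfl fun i _ => Finset.sum_congr rfl fun j _ => by ring
    change 0 ≤ (∑ i, ∑ j, u i * u j * _) + (∑ i, ∑ j, v i * u j * _) +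
      ((∑ i, ∑ j, u i * v j * _) + ∑ i, ∑ j, v i * v j * _)
    rw [a1, a2, a3, a4]
    have hc := hρ u v
    set s := √Var[fun ω => ∑ i, u i * L i (W ω); P]
    set t := √Var[fun ω => ∑ i, v i * M i (W ω); P]
    have es : Var[fun ω => ∑ i, u i * L i (W ω); P] = s ^ 2 :=
      (Real.sq_sqrt (variance_nonneg _ _)).symm
    have et : Var[fun ω => ∑ i, v i * M i (W ω); P] = t ^ 2 :=
      (Real.sq_sqrt (variance_nonneg _ _)).symm
    -- With `s`, `t` the standard deviations, the bound `cov ≥ -ρ s t` turns the quadratic form of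
    -- the block matrix into at least `ρ (s - t)²`.
    rw [es, et]
    have := (abs_le.1 hc).1
    nlinarith [mul_nonneg h0 (sq_nonneg (s - t))]

/-! ### Elementary bounds for canonical correlations -/

lemma abs_covariance_le_sqrt_mul_sqrt [MeasurableSpace Ω] {P : Measure Ω} [IsFiniteMeasure P]
    {X Y : Ω → ℝ} (hX : MemLp X 2 P) (hY : MemLp Y 2 P) :
    |cov[X, Y; P]| ≤ √Var[X; P] * √Var[Y; P] := by
  have h : ∀ t : ℝ, 0 ≤ Var[X; P] * (t * t) + 2 * cov[X, Y; P] * t + Var[Y; P] := by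
    intro t
    have h1 := variance_nonneg (fun ω => t * X ω + Y ω) P
    rw [variance_fun_add (hX.const_mul t) hY, variance_const_mul, covariance_const_mul_left] at h1
    linarith
  have h2 := discrim_le_zero h
  rw [discrim] at h2
  rw [← Real.sqrt_mul (variance_nonneg _ _)]
  refine Real.abs_le_sqrt ?_
  nlinarith

lemma covariance_congr_ae [MeasurableSpace Ω] {P : Measure Ω} {X Y X' Y' : Ω → ℝ}
    (hX : X =ᵐ[P] X') (hY : Y =ᵐ[P] Y') : cov[X, Y; P] = cov[X', Y'; P] := by
  rw [covariance, covariance, integral_congr_ae hX, integral_congr_ae hY]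
  refine integral_congr_ae ?_
  filter_upwards [hX, hY] with ω h1 h2
  rw [h1, h2]

lemma abs_corr_le_one [MeasurableSpace Ω] {P : Measure Ω} [IsFiniteMeasure P]
    {X Y : Ω → ℝ} (hX : MemLp X 2 P) (hY : MemLp Y 2 P) : |corr X Y P| ≤ 1 := by
  have h0 : 0 ≤ √Var[X; P] * √Var[Y; P] := by positivity
  rw [corr, abs_div, abs_of_nonneg h0]
  exact div_le_one_of_le₀ (abs_covariance_le_sqrt_mul_sqrt hX hY) h0

lemma canonicalCorr_nonneg {ι κ : Type*} [Fintype ι] [Fintype κ] [MeasurableSpace Ω]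
    (U : Ω → ι → ℝ) (V : Ω → κ → ℝ) (P : Measure Ω) : 0 ≤ canonicalCorr U V P :=
  Real.iSup_nonneg fun _ => abs_nonneg _

lemma memLp_sum_mul {ι : Type*} [Fintype ι] [MeasurableSpace Ω] {P : Measure Ω}
    {U : Ω → ι → ℝ} (hU : ∀ i, MemLp (fun ω => U ω i) 2 P) (x : ι → ℝ) :
    MemLp (fun ω => ∑ i, x i * U ω i) 2 P :=
  memLp_finsetSum _ fun i _ => (hU i).const_mul _

lemma canonicalCorr_le_one {ι κ : Type*} [Fintype ι] [Fintype κ] [MeasurableSpace Ω]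
    {U : Ω → ι → ℝ} {V : Ω → κ → ℝ} {P : Measure Ω} [IsFiniteMeasure P]
    (hU : ∀ i, MemLp (fun ω => U ω i) 2 P) (hV : ∀ i, MemLp (fun ω => V ω i) 2 P) :
    canonicalCorr U V P ≤ 1 :=
  ciSup_le fun _ => abs_corr_le_one (memLp_sum_mul hU _) (memLp_sum_mul hV _)

lemma abs_cov_le_canonicalCorr_mul {ι κ : Type*} [Fintype ι] [Fintype κ] [MeasurableSpace Ω]
    {U : Ω → ι → ℝ} {V : Ω → κ → ℝ} {P : Measure Ω} [IsFiniteMeasure P]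
    (hU : ∀ i, MemLp (fun ω => U ω i) 2 P) (hV : ∀ i, MemLp (fun ω => V ω i) 2 P)
    (x : ι → ℝ) (y : κ → ℝ) :
    |cov[fun ω => ∑ i, x i * U ω i, fun ω => ∑ i, y i * V ω i; P]| ≤ canonicalCorr U V P *
      (√Var[fun ω => ∑ i, x i * U ω i; P] * √Var[fun ω => ∑ i, y i * V ω i; P]) := by
  have hb : BddAbove (range fun p : (ι → ℝ) × (κ → ℝ) =>
      |corr (fun ω => ∑ i, p.1 i * U ω i) (fun ω => ∑ j, p.2 j * V ω j) P|) :=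
    ⟨1, by rintro _ ⟨p, rfl⟩; exact abs_corr_le_one (memLp_sum_mul hU _) (memLp_sum_mul hV _)⟩
  have h1 : |corr _ _ P| ≤ canonicalCorr U V P := le_ciSup hb (x, y)
  have h2 := abs_covariance_le_sqrt_mul_sqrt (memLp_sum_mul hU x) (memLp_sum_mul hV y)
  set d := √Var[fun ω => ∑ i, x i * U ω i; P] * √Var[fun ω => ∑ i, y i * V ω i; P] with hd
  have hd0 : 0 ≤ d := by positivity
  rcases hd0.eq_or_lt with h | h
  -- If one of the variances vanishes, the correlation carries no information, but Cauchy–Schwarz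
  -- forces the covariance itself to vanish.
  · rw [← h] at h2 ⊢; simpa using h2
  · rw [corr, abs_div] at h1
    simp only [← hd, abs_of_pos h] at h1
    exact (div_le_iff₀ h).1 h1

/-- This is the totality of the Hartley functions of `X`. If `w` is orthogonal to all of them, the
signed measure `w P` pushed forward by `X` has zero Fourier transform, so it vanishes. -/
lemma integral_mul_indicator_eq_zero_of_hartley [MeasurableSpace Ω] {P : Measure Ω}
    [IsFiniteMeasure P] {E : Type*} [NormedAddCommGroup E] [NormedSpace ℝ E] [MeasurableSpace E]
    [BorelSpace E] [SecondCountableTopology E] [CompleteSpace E] {X : Ω → E}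
    (hX : AEMeasurable X P) {w : Ω → ℝ} (hw : Integrable w P)
    (h : ∀ L : StrongDual ℝ E, ∫ ω, w ω * hartley P (fun ω => L (X ω)) ω ∂P = 0)
    {A : Set E} (hA : MeasurableSet A) :
    ∫ ω, w ω * (X ⁻¹' A).indicator 1 ω ∂P = 0 := by
  have hm : ∀ L : StrongDual ℝ E, AEMeasurable (fun ω => L (X ω)) P := fun L =>
    L.continuous.measurable.comp_aemeasurable hX
  have hwm := hw.aemeasurable
  have hcosI : ∀ L : StrongDual ℝ E, Integrable (fun ω => w ω * Real.cos (L (X ω))) P := by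
    intro L
    have := hm L
    exact hw.mul_bdd (c := 1) (by fun_prop : AEMeasurable _ P).aestronglyMeasurable
      (ae_of_all _ fun ω => Real.abs_cos_le_one _)
  have hsinI : ∀ L : StrongDual ℝ E, Integrable (fun ω => w ω * Real.sin (L (X ω))) P := by
    intro L
    have := hm L
    exact hw.mul_bdd (c := 1) (by fun_prop : AEMeasurable _ P).aestronglyMeasurable
      (ae_of_all _ fun ω => Real.abs_sin_le_one _)
  have hcas : ∀ L : StrongDual ℝ E,
      ∫ ω, w ω * Real.cos (L (X ω)) ∂P + ∫ ω, w ω * Real.sin (L (X ω)) ∂P = 0 := by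
    intro L
    rw [← integral_add (hcosI L) (hsinI L)]
    have h1 := h L
    have e : ∀ ω, w ω * hartley P (fun ω => L (X ω)) ω = Real.exp (Var[fun ω => L (X ω); P] / 2) *
        (w ω * Real.cos (L (X ω)) + w ω * Real.sin (L (X ω))) := fun ω => by
      rw [hartley]; ring
    simp_rw [e] at h1
    rw [integral_const_mul] at h1
    exact (mul_eq_zero.1 h1).resolve_left (Real.exp_pos _).ne'
  have hcs : ∀ L : StrongDual ℝ E,
      ∫ ω, w ω * Real.cos (L (X ω)) ∂P = 0 ∧ ∫ ω, w ω * Real.sin (L (X ω)) ∂P = 0 := by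
    intro L
    have h1 := hcas L
    -- Replacing `L` by `-L` flips the sign of the sine only, which separates the cosine and sine
    -- integrals.
    have h2 := hcas (-L)
    simp only [neg_apply, Real.cos_neg, Real.sin_neg, mul_neg,
      integral_neg] at h2
    constructor <;> linarith
  have hexp : ∀ L : StrongDual ℝ E,
      Integrable (fun ω => (w ω : ℂ) * Complex.exp (((L (X ω) : ℝ) : ℂ) * Complex.I)) P := by
    intro L
    have := hm L
    refine (hw.ofReal (𝕜 := ℂ)).mul_bdd (c := 1)
      (by fun_prop : AEMeasurable _ P).aestronglyMeasurable (ae_of_all _ fun ω => ?_)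
    simp [Complex.norm_exp_ofReal_mul_I]
  have hzero : ∀ L : StrongDual ℝ E,
      ∫ ω, (w ω : ℂ) * Complex.exp (((L (X ω) : ℝ) : ℂ) * Complex.I) ∂P = 0 := by
    intro L
    apply Complex.ext
    · rw [← RCLike.re_eq_complex_re, ← integral_re (hexp L)]
      simpa [Complex.exp_ofReal_mul_I_re] using (hcs L).1
    · rw [← RCLike.im_eq_complex_im, ← integral_im (hexp L)]
      simpa [Complex.exp_ofReal_mul_I_im] using (hcs L).2
  -- The positive and negative parts of `w` are the densities of two finite measures. Their images
  -- under `X` will be identified through their characteristic functions.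
  have : IsFiniteMeasure (P.withDensity fun ω => ENNReal.ofReal (w ω)) :=
    isFiniteMeasure_withDensity_ofReal hw.2
  have : IsFiniteMeasure (P.withDensity fun ω => ENNReal.ofReal (-w ω)) :=
    isFiniteMeasure_withDensity_ofReal hw.neg.2
  have hX1 : AEMeasurable X (P.withDensity fun ω => ENNReal.ofReal (w ω)) :=
    hX.mono_ac (withDensity_absolutelyContinuous _ _)
  have hX2 : AEMeasurable X (P.withDensity fun ω => ENNReal.ofReal (-w ω)) :=
    hX.mono_ac (withDensity_absolutelyContinuous _ _)
  have key : ∀ (f : Ω → ℂ), Integrable (fun ω => (w ω : ℂ) * f ω) P →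
      ∫ ω, f ω ∂(P.withDensity fun ω => ENNReal.ofReal (w ω))
        - ∫ ω, f ω ∂(P.withDensity fun ω => ENNReal.ofReal (-w ω))
        = ∫ ω, (w ω : ℂ) * f ω ∂P := by
    intro f hf
    rw [integral_withDensity_eq_integral_toReal_smul₀ (by fun_prop)
      (ae_of_all _ fun _ => ENNReal.ofReal_lt_top),
      integral_withDensity_eq_integral_toReal_smul₀ (by fun_prop)
      (ae_of_all _ fun _ => ENNReal.ofReal_lt_top)]
    simp only [ENNReal.toReal_ofReal']
    have hI : ∀ s : Set ℝ, MeasurableSet s →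
        Integrable (fun ω => (s.indicator (fun _ => (1 : ℂ)) (w ω)) * ((w ω : ℂ) * f ω)) P := by
      intro s hs
      refine hf.bdd_mul (c := 1) ?_ (ae_of_all _ fun ω => ?_)
      · exact ((measurable_const.indicator hs).comp_aemeasurable hwm).aestronglyMeasurable
      · by_cases hx : w ω ∈ s <;> simp [hx]
    have e1 : (fun ω => max (w ω) 0 • f ω)
        = fun ω => ((Ioi 0).indicator (fun _ => (1 : ℂ)) (w ω)) * ((w ω : ℂ) * f ω) := by
      ext ω
      rcases lt_or_ge 0 (w ω) with hx | hx
      · simp [hx, hx.le]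
      · simp [hx, not_lt.2 hx]
    have e2 : (fun ω => max (-w ω) 0 • f ω)
        = fun ω => -(((Iio 0).indicator (fun _ => (1 : ℂ)) (w ω)) * ((w ω : ℂ) * f ω)) := by
      ext ω
      rcases lt_or_ge (w ω) 0 with hx | hx
      · simp [hx, hx.le]
      · simp [hx, not_lt.2 hx]
    rw [e1, e2, integral_neg, sub_neg_eq_add, ← integral_add (hI _ measurableSet_Ioi)
      (hI _ measurableSet_Iio)]
    refine integral_congr_ae (ae_of_all _ fun ω => ?_)
    rcases lt_trichotomy (w ω) 0 with hx | hx | hx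
    · simp [hx, hx.le]
    · simp [hx]
    · simp [hx, hx.le]
  have heq : (P.withDensity fun ω => ENNReal.ofReal (w ω)).map X
      = (P.withDensity fun ω => ENNReal.ofReal (-w ω)).map X := by
    refine Measure.ext_of_charFunDual (funext fun L => ?_)
    rw [charFunDual_apply, charFunDual_apply, integral_map hX1 (by fun_prop),
      integral_map hX2 (by fun_prop), ← sub_eq_zero, key _ (hexp L), hzero]
  have hfA : AEStronglyMeasurable (A.indicator (fun _ => (1 : ℂ))) ((P.withDensity fun ω =>
      ENNReal.ofReal (w ω)).map X) := (measurable_const.indicator hA).aestronglyMeasurable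
  have hiA : Integrable (fun ω => (w ω : ℂ) * A.indicator (fun _ => (1 : ℂ)) (X ω)) P := by
    refine (hw.ofReal (𝕜 := ℂ)).mul_bdd (c := 1) ?_ (ae_of_all _ fun ω => ?_)
    · exact ((measurable_const.indicator hA).comp_aemeasurable hX).aestronglyMeasurable
    · by_cases hx : X ω ∈ A <;> simp [hx]
  have h1 := key _ hiA
  rw [← integral_map hX1 hfA, ← integral_map hX2 (heq ▸ hfA), heq, sub_self] at h1
  have e : ∀ ω, (w ω : ℂ) * A.indicator (fun _ => (1 : ℂ)) (X ω)
      = ((w ω * (X ⁻¹' A).indicator 1 ω : ℝ) : ℂ) := by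
    intro ω
    by_cases hx : X ω ∈ A <;> simp [hx]
  simp_rw [e] at h1
  rw [integral_complex_ofReal] at h1
  exact_mod_cast h1.symm

/-- The closed span of the Hartley functions of a random vector. -/
def hartleySpan [MeasurableSpace Ω] {P : Measure Ω} [IsFiniteMeasure P] {E : Type*}
    [NormedAddCommGroup E] [NormedSpace ℝ E] [MeasurableSpace E] [BorelSpace E] {X : Ω → E}
    (hX : AEMeasurable X P) : Submodule ℝ (Lp ℝ 2 P) :=
  Submodule.span ℝ (range fun L : StrongDual ℝ E => (memLp_hartley (P := P)
    (L.continuous.measurable.comp_aemeasurable hX : AEMeasurable (fun ω => L (X ω)) P) 2).toLp)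

/-- In a Hilbert space the closure of a subspace is its double orthogonal complement, so it suffices
that every `w` orthogonal to the Hartley functions is orthogonal to the indicator. -/
lemma indicator_mem_closure_hartleySpan [MeasurableSpace Ω] {P : Measure Ω}
    [IsFiniteMeasure P] {E : Type*} [NormedAddCommGroup E] [NormedSpace ℝ E] [MeasurableSpace E]
    [BorelSpace E] [SecondCountableTopology E] [CompleteSpace E] {X : Ω → E}
    (hX : AEMeasurable X P) {A : Set E} (hA : MeasurableSet A)
    (hf : MemLp ((X ⁻¹' A).indicator (1 : Ω → ℝ)) 2 P) :
    hf.toLp ∈ closure (hartleySpan hX : Set (Lp ℝ 2 P)) := by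
  rw [← Submodule.topologicalClosure_coe, SetLike.mem_coe,
    ← Submodule.orthogonal_orthogonal_eq_closure, Submodule.mem_orthogonal]
  intro w hw
  rw [Submodule.mem_orthogonal] at hw
  rw [L2.inner_def]
  have hwi : Integrable w P := (Lp.memLp w).integrable (by norm_num)
  have h0 := integral_mul_indicator_eq_zero_of_hartley hX hwi (fun L => ?_) hA
  · rw [← h0]
    refine integral_congr_ae ?_
    filter_upwards [hf.coeFn_toLp] with ω hω
    rw [hω]
    simp [mul_comm]
  · have h1 := hw _ (Submodule.subset_span (mem_range_self L))
    rw [L2.inner_def] at h1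
    rw [← h1]
    refine integral_congr_ae ?_
    filter_upwards [(memLp_hartley (P := P)
      (L.continuous.measurable.comp_aemeasurable hX : AEMeasurable (fun ω => L (X ω)) P)
        2).coeFn_toLp] with ω hω
    rw [hω]
    simp [Function.comp_def]

lemma exists_sum_hartley_of_mem_hartleySpan [MeasurableSpace Ω] {P : Measure Ω}
    [IsFiniteMeasure P] {E : Type*} [NormedAddCommGroup E] [NormedSpace ℝ E] [MeasurableSpace E]
    [BorelSpace E] {X : Ω → E} (hX : AEMeasurable X P) {f : Lp ℝ 2 P} (hf : f ∈ hartleySpan hX) :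
    ∃ (s : Finset (StrongDual ℝ E)) (x : s → ℝ),
      f =ᵐ[P] fun ω => ∑ i, x i * hartley P (fun ω => (i : StrongDual ℝ E) (X ω)) ω := by
  classical
  obtain ⟨c, rfl⟩ := Finsupp.mem_span_range_iff_exists_finsupp.1 hf
  refine ⟨c.support, fun i => c i, ?_⟩
  set F : StrongDual ℝ E → Lp ℝ 2 P := fun L => (memLp_hartley (P := P)
    (L.continuous.measurable.comp_aemeasurable hX : AEMeasurable (fun ω => L (X ω)) P) 2).toLp
  have hF : ∀ᵐ ω ∂P, ∀ L ∈ c.support, F L ω = hartley P (fun ω => L (X ω)) ω :=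
    (ae_ball_iff c.support.countable_toSet).2 fun L _ => MemLp.coeFn_toLp _
  have hsum : (c.sum fun i a => a • F i : Lp ℝ 2 P) =ᵐ[P] fun ω => ∑ i ∈ c.support, c i * F i ω := by
    rw [Finsupp.sum]
    induction c.support using Finset.induction_on with
    | empty =>
      filter_upwards [Lp.coeFn_zero ℝ 2 P] with ω h
      simpa using h
    | insert i t hi ih =>
      rw [Finset.sum_insert hi]
      filter_upwards [Lp.coeFn_add (c i • F i) (∑ j ∈ t, c j • F j), Lp.coeFn_smul (c i) (F i), ih]
        with ω h1 h2 h3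
      rw [h1, Pi.add_apply, h2, h3, Finset.sum_insert hi]
      rfl
  filter_upwards [hF, hsum] with ω h1 h2
  rw [h2, ← Finset.sum_coe_sort]
  exact Finset.sum_congr rfl fun i _ => by rw [h1 i i.2]

/-- **Gebelein's inequality**: the covariance of events depending on two jointly Gaussian vectors
is bounded by the canonical correlation of the vectors. -/
theorem abs_cov_indicator_le_canonicalCorr {ι κ : Type u} [Fintype ι] [Fintype κ]
    [MeasurableSpace Ω] {P : Measure Ω} {U : Ω → ι → ℝ} {V : Ω → κ → ℝ}
    (hUV : HasGaussianLaw (fun ω => (U ω, V ω)) P) (hU0 : ∀ i, ∫ ω, U ω i ∂P = 0)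
    (hV0 : ∀ i, ∫ ω, V ω i ∂P = 0) {A : Set (ι → ℝ)} {B : Set (κ → ℝ)} (hA : MeasurableSet A)
    (hB : MeasurableSet B) :
    |cov[(U ⁻¹' A).indicator (1 : Ω → ℝ), (V ⁻¹' B).indicator (1 : Ω → ℝ); P]|
      ≤ canonicalCorr U V P := by
  classical
  have hp := hUV.isProbabilityMeasure
  have hU := hUV.fst
  have hV := hUV.snd
  have hUm := hU.aemeasurable
  have hVm := hV.aemeasurable
  have hU2 : ∀ i, MemLp (fun ω => U ω i) 2 P := fun i => (hU.eval i).memLp_two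
  have hV2 : ∀ i, MemLp (fun ω => V ω i) 2 P := fun i => (hV.eval i).memLp_two
  have hρ0 := canonicalCorr_nonneg U V P
  have hρ1 := canonicalCorr_le_one hU2 hV2
  set ρ := canonicalCorr U V P with hρ
  -- A combination of linear functionals of the vector is a combination of its coordinates, which is
  -- the form that enters `canonicalCorr`.
  have hexpand : ∀ {r : Type u} [Fintype r] (T : Ω → r → ℝ) (s : Finset (StrongDual ℝ (r → ℝ)))
      (x : s → ℝ) (ω : Ω), ∑ L, x L * (L : StrongDual ℝ (r → ℝ)) (T ω) =
        ∑ j, (∑ L, x L * (L : StrongDual ℝ (r → ℝ)) (fun i => if j = i then 1 else 0)) * T ω j := by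
    intro r _ T s x ω
    simp only [Finset.sum_mul]
    rw [Finset.sum_comm]
    refine Finset.sum_congr rfl fun L _ => ?_
    have := LinearMap.pi_apply_eq_sum_univ ((L : StrongDual ℝ (r → ℝ)) : (r → ℝ) →ₗ[ℝ] ℝ) (T ω)
    rw [ContinuousLinearMap.coe_coe] at this
    rw [this, Finset.mul_sum]
    refine Finset.sum_congr rfl fun j _ => ?_
    rw [smul_eq_mul]; ring
  have hzero : ∀ {r : Type u} [Fintype r] {T : Ω → r → ℝ} (hT : ∀ i, MemLp (fun ω => T ω i) 2 P)
      (hT0 : ∀ i, ∫ ω, T ω i ∂P = 0) (L : StrongDual ℝ (r → ℝ)), ∫ ω, L (T ω) ∂P = 0 := by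
    intro r _ T hT hT0 L
    have e : ∀ ω, L (T ω) = ∑ j, T ω j * L (fun i => if j = i then 1 else 0) := fun ω =>
      LinearMap.pi_apply_eq_sum_univ (L : (r → ℝ) →ₗ[ℝ] ℝ) (T ω)
    simp_rw [e]
    rw [integral_finsetSum _ fun i _ => ((hT i).integrable (by norm_num)).mul_const _]
    refine Finset.sum_eq_zero fun j _ => ?_
    rw [integral_mul_const, hT0, zero_mul]
  have hspan : ∀ F ∈ hartleySpan hUm, ∀ G ∈ hartleySpan hVm,
      |cov[F, G; P]| ≤ ρ / 2 * (Var[F; P] + Var[G; P]) := by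
    intro F hF G hG
    obtain ⟨s, x, hx⟩ := exists_sum_hartley_of_mem_hartleySpan hUm hF
    obtain ⟨t, y, hy⟩ := exists_sum_hartley_of_mem_hartleySpan hVm hG
    rw [variance_congr hx, variance_congr hy, covariance_congr_ae hx hy]
    refine abs_cov_sum_hartley_le hUV (fun L => ?_)
      (fun i : s => (i : StrongDual ℝ (ι → ℝ)).comp (ContinuousLinearMap.fst ℝ _ _))
      (fun i : t => (i : StrongDual ℝ (κ → ℝ)).comp (ContinuousLinearMap.snd ℝ _ _))
      hρ0 hρ1 (fun a b => ?_) x y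
    · have e : ∀ ω, L (U ω, V ω) = L.comp (ContinuousLinearMap.inl ℝ _ _) (U ω)
          + L.comp (ContinuousLinearMap.inr ℝ _ _) (V ω) := by
        intro ω
        simp [← map_add]
      simp_rw [e]
      rw [integral_add (hU.map_fun _).integrable (hV.map_fun _).integrable, hzero hU2 hU0,
        hzero hV2 hV0, add_zero]
    · simp only [ContinuousLinearMap.comp_apply, ContinuousLinearMap.coe_fst',
        ContinuousLinearMap.coe_snd']
      simp_rw [hexpand U s a, hexpand V t b]
      exact abs_cov_le_canonicalCorr_mul hU2 hV2 _ _
  have hcov : ∀ F G : Lp ℝ 2 P, cov[F, G; P] = inner ℝ F G -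
      inner ℝ F ((memLp_const (1 : ℝ)).toLp) * inner ℝ G ((memLp_const (1 : ℝ)).toLp) := by
    have hint : ∀ F : Lp ℝ 2 P, ∫ ω, F ω ∂P = inner ℝ F ((memLp_const (1 : ℝ)).toLp) := by
      intro F
      rw [L2.inner_def]
      refine integral_congr_ae ?_
      filter_upwards [(memLp_const (μ := P) (p := 2) (1 : ℝ)).coeFn_toLp] with ω hω
      rw [hω]; simp
    intro F G
    rw [covariance_eq_sub (Lp.memLp F) (Lp.memLp G), hint, hint, L2.inner_def]
    congr 1
    refine integral_congr_ae (ae_of_all _ fun ω => ?_)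
    simp [mul_comm]
  have hvar : ∀ F : Lp ℝ 2 P, Var[F; P] = inner ℝ F F -
      inner ℝ F ((memLp_const (1 : ℝ)).toLp) * inner ℝ F ((memLp_const (1 : ℝ)).toLp) := by
    intro F
    rw [← covariance_self (Lp.memLp F).aemeasurable, hcov]
  -- Covariance and variance are continuous in `L²`, so the inequality passes from the two spans to
  -- their closures, which contain the indicators. Indicators have variance at most `1`, so the
  -- right side becomes `ρ`.
  have hclosed : IsClosed {p : Lp ℝ 2 P × Lp ℝ 2 P |
      |cov[p.1, p.2; P]| ≤ ρ / 2 * (Var[p.1; P] + Var[p.2; P])} := by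
    simp_rw [hcov, hvar]
    exact isClosed_le (by fun_prop) (by fun_prop)
  have hsub : closure ((hartleySpan hUm : Set (Lp ℝ 2 P)) ×ˢ (hartleySpan hVm : Set (Lp ℝ 2 P))) ⊆
      {p : Lp ℝ 2 P × Lp ℝ 2 P | |cov[p.1, p.2; P]| ≤ ρ / 2 * (Var[p.1; P] + Var[p.2; P])} :=
    closure_minimal (fun p hp => hspan _ hp.1 _ hp.2) hclosed
  have hmem : ∀ {r : Type u} [Fintype r] {T : Ω → r → ℝ} (hT : AEMeasurable T P)
      {C : Set (r → ℝ)} (hC : MeasurableSet C), MemLp ((T ⁻¹' C).indicator (1 : Ω → ℝ)) 2 P := by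
    intro r _ T hT C hC
    refine MemLp.of_bound (C := 1) ?_ (ae_of_all _ fun ω => ?_)
    · exact ((measurable_const.indicator hC).comp_aemeasurable hT : AEMeasurable
        ((C.indicator (fun _ => (1 : ℝ))) ∘ T) P).aestronglyMeasurable
    · by_cases h : ω ∈ T ⁻¹' C <;> simp [h]
  have hvarle : ∀ {r : Type u} [Fintype r] {T : Ω → r → ℝ} (hT : AEMeasurable T P)
      {C : Set (r → ℝ)} (hC : MeasurableSet C),
      Var[(T ⁻¹' C).indicator (1 : Ω → ℝ); P] ≤ 1 := by
    intro r _ T hT C hC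
    refine (variance_le_expectation_sq (hmem hT hC).aestronglyMeasurable).trans ?_
    refine (integral_mono_of_nonneg (ae_of_all _ fun ω => sq_nonneg _) (integrable_const (1 : ℝ))
      (ae_of_all _ fun ω => ?_)).trans (by simp)
    by_cases h : ω ∈ T ⁻¹' C <;> simp [h]
  have h := hsub (a := ((hmem hUm hA).toLp, (hmem hVm hB).toLp)) (by
    rw [closure_prod_eq]
    exact ⟨indicator_mem_closure_hartleySpan hUm hA (hmem hUm hA),
      indicator_mem_closure_hartleySpan hVm hB (hmem hVm hB)⟩)
  rw [mem_ofPred_eq] at h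
  rw [variance_congr (hmem hUm hA).coeFn_toLp, variance_congr (hmem hVm hB).coeFn_toLp,
    covariance_congr_ae (hmem hUm hA).coeFn_toLp (hmem hVm hB).coeFn_toLp] at h
  refine h.trans ?_
  have h1 := hvarle hUm hA
  have h2 := hvarle hVm hB
  have := mul_le_mul_of_nonneg_left (add_le_add h1 h2) (div_nonneg hρ0 zero_le_two)
  linarith

/-! ### The `M₂` topology -/

lemma CadlagSpace.exists_bound (f : CadlagSpace) : ∃ C, 0 ≤ C ∧ ∀ t, |f t| ≤ C := by
  have h : ∃ C, 0 ≤ C ∧ ∀ t ∈ (univ : Set I), |f t| ≤ C := by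
    refine isCompact_univ.induction_on (p := fun s => ∃ C, 0 ≤ C ∧ ∀ t ∈ s, |f t| ≤ C)
      ⟨0, le_rfl, by simp⟩ ?_ ?_ ?_
    · rintro s t hst ⟨C, hC, h⟩
      exact ⟨C, hC, fun x hx => h x (hst hx)⟩
    · rintro s t ⟨C, hC, h⟩ ⟨D, hD, h'⟩
      refine ⟨max C D, le_max_of_le_left hC, ?_⟩
      rintro x (hx | hx)
      · exact (h x hx).trans (le_max_left _ _)
      · exact (h' x hx).trans (le_max_right _ _)
    · intro t _
      obtain ⟨L, hL⟩ := f.leftLimits t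
      have h1 : ∀ᶠ s in 𝓝[<] t, |f s| < |L| + 1 := hL.abs.eventually_lt_const (by linarith)
      have h2 : ∀ᶠ s in 𝓝[≥] t, |f s| < |f t| + 1 :=
        (f.rightContinuous t).tendsto.abs.eventually_lt_const (by linarith)
      have h3 : ∀ᶠ s in 𝓝 t, |f s| ≤ max (|L| + 1) (|f t| + 1) := by
        rw [← nhdsLT_sup_nhdsGE, eventually_sup]
        exact ⟨h1.mono fun s hs => hs.le.trans (le_max_left _ _),
          h2.mono fun s hs => hs.le.trans (le_max_right _ _)⟩
      rw [nhdsWithin_univ]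
      exact ⟨_, h3, _, le_max_of_le_left (by positivity), fun s hs => hs⟩
  obtain ⟨C, hC, h⟩ := h
  exact ⟨C, hC, fun t => h t (mem_univ t)⟩

/-- The filter includes `t` itself, so that the convention `leftLim f 0 = f 0` at the left end point
is covered. -/
lemma leftLim_mem_of_isClosed {f : I → ℝ} {t : I} {K : Set ℝ} (hK : IsClosed K)
    (h : ∀ᶠ s in 𝓝[≤] t, f s ∈ K) : Function.leftLim f t ∈ K := by
  by_contra hn
  have h1 := (mapClusterPt_leftLim f t).frequently (hK.isOpen_compl.mem_nhds hn)
  obtain ⟨s, hs1, hs2⟩ := (h1.and_eventually h).exists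
  exact hs1 hs2

lemma uIcc_leftLim_subset_of_eventually {f : I → ℝ} {t : I} {a r : ℝ}
    (h : ∀ᶠ s in 𝓝 t, f s ∈ Metric.closedBall a r) :
    uIcc (Function.leftLim f t) (f t) ⊆ Metric.closedBall a r := by
  have h1 := leftLim_mem_of_isClosed Metric.isClosed_closedBall (h.filter_mono nhdsWithin_le_nhds)
  have h2 := h.self_of_nhds
  rw [Real.closedBall_eq_Icc] at *
  exact uIcc_subset_Icc h1 h2

lemma mem_completedGraph (f : CadlagSpace) (t : I) : (t, f t) ∈ completedGraph f :=
  right_mem_uIcc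

/-- `M₂` convergence implies convergence at the continuity points of the limit. -/
lemma tendsto_eval_of_continuousAt {f : CadlagSpace} {t : I} (hf : ContinuousAt f.toFun t) :
    Tendsto (fun g : CadlagSpace => g t) (𝓝 f) (𝓝 (f t)) := by
  rw [Metric.tendsto_nhds]
  intro ε hε
  have h1 : ∀ᶠ s in 𝓝 t, f s ∈ Metric.closedBall (f t) (ε / 2) :=
    hf (Metric.closedBall_mem_nhds _ (by positivity))
  obtain ⟨δ, hδ, hball⟩ := Metric.eventually_nhds_iff_ball.1 (eventually_eventually_nhds.2 h1)
  -- A point of the completed graph of `f` within this distance of `(t, g t)` has time within `δ` of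
  -- `t`, hence height within `ε / 2` of `f t`; the other `ε / 2` pays for the distance from `g t`
  -- to that height.
  have hr : 0 < min δ (ε / 2) := by positivity
  filter_upwards [Metric.eball_mem_nhds f (ENNReal.ofReal_pos.2 hr)] with g hg
  obtain ⟨⟨s, y⟩, hy, hd⟩ := Metric.exists_edist_lt_of_hausdorffEDist_lt
    (mem_completedGraph g t) (show Metric.hausdorffEDist (completedGraph g) (completedGraph f) < _
      from hg)
  rw [edist_dist, ENNReal.ofReal_lt_ofReal_iff hr, Prod.dist_eq, max_lt_iff] at hd
  have hs : s ∈ Metric.ball t δ := by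
    rw [Metric.mem_ball, dist_comm]; exact hd.1.trans_le (min_le_left _ _)
  have h2 := uIcc_leftLim_subset_of_eventually (hball s hs) hy
  calc dist (g t) (f t) ≤ dist (g t) y + dist y (f t) := dist_triangle _ _ _
    _ < ε / 2 + ε / 2 := add_lt_add_of_lt_of_le (hd.2.trans_le (min_le_right _ _)) h2
    _ = ε := by ring

/-- The completed graph of `f` stays in the strip of height `C`, and a Hausdorff distance below `1`
enlarges the strip by at most `1`. This supplies the dominating constant for integrals along
`M₂`-convergent families. -/
lemma eventually_forall_abs_le {f : CadlagSpace} {C : ℝ} (hC : ∀ t, |f t| ≤ C) :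
    ∀ᶠ g in 𝓝 f, ∀ t, |(g : CadlagSpace) t| ≤ C + 1 := by
  filter_upwards [Metric.eball_mem_nhds f (ENNReal.ofReal_pos.2 one_pos)] with g hg t
  obtain ⟨⟨s, y⟩, hy, hd⟩ := Metric.exists_edist_lt_of_hausdorffEDist_lt
    (mem_completedGraph g t) (show Metric.hausdorffEDist (completedGraph g) (completedGraph f) < _
      from hg)
  rw [edist_dist, ENNReal.ofReal_lt_ofReal_iff one_pos, Prod.dist_eq, max_lt_iff] at hd
  have h2 := uIcc_leftLim_subset_of_eventually (f := f.toFun) (t := s) (a := 0) (r := C)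
    (Eventually.of_forall fun s => by simpa using hC s) hy
  have h3 : |y| ≤ C := by simpa using h2
  have h4 : |g t - y| < 1 := hd.2
  have := abs_sub_abs_le_abs_sub (g t) y
  linarith

/-- By right continuity `f` is the pointwise limit of `f ∘ r n`, where `r n` rounds up to a grid of
mesh `1 / (n + 1)`, clipped to the unit interval, and takes its values through an integer floor. -/
lemma CadlagSpace.measurable_toFun (f : CadlagSpace) : Measurable f.toFun := by
  set r : ℕ → I → I := fun n s => Set.projIcc 0 1 zero_le_one
    (((⌊((n : ℝ) + 1) * (s : ℝ)⌋ : ℤ) + 1 : ℝ) / ((n : ℝ) + 1))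
  have hval : ∀ n s, ((r n s : I) : ℝ) = max 0 (min 1
      (((⌊((n : ℝ) + 1) * (s : ℝ)⌋ : ℤ) + 1 : ℝ) / ((n : ℝ) + 1))) := fun n s => by
    simp [r, Set.coe_projIcc]
  have hge : ∀ n s, s ≤ r n s := by
    intro n s
    rw [← Subtype.coe_le_coe, hval]
    refine le_max_of_le_right (le_min s.2.2 ?_)
    rw [le_div_iff₀ (by positivity), mul_comm]
    exact (Int.lt_floor_add_one _).le
  have hle : ∀ n s, ((r n s : I) : ℝ) ≤ s + 1 / ((n : ℝ) + 1) := by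
    intro n s
    rw [hval]
    refine max_le (add_nonneg s.2.1 (by positivity)) ((min_le_right _ _).trans ?_)
    have e : ((s : ℝ) + 1 / ((n : ℝ) + 1)) * ((n : ℝ) + 1) = ((n : ℝ) + 1) * s + 1 := by
      field_simp
    rw [div_le_iff₀ (by positivity), e]
    have := Int.floor_le (((n : ℝ) + 1) * (s : ℝ))
    linarith
  refine measurable_of_tendsto_metrizable (f := fun n s => f (r n s)) (fun n => ?_) ?_
  · have h1 : Measurable fun s : I => ⌊((n : ℝ) + 1) * (s : ℝ)⌋ :=
      Int.measurable_floor.comp (by fun_prop)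
    exact (measurable_from_top (f := fun k : ℤ => f (Set.projIcc 0 1 zero_le_one
      (((k : ℤ) + 1 : ℝ) / ((n : ℝ) + 1))))).comp h1
  · refine tendsto_pi_nhds.2 fun s => (f.rightContinuous s).tendsto.comp ?_
    refine tendsto_nhdsWithin_iff.2 ⟨?_, Eventually.of_forall fun n => hge n s⟩
    rw [tendsto_subtype_rng]
    refine tendsto_of_tendsto_of_tendsto_of_le_of_le tendsto_const_nhds ?_
      (fun n => Subtype.coe_le_coe.2 (hge n s)) (fun n => hle n s)
    simpa using tendsto_const_nhds.add (tendsto_one_div_add_atTop_nhds_zero_nat (𝕜 := ℝ))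

lemma CadlagSpace.continuousAt_iff_leftLim_eq (f : CadlagSpace) (t : I) :
    ContinuousAt f.toFun t ↔ Function.leftLim f.toFun t = f t := by
  constructor
  · intro h
    exact h.continuousWithinAt.leftLim_eq
  · intro h
    rw [continuousAt_iff_continuous_left'_right']
    refine ⟨?_, (f.rightContinuous t).mono Ioi_subset_Ici_self⟩
    have := tendsto_leftLim_of_tendsto (f.leftLimits t)
    rwa [h] at this

/-- Jumps larger than a fixed `ε` are isolated: every point has a punctured neighbourhood without
any. They form a locally null set, and `ε` runs through a sequence tending to zero. -/
lemma CadlagSpace.ae_continuousAt (f : CadlagSpace) : ∀ᵐ t : I, ContinuousAt f.toFun t := by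
  have h : ∀ n : ℕ, volume {t : I | 1 / ((n : ℝ) + 1) < |f t - Function.leftLim f.toFun t|} = 0 := by
    intro n
    set ε := 1 / ((n : ℝ) + 1) with hε
    have hε0 : 0 < ε := by positivity
    refine measure_null_of_locally_null _ fun t _ => ?_
    -- Common to both sides of `t`: where `f` stays within `ε / 2` of its one-sided limit `a` on a
    -- full neighbourhood of `s`, both `f s` and its left limit are within `ε / 2` of `a`.
    have key : ∀ (a : ℝ) (F : Filter I), Tendsto f.toFun F (𝓝 a) →
        (∀ U ∈ F, ∀ᶠ s in F, U ∈ 𝓝 s) →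
        ∀ᶠ s in F, |f s - Function.leftLim f.toFun s| ≤ ε := by
      intro a F hF hopen
      have h1 : {s | f s ∈ Metric.closedBall a (ε / 2)} ∈ F :=
        hF (Metric.closedBall_mem_nhds _ (by positivity))
      filter_upwards [hopen _ h1] with s hs
      have h2 := uIcc_leftLim_subset_of_eventually hs
      have h3 := h2 left_mem_uIcc
      have h4 := h2 right_mem_uIcc
      rw [Metric.mem_closedBall, Real.dist_eq, abs_le] at h3 h4
      rw [abs_le]
      constructor <;> linarith
    have hleft : ∀ᶠ s in 𝓝[<] t, |f s - Function.leftLim f.toFun s| ≤ ε := by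
      obtain ⟨L, hL⟩ := f.leftLimits t
      refine key L _ hL fun U hU => ?_
      have := eventually_eventually_nhdsWithin.2 (show ∀ᶠ s in 𝓝[<] t, s ∈ U from hU)
      filter_upwards [this, self_mem_nhdsWithin] with s hs hst
      rwa [isOpen_Iio.nhdsWithin_eq hst] at hs
    have hright : ∀ᶠ s in 𝓝[>] t, |f s - Function.leftLim f.toFun s| ≤ ε := by
      refine key (f t) _ ((f.rightContinuous t).mono Ioi_subset_Ici_self) fun U hU => ?_
      have := eventually_eventually_nhdsWithin.2 (show ∀ᶠ s in 𝓝[>] t, s ∈ U from hU)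
      filter_upwards [this, self_mem_nhdsWithin] with s hs hst
      rwa [isOpen_Ioi.nhdsWithin_eq hst] at hs
    have hne : ∀ᶠ s in 𝓝[≠] t, |f s - Function.leftLim f.toFun s| ≤ ε := by
      rw [← nhdsLT_sup_nhdsGT, eventually_sup]
      exact ⟨hleft, hright⟩
    refine ⟨{t}, ?_, measure_singleton t⟩
    rw [mem_nhdsWithin_iff_eventually]
    filter_upwards [eventually_nhdsWithin_iff.1 hne] with s hs hs'
    by_contra hst
    exact absurd (hs hst) (not_le.2 hs')
  have h2 : ∀ᵐ t : I, ∀ n : ℕ, |f t - Function.leftLim f.toFun t| ≤ 1 / ((n : ℝ) + 1) := by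
    rw [ae_all_iff]
    intro n
    rw [ae_iff]
    simpa only [not_le] using h n
  filter_upwards [h2] with t ht
  rw [f.continuousAt_iff_leftLim_eq]
  have h0 : |f t - Function.leftLim f.toFun t| ≤ 0 :=
    ge_of_tendsto' tendsto_one_div_add_atTop_nhds_zero_nat ht
  linarith [abs_eq_zero.1 (le_antisymm h0 (abs_nonneg _))]

/-! ### The normalizing functionals -/

/-- The discretized version `∫₀¹ (f(s) - n⁻¹ ⌊n s⌋ f(1))² ds` of the squared normalizer. -/
def discreteSqNorm (n : ℕ) (f : CadlagSpace) : ℝ :=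
  ∫ s : I, (f s - (⌊(n : ℝ) * (s : ℝ)⌋ : ℝ) / n * f 1) ^ 2

/-- The squared normalizer `∫₀¹ (f(s) - s f(1))² ds`. -/
def limitSqNorm (f : CadlagSpace) : ℝ := ∫ s : I, (f s - (s : ℝ) * f 1) ^ 2

lemma floor_div_mem_Icc (n : ℕ) (s : I) : (⌊(n : ℝ) * (s : ℝ)⌋ : ℝ) / n ∈ Icc (0 : ℝ) 1 := by
  have h0 : 0 ≤ (n : ℝ) * (s : ℝ) := mul_nonneg n.cast_nonneg s.2.1
  refine ⟨div_nonneg (by exact_mod_cast Int.floor_nonneg.2 h0) n.cast_nonneg, ?_⟩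
  refine div_le_one_of_le₀ ((Int.floor_le _).trans ?_) n.cast_nonneg
  exact mul_le_of_le_one_right n.cast_nonneg s.2.2

lemma tendsto_floor_div (s : I) :
    Tendsto (fun n : ℕ => (⌊(n : ℝ) * (s : ℝ)⌋ : ℝ) / n) atTop (𝓝 s) := by
  have h := (tendsto_nat_floor_mul_div_atTop (R := ℝ) s.2.1).comp tendsto_natCast_atTop_atTop
  refine h.congr fun n => ?_
  have h0 : 0 ≤ (n : ℝ) * (s : ℝ) := mul_nonneg n.cast_nonneg s.2.1
  simp only [Function.comp]
  rw [mul_comm (s : ℝ), ← natCast_floor_eq_intCast_floor h0]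

/-- Dominated convergence: `M₂` convergence gives convergence at almost every time and an eventual
uniform bound. Continuity at `1` is needed because the end value enters the integrand at every time.
The weights `τ` allow both `⌊n s⌋ / n` and `s`. -/
lemma tendsto_weightedSqNorm {α : Type*} {l : Filter α} [l.IsCountablyGenerated]
    {g : α → CadlagSpace} {τ : α → I → ℝ} {f : CadlagSpace} (hg : Tendsto g l (𝓝 f))
    (hm : ∀ a, Measurable (τ a)) (hτ : ∀ a s, τ a s ∈ Icc (0 : ℝ) 1)
    (hlim : ∀ s : I, Tendsto (fun a => τ a s) l (𝓝 s)) (hf : ContinuousAt f.toFun 1) :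
    Tendsto (fun a => ∫ s : I, (g a s - τ a s * g a 1) ^ 2) l (𝓝 (limitSqNorm f)) := by
  obtain ⟨C, hC0, hC⟩ := f.exists_bound
  refine tendsto_integral_filter_of_dominated_convergence (fun _ => (2 * (C + 1)) ^ 2) ?_ ?_
    (integrable_const _) ?_
  · refine Eventually.of_forall fun a => ?_
    exact ((((g a).measurable_toFun.sub ((hm a).mul_const _))).pow_const 2).aestronglyMeasurable
  · filter_upwards [hg.eventually (eventually_forall_abs_le hC)] with a ha
    refine ae_of_all _ fun s => ?_
    rw [Real.norm_eq_abs, abs_of_nonneg (sq_nonneg _), sq_le_sq, abs_of_nonneg (by positivity :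
      0 ≤ 2 * (C + 1))]
    obtain ⟨h1, h2⟩ := hτ a s
    calc _ ≤ |g a s| + |τ a s * g a 1| := abs_sub _ _
      _ ≤ (C + 1) + 1 * (C + 1) := by
        rw [abs_mul, abs_of_nonneg h1]
        exact add_le_add (ha s) (mul_le_mul h2 (ha 1) (abs_nonneg _) zero_le_one)
      _ = _ := by ring
  · filter_upwards [f.ae_continuousAt] with s hs
    exact (((tendsto_eval_of_continuousAt hs).comp hg).sub
      ((hlim s).mul ((tendsto_eval_of_continuousAt hf).comp hg))).pow 2

lemma tendsto_discreteSqNorm {f : CadlagSpace} (hf : ContinuousAt f.toFun 1) :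
    Tendsto (fun p : ℕ × CadlagSpace => discreteSqNorm p.1 p.2) (atTop ×ˢ 𝓝 f)
      (𝓝 (limitSqNorm f)) := by
  refine tendsto_weightedSqNorm (g := Prod.snd)
    (τ := fun (p : ℕ × CadlagSpace) s => (⌊(p.1 : ℝ) * (s : ℝ)⌋ : ℝ) / p.1) tendsto_snd (fun p => ?_)
    (fun p s => floor_div_mem_Icc p.1 s) (fun s => (tendsto_floor_div s).comp tendsto_fst) hf
  have h2 : Measurable fun s : I => ((⌊(p.1 : ℝ) * (s : ℝ)⌋ : ℤ) : ℝ) :=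
    measurable_from_top.comp (Int.measurable_floor.comp (by fun_prop))
  exact h2.div_const _

lemma continuousAt_limitSqNorm {f : CadlagSpace} (hf : ContinuousAt f.toFun 1) :
    ContinuousAt limitSqNorm f := by
  change Tendsto (fun g : CadlagSpace => ∫ s : I, (g s - (s : ℝ) * g 1) ^ 2) (𝓝 f) _
  exact tendsto_weightedSqNorm (g := fun g => g) (τ := fun _ s => (s : ℝ)) tendsto_id (fun _ => by fun_prop)
    (fun _ s => s.2) (fun _ => tendsto_const_nhds) hf

lemma continuousAt_limitFunctional {f : CadlagSpace} (hf : ContinuousAt f.toFun 1)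
    (h0 : 0 < limitSqNorm f) : ContinuousAt limitFunctional f := by
  change Tendsto (fun g : CadlagSpace => g 1 / √(limitSqNorm g)) (𝓝 f)
    (𝓝 (f 1 / √(limitSqNorm f)))
  exact (tendsto_eval_of_continuousAt hf).div (continuousAt_limitSqNorm hf).sqrt
    (Real.sqrt_pos.2 h0).ne'

/-- The functional whose value at the normalized partial sum process is the self-normalized
statistic. -/
def discreteFunctional (n : ℕ) (f : CadlagSpace) : ℝ := f 1 / √(discreteSqNorm n f)

lemma tendsto_discreteFunctional {f : CadlagSpace} (hf : ContinuousAt f.toFun 1)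
    (h0 : 0 < limitSqNorm f) :
    Tendsto (fun p : ℕ × CadlagSpace => discreteFunctional p.1 p.2) (atTop ×ˢ 𝓝 f)
      (𝓝 (limitFunctional f)) :=
  ((tendsto_eval_of_continuousAt hf).comp tendsto_snd).div (tendsto_discreteSqNorm hf).sqrt
    (Real.sqrt_pos.2 h0).ne'

lemma limitSqNorm_nonneg (f : CadlagSpace) : 0 ≤ limitSqNorm f :=
  integral_nonneg fun _ => sq_nonneg _

/-- The path agrees almost everywhere with a linear function. Right continuity would turn an
exceptional time `t < 1` into an exceptional interval of positive length, and at `t = 1` the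
identity is trivial. -/
lemma eq_linear_of_limitSqNorm_eq_zero {f : CadlagSpace} (h : limitSqNorm f = 0) (t : I) :
    f t = (t : ℝ) * f 1 := by
  obtain ⟨C, hC0, hC⟩ := f.exists_bound
  have hm := f.measurable_toFun
  have hI : Integrable fun s : I => (f s - (s : ℝ) * f 1) ^ 2 := by
    refine Integrable.of_bound (C := (2 * C) ^ 2)
      (by fun_prop : Measurable _).aestronglyMeasurable (ae_of_all _ fun s => ?_)
    rw [Real.norm_eq_abs, abs_of_nonneg (sq_nonneg _), sq_le_sq, abs_of_nonneg (by positivity :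
      0 ≤ 2 * C)]
    calc _ ≤ |f s| + |(s : ℝ) * f 1| := abs_sub _ _
      _ ≤ C + 1 * C := by
        rw [abs_mul, abs_of_nonneg s.2.1]
        exact add_le_add (hC s) (mul_le_mul s.2.2 (hC 1) (abs_nonneg _) zero_le_one)
      _ = _ := by ring
  have h1 := (integral_eq_zero_iff_of_nonneg (fun s => sq_nonneg _) hI).1 h
  rcases eq_or_lt_of_le (unitInterval.le_one' (t := t)) with rfl | ht
  · simp
  by_contra hne
  have hc : ContinuousWithinAt (fun s : I => f s - (s : ℝ) * f 1) (Ici t) t :=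
    (f.rightContinuous t).sub (by fun_prop)
  have h2 : ∀ᶠ s in 𝓝[≥] t, f s - (s : ℝ) * f 1 ≠ 0 := hc.eventually_ne (sub_ne_zero.2 hne)
  obtain ⟨u, hu, hu2⟩ := (mem_nhdsGE_iff_exists_Ico_subset' ht).1 h2
  have h3 : volume (Ico t u) = 0 := by
    refine measure_mono_null (fun s hs => ?_) (ae_iff.1 h1)
    exact fun hs0 => hu2 hs (pow_eq_zero_iff two_ne_zero |>.1 hs0)
  rw [unitInterval.volume_Ico, ENNReal.ofReal_eq_zero] at h3
  have : (t : ℝ) < u := hu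
  linarith

/-! ### Mapping theorems for convergence in distribution -/

/-- The closed-set half of the extended continuous mapping theorem. The events may be nonmeasurable:
they are enclosed in preimages of closed sets, to which the portmanteau theorem applies. -/
lemma eventually_measureReal_lt_of_tendstoInDistribution {E : Type*} [TopologicalSpace E]
    [MeasurableSpace E] [BorelSpace E] [HasOuterApproxClosed E] [MeasurableSpace Ω]
    [MeasurableSpace Ω'] {P : Measure Ω} [IsProbabilityMeasure P] {P' : Measure Ω'}
    [IsProbabilityMeasure P'] {X : ℕ → Ω → E} {Z : Ω' → E}
    (h : TendstoInDistribution X atTop Z (fun _ => P) P') {φ : ℕ → E → ℝ} {ψ : E → ℝ}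
    (hφ : ∀ᵐ ω ∂P', Tendsto (fun p : ℕ × E => φ p.1 p.2) (atTop ×ˢ 𝓝 (Z ω)) (𝓝 (ψ (Z ω))))
    {F : Set ℝ} (hF : IsClosed F) {c : ℝ} (hc : P'.real {ω | ψ (Z ω) ∈ F} < c) :
    ∀ᶠ n in atTop, P.real {ω | φ n (X n ω) ∈ F} < c := by
  -- These closed sets decrease in `k`. A limit point lying in all of them is approached by `g` with
  -- `φ m g ∈ F` for arbitrarily large `m`, so joint convergence forces `ψ` to take a value in `F`
  -- there.
  set C : ℕ → Set E := fun k => closure {g | ∃ m ≥ k, φ m g ∈ F} with hC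
  have hCanti : Antitone fun k => Z ⁻¹' C k := fun i j hij => preimage_mono
    (closure_mono fun g ⟨m, hm, hg⟩ => ⟨m, hij.trans hm, hg⟩)
  have hlim := tendsto_measure_iInter_atTop (μ := P') (s := fun k => Z ⁻¹' C k)
    (fun k => h.aemeasurable_limit.nullMeasurableSet_preimage isClosed_closure.measurableSet)
    hCanti ⟨0, measure_ne_top _ _⟩
  have hsub : P' (⋂ k, Z ⁻¹' C k) ≤ P' {ω | ψ (Z ω) ∈ F} := by
    refine measure_mono_ae ?_
    filter_upwards [hφ] with ω hω hmem
    by_contra hn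
    have h1 := hω.eventually (hF.isOpen_compl.mem_nhds hn)
    obtain ⟨pa, hpa, pb, hpb, hp⟩ := eventually_prod_iff.1 h1
    obtain ⟨N, hN⟩ := eventually_atTop.1 hpa
    have h2 : Z ω ∈ C N := mem_iInter.1 hmem N
    obtain ⟨g, hg, m, hm, hgm⟩ := mem_closure_iff_nhds.1 h2 _ hpb
    exact hp (hN m hm) hg hgm
  have hc0 : 0 ≤ c := measureReal_nonneg.trans hc.le
  have hlt : P' (⋂ k, Z ⁻¹' C k) < ENNReal.ofReal c := by
    refine hsub.trans_lt ?_
    rw [← ofReal_measureReal]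
    exact (ENNReal.ofReal_lt_ofReal_iff (measureReal_nonneg.trans_lt hc)).2 hc
  obtain ⟨k, hk⟩ := (hlim.eventually_lt_const hlt).exists
  have h3 := ProbabilityMeasure.limsup_measure_closed_le_of_tendsto h.tendsto
    (isClosed_closure : IsClosed (C k))
  simp only [ProbabilityMeasure.coe_mk] at h3
  rw [Measure.map_apply_of_aemeasurable h.aemeasurable_limit isClosed_closure.measurableSet] at h3
  have h4 := eventually_lt_of_limsup_lt (h3.trans_lt hk)
  filter_upwards [h4, eventually_ge_atTop k] with n hn hkn
  rw [Measure.map_apply_of_aemeasurable (h.forall_aemeasurable n)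
    isClosed_closure.measurableSet] at hn
  have h5 : P {ω | φ n (X n ω) ∈ F} < ENNReal.ofReal c :=
    (measure_mono (show {ω | φ n (X n ω) ∈ F} ⊆ X n ⁻¹' C k from
      fun ω hω => subset_closure ⟨n, hkn, hω⟩)).trans_lt hn
  rw [measureReal_def]
  exact (ENNReal.toReal_lt_toReal (measure_ne_top _ _) ENNReal.ofReal_ne_top).2 h5 |>.trans_eq
    (ENNReal.toReal_ofReal hc0)

/-- At a continuity point of `ψ`, membership in `ψ ⁻¹' F` and in its closure coincide for closed
`F`. Almost everywhere continuity thus replaces Borel measurability of `ψ`. -/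
lemma aemeasurable_comp_of_ae_continuousAt {E : Type*} [TopologicalSpace E]
    [MeasurableSpace E] [BorelSpace E] [MeasurableSpace Ω'] {P' : Measure Ω'}
    {Z : Ω' → E} (hZ : AEMeasurable Z P') {ψ : E → ℝ}
    (hψ : ∀ᵐ ω ∂P', ContinuousAt ψ (Z ω)) : AEMeasurable (fun ω => ψ (Z ω)) P' := by
  refine NullMeasurable.aemeasurable ?_
  refine measurable_of_isClosed (f := (fun ω : NullMeasurableSpace Ω' P' => ψ (Z ω))) fun F hF => ?_
  have h1 : NullMeasurableSet (Z ⁻¹' closure (ψ ⁻¹' F)) P' :=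
    hZ.nullMeasurableSet_preimage isClosed_closure.measurableSet
  refine h1.congr ?_
  filter_upwards [hψ] with ω hω
  refine propext ⟨fun h => ?_, fun h => subset_closure h⟩
  by_contra hn
  obtain ⟨g, hg, hg'⟩ := mem_closure_iff_nhds.1 h _ (hω (hF.isOpen_compl.mem_nhds hn))
  exact hg hg'

lemma le_measureReal_lt_of_continuousAt_cdf [MeasurableSpace Ω'] {P' : Measure Ω'}
    [IsFiniteMeasure P'] {T : Ω' → ℝ} {x : ℝ}
    (hx : ContinuousAt (fun y => P'.real {ω | T ω ≤ y}) x) :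
    P'.real {ω | T ω ≤ x} ≤ P'.real {ω | T ω < x} := by
  have h1 : Tendsto (fun n : ℕ => x - 1 / ((n : ℝ) + 1)) atTop (𝓝 x) := by
    simpa using tendsto_const_nhds.sub (tendsto_one_div_add_atTop_nhds_zero_nat (𝕜 := ℝ))
  refine le_of_tendsto' (hx.tendsto.comp h1) fun n => ?_
  refine measureReal_mono fun ω hω => ?_
  have : 0 < 1 / ((n : ℝ) + 1) := by positivity
  have h2 : T ω ≤ x - 1 / ((n : ℝ) + 1) := hω
  show T ω < x
  linarith

lemma tendsto_cdf_of_tendstoInDistribution {E : Type*} [TopologicalSpace E]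
    [MeasurableSpace E] [BorelSpace E] [HasOuterApproxClosed E] [MeasurableSpace Ω]
    [MeasurableSpace Ω'] {P : Measure Ω} [IsProbabilityMeasure P] {P' : Measure Ω'}
    [IsProbabilityMeasure P'] {X : ℕ → Ω → E} {Z : Ω' → E}
    (h : TendstoInDistribution X atTop Z (fun _ => P) P') {φ : ℕ → E → ℝ} {ψ : E → ℝ}
    (hφ : ∀ᵐ ω ∂P', Tendsto (fun p : ℕ × E => φ p.1 p.2) (atTop ×ˢ 𝓝 (Z ω)) (𝓝 (ψ (Z ω))))
    (hφm : ∀ᶠ n in atTop, AEMeasurable (fun ω => φ n (X n ω)) P)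
    (hψm : AEMeasurable (fun ω => ψ (Z ω)) P') {x : ℝ}
    (hx : ContinuousAt (fun y => P'.real {ω | ψ (Z ω) ≤ y}) x) :
    Tendsto (fun n => P.real {ω | φ n (X n ω) ≤ x}) atTop (𝓝 (P'.real {ω | ψ (Z ω) ≤ x})) := by
  rw [tendsto_order]
  constructor
  · intro c hc
    have h1 : P'.real {ω | ψ (Z ω) ∈ Ici x} < 1 - c := by
      have e : {ω | ψ (Z ω) ∈ Ici x} = {ω | ψ (Z ω) < x}ᶜ := by
        ext ω; simp
      rw [e, probReal_compl_eq_one_sub₀ (nullMeasurableSet_lt hψm aemeasurable_const)]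
      have := le_measureReal_lt_of_continuousAt_cdf hx
      linarith
    filter_upwards [eventually_measureReal_lt_of_tendstoInDistribution h hφ isClosed_Ici h1, hφm]
      with n hn hm
    have e : {ω | φ n (X n ω) ∈ Ici x} = {ω | φ n (X n ω) < x}ᶜ := by
      ext ω; simp
    rw [e, probReal_compl_eq_one_sub₀ (nullMeasurableSet_lt hm aemeasurable_const)] at hn
    have h2 : P.real {ω | φ n (X n ω) < x} ≤ P.real {ω | φ n (X n ω) ≤ x} :=
      measureReal_mono fun ω (hω : φ n (X n ω) < x) => hω.le
    linarith
  · intro c hc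
    exact eventually_measureReal_lt_of_tendstoInDistribution h hφ isClosed_Iic hc

/-! ### Path properties of the limit process -/

lemma eq_zero_of_denseRange {f : CadlagSpace} {d : ℕ → I} (hd : DenseRange d)
    (h : ∀ i, f (d i) = 0) (h1 : f 1 = 0) (t : I) : f t = 0 := by
  rcases eq_or_lt_of_le (unitInterval.le_one' (t := t)) with rfl | ht
  · exact h1
  by_contra hne
  have h2 : ∀ᶠ s in 𝓝[≥] t, f s ≠ 0 := (f.rightContinuous t).eventually_ne hne
  obtain ⟨u, hu, hu2⟩ := (mem_nhdsGE_iff_exists_Ico_subset' ht).1 h2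
  obtain ⟨i, hi⟩ := hd.exists_mem_open isOpen_Ioo (nonempty_Ioo.2 hu)
  exact hu2 ⟨hi.1.le, hi.2⟩ (h i)

section FunctionalLimit

lemma IsSSSI.aemeasurable [MeasurableSpace Ω'] {P' : Measure Ω'} {Y : ℝ≥0 → Ω' → ℝ} {H : ℝ}
    (hY : IsSSSI Y H P') (t : ℝ≥0) : AEMeasurable (Y t) P' := by
  have h := (hY.selfSimilar 1 one_pos {t}).aemeasurable_fst
  have h2 := (measurable_pi_apply (⟨t, Finset.mem_singleton_self t⟩ :
    ({t} : Finset ℝ≥0))).comp_aemeasurable h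
  simpa [Function.comp_def] using h2

/-- Self-similarity carries linearity on `[0, 1]` with `|Y(1)| ≤ K` to linearity on `[0, n]` with
`|Y(n)| ≤ n^H K`. Then `Y(1) = Y(n) / n`, so the bound on `Y(1)` improves by the factor `n^(H - 1)`.
Only finitely many times are retained, since only finite-dimensional laws are compared. -/
lemma IsSSSI.measure_linear_le [MeasurableSpace Ω'] {P' : Measure Ω'} {Y : ℝ≥0 → Ω' → ℝ} {H : ℝ}
    (hY : IsSSSI Y H P') (K : ℝ) (J : Finset ℝ≥0) {n : ℕ} (hn : 0 < n) :
    P' {ω | |Y 1 ω| ≤ K ∧ ∀ s ≤ (1 : ℝ≥0), Y s ω = s * Y 1 ω} ≤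
      P' {ω | |Y 1 ω| ≤ (n : ℝ) ^ (H - 1) * K ∧ ∀ s ∈ J, s ≤ 1 → Y s ω = s * Y 1 ω} := by
  classical
  have hn0 : (n : ℝ≥0) ≠ 0 := by exact_mod_cast hn.ne'
  have hnR : (0 : ℝ) < n := by exact_mod_cast hn
  -- Multiplied by `n`, these times become `n`, `1` and the times of `J` not exceeding `1`.
  set J' : Finset ℝ≥0 := insert 1 (insert (1 / (n : ℝ≥0)) ((J.filter (· ≤ 1)).image (· / (n : ℝ≥0))))
    with hJ'
  have h1 : (1 : ℝ≥0) ∈ J' := by simp [hJ']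
  have h2 : 1 / (n : ℝ≥0) ∈ J' := by simp [hJ']
  have h3 : ∀ s ∈ J, s ≤ 1 → s / (n : ℝ≥0) ∈ J' := fun s hs hs1 =>
    Finset.mem_insert_of_mem (Finset.mem_insert_of_mem
      (Finset.mem_image_of_mem _ (Finset.mem_filter.2 ⟨hs, hs1⟩)))
  have hdiv : ∀ s : ℝ≥0, s ≤ 1 → s / (n : ℝ≥0) ≤ 1 := fun s hs =>
    div_le_one_of_le₀ (hs.trans (by exact_mod_cast hn)) zero_le
  have h4 : ∀ t ∈ J', t ≤ 1 := by
    intro t ht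
    simp only [hJ', Finset.mem_insert, Finset.mem_image, Finset.mem_filter] at ht
    rcases ht with rfl | rfl | ⟨s, ⟨_, hs⟩, rfl⟩
    · exact le_rfl
    · exact hdiv 1 le_rfl
    · exact hdiv s hs
  set S : Set (J' → ℝ) := {v | |v ⟨1, h1⟩| ≤ (n : ℝ) ^ H * K ∧
    ∀ t : J', v t = ((t : ℝ≥0) : ℝ) * v ⟨1, h1⟩} with hS
  have hSm : MeasurableSet S := by
    have : S = {v | |v ⟨1, h1⟩| ≤ (n : ℝ) ^ H * K} ∩
        ⋂ t : J', {v | v t = ((t : ℝ≥0) : ℝ) * v ⟨1, h1⟩} := by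
      ext v; simp [hS]
    rw [this]
    exact (measurableSet_le (by fun_prop) (by fun_prop)).inter
      (MeasurableSet.iInter fun t => measurableSet_eq_fun (by fun_prop) (by fun_prop))
  have key := (hY.selfSimilar n (pos_iff_ne_zero.2 hn0) J').measure_mem_eq hSm
  have hpow : 0 < (n : ℝ) ^ H := Real.rpow_pos_of_pos hnR _
  calc P' {ω | |Y 1 ω| ≤ K ∧ ∀ s ≤ (1 : ℝ≥0), Y s ω = s * Y 1 ω}
      ≤ P' ((fun ω (t : J') => ((n : ℝ≥0) : ℝ) ^ H * Y t ω) ⁻¹' S) := by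
        refine measure_mono fun ω hω => ⟨?_, fun t => ?_⟩
        · simp only [NNReal.coe_natCast]
          rw [abs_mul, abs_of_pos hpow]
          exact mul_le_mul_of_nonneg_left hω.1 hpow.le
        · simp only
          rw [hω.2 t (h4 t t.2)]; ring
    _ = P' ((fun ω (t : J') => Y ((n : ℝ≥0) * t) ω) ⁻¹' S) := key.symm
    _ ≤ _ := by
        refine measure_mono fun ω hω => ?_
        obtain ⟨ha, hb⟩ := hω
        have hb1 := hb ⟨_, h2⟩
        simp only [mul_one] at ha hb1
        rw [mul_one_div_cancel hn0] at hb1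
        push_cast at hb1
        refine ⟨?_, fun s hs hs1 => ?_⟩
        · rw [hb1, abs_mul, abs_of_pos (by positivity), Real.rpow_sub_one hnR.ne']
          calc 1 / (n : ℝ) * |Y n ω| ≤ 1 / (n : ℝ) * ((n : ℝ) ^ H * K) := by gcongr
            _ = _ := by ring
        · have hb2 := hb ⟨_, h3 s hs hs1⟩
          simp only [mul_one] at hb2
          rw [mul_div_cancel₀ _ hn0] at hb2
          push_cast at hb2
          rw [hb2, hb1]; ring

variable [MeasurableSpace Ω] {P : Measure Ω} [IsProbabilityMeasure P]
    [MeasurableSpace Ω'] {P' : Measure Ω'} [IsProbabilityMeasure P']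
    {X : ℤ → Ω → ℝ} {μ H : ℝ} {ℓ : ℝ → ℝ} {Y : ℝ≥0 → Ω' → ℝ} {path : Ω' → CadlagSpace}

lemma FunctionalLimit.aemeasurable_eval (h : FunctionalLimit P P' X μ H ℓ Y path) (t : I) :
    AEMeasurable (fun ω => path ω t) P' := by
  refine (h.sssi.aemeasurable (unitInterval.toNNReal t)).congr ?_
  filter_upwards [h.path_eq] with ω hω
  exact (hω t).symm

lemma FunctionalLimit.identDistrib_increment (h : FunctionalLimit P P' X μ H ℓ Y path) (a : I) :
    IdentDistrib (fun ω => path ω 1 - path ω (unitInterval.symm a))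
      (fun ω => path ω a - path ω 0) P' P' := by
  have h1 := h.sssi.stationaryIncrements (unitInterval.toNNReal (unitInterval.symm a))
    {unitInterval.toNNReal a}
  have h2 := h1.comp (measurable_pi_apply (⟨unitInterval.toNNReal a, Finset.mem_singleton_self _⟩ :
    ({unitInterval.toNNReal a} : Finset ℝ≥0)))
  have hsum : unitInterval.toNNReal a + unitInterval.toNNReal (unitInterval.symm a)
      = unitInterval.toNNReal 1 := by
    ext; simp
  have hm : ∀ t, AEMeasurable (fun ω => path ω t) P' := h.aemeasurable_eval
  refine (IdentDistrib.of_ae_eq ((hm 1).sub (hm _)) ?_).trans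
    (h2.trans (IdentDistrib.of_ae_eq ((hm a).sub (hm 0)) ?_).symm)
  · filter_upwards [h.path_eq] with ω hω
    simp only [Function.comp_apply, Pi.sub_apply]
    rw [hω 1, hω, hsum]
  · filter_upwards [h.path_eq] with ω hω
    simp only [Function.comp_apply, Pi.sub_apply]
    rw [hω a, hω 0]
    simp

/-- The increment over `[1 - a, 1]` has the law of the increment over `[0, a]`, which tends to zero
by right continuity at `0`. The former also converges to the jump at `1`, and limits in probability
are unique. -/
lemma FunctionalLimit.ae_continuousAt_one (h : FunctionalLimit P P' X μ H ℓ Y path) :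
    ∀ᵐ ω ∂P', ContinuousAt (path ω).toFun 1 := by
  have hpos : ∀ n : ℕ, 0 < 1 / ((n : ℝ) + 1) := fun n => by positivity
  have hle : ∀ n : ℕ, 1 / ((n : ℝ) + 1) ≤ 1 := fun n => by
    rw [div_le_one (by positivity)]; linarith [(n.cast_nonneg : (0 : ℝ) ≤ n)]
  set a : ℕ → I := fun n => ⟨1 / ((n : ℝ) + 1), (hpos n).le, hle n⟩
  have ha : Tendsto a atTop (𝓝[≥] 0) := by
    refine tendsto_nhdsWithin_iff.2 ⟨?_, Eventually.of_forall fun n => (a n).2.1⟩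
    rw [tendsto_subtype_rng]
    exact tendsto_one_div_add_atTop_nhds_zero_nat
  have hb : Tendsto (fun n => unitInterval.symm (a n)) atTop (𝓝[<] 1) := by
    refine tendsto_nhdsWithin_iff.2 ⟨?_, Eventually.of_forall fun n => ?_⟩
    · have := (unitInterval.continuous_symm.tendsto 0).comp (ha.mono_right nhdsWithin_le_nhds)
      rwa [unitInterval.symm_zero] at this
    · show unitInterval.symm (a n) < 1
      rw [← Subtype.coe_lt_coe, unitInterval.coe_symm_eq]
      have := hpos n
      simp only [a, Icc.coe_one]
      linarith
  have hm : ∀ t, AEMeasurable (fun ω => path ω t) P' := h.aemeasurable_eval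
  have h1 : TendstoInMeasure P' (fun n ω => path ω (a n) - path ω 0) atTop fun _ => (0 : ℝ) := by
    refine tendstoInMeasure_of_tendsto_ae
      (fun n => ((hm _).sub (hm _)).aestronglyMeasurable) (ae_of_all _ fun ω => ?_)
    have := (((path ω).rightContinuous 0).tendsto.comp ha).sub_const (path ω 0)
    simpa using this
  have h2 : TendstoInMeasure P' (fun n ω => path ω 1 - path ω (unitInterval.symm (a n))) atTop
      fun _ => (0 : ℝ) := by
    intro ε hε
    refine (h1 ε hε).congr fun n => ?_
    have hs : MeasurableSet {x : ℝ | ε ≤ edist x 0} :=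
      measurableSet_le measurable_const (by fun_prop)
    exact ((h.identDistrib_increment (a n)).measure_mem_eq hs).symm
  have h3 : TendstoInMeasure P' (fun n ω => path ω 1 - path ω (unitInterval.symm (a n))) atTop
      fun ω => path ω 1 - Function.leftLim (path ω).toFun 1 := by
    refine tendstoInMeasure_of_tendsto_ae
      (fun n => ((hm _).sub (hm _)).aestronglyMeasurable) (ae_of_all _ fun ω => ?_)
    exact ((tendsto_leftLim_of_tendsto ((path ω).leftLimits 1)).comp hb).const_sub _
  filter_upwards [tendstoInMeasure_ae_unique h2 h3] with ω hω
  rw [CadlagSpace.continuousAt_iff_leftLim_eq]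
  linarith

/-- Let `n` grow in the scaling bound while the finite time sets exhaust a dense sequence. As `H <
1`, the limiting event forces `Y(1) = 0` and a path vanishing at a dense set of times, hence
everywhere by right continuity, which is almost surely excluded. -/
lemma FunctionalLimit.measure_linear_eq_zero (h : FunctionalLimit P P' X μ H ℓ Y path) (K : ℝ) :
    P' {ω | |Y 1 ω| ≤ K ∧ ∀ s ≤ (1 : ℝ≥0), Y s ω = s * Y 1 ω} = 0 := by
  classical
  set d : ℕ → I := TopologicalSpace.denseSeq I
  set J : ℕ → Finset ℝ≥0 := fun n => (Finset.range n).image fun i => unitInterval.toNNReal (d i)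
  set B : ℕ → Set Ω' := fun n => {ω | |Y 1 ω| ≤ ((n + 1 : ℕ) : ℝ) ^ (H - 1) * |K| ∧
    ∀ s ∈ J (n + 1), s ≤ 1 → Y s ω = s * Y 1 ω}
  have hle : ∀ n, P' {ω | |Y 1 ω| ≤ K ∧ ∀ s ≤ (1 : ℝ≥0), Y s ω = s * Y 1 ω} ≤ P' (B n) := by
    intro n
    refine le_trans (measure_mono fun ω hω => ?_)
      (h.sssi.measure_linear_le |K| (J (n + 1)) n.succ_pos)
    exact ⟨hω.1.trans (le_abs_self K), hω.2⟩
  have hYm := h.sssi.aemeasurable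
  have hBm : ∀ n, NullMeasurableSet (B n) P' := by
    intro n
    have e : B n = {ω | |Y 1 ω| ≤ ((n + 1 : ℕ) : ℝ) ^ (H - 1) * |K|} ∩
        ⋂ s : J (n + 1), {ω | (s : ℝ≥0) ≤ 1 → Y s ω = (s : ℝ≥0) * Y 1 ω} := by
      ext ω; simp [B]
    rw [e]
    refine (nullMeasurableSet_le (hYm 1).abs aemeasurable_const).inter
      (NullMeasurableSet.iInter fun s => ?_)
    by_cases hs : (s : ℝ≥0) ≤ 1
    · simp only [hs, true_imp_iff]
      exact nullMeasurableSet_eq_fun (hYm _) ((hYm 1).const_mul _)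
    · simp [hs]
  have hanti : Antitone B := by
    intro m n hmn ω hω
    refine ⟨hω.1.trans (mul_le_mul_of_nonneg_right ?_ (abs_nonneg K)), fun s hs => hω.2 s ?_⟩
    · exact Real.rpow_le_rpow_of_nonpos (by positivity) (by exact_mod_cast Nat.succ_le_succ hmn)
        (by linarith [h.H_lt_one])
    · exact Finset.image_subset_image (Finset.range_mono (Nat.succ_le_succ hmn)) hs
  have hlim := tendsto_measure_iInter_atTop hBm hanti ⟨0, measure_ne_top P' _⟩
  have hzero : P' (⋂ n, B n) = 0 := by
    have hae : ∀ᵐ ω ∂P', ω ∉ ⋂ n, B n := by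
      filter_upwards [h.path_eq, h.nonzero] with ω hpath hne hmem
      rw [mem_iInter] at hmem
      have e1 : unitInterval.toNNReal 1 = 1 := by ext; simp
      have hpow : Tendsto (fun n : ℕ => ((n + 1 : ℕ) : ℝ) ^ (H - 1) * |K|) atTop (𝓝 0) := by
        have h1 := (tendsto_rpow_neg_atTop (y := 1 - H) (by linarith [h.H_lt_one])).comp
          (tendsto_natCast_atTop_atTop.comp (tendsto_add_atTop_nat 1))
        simpa [neg_sub, Function.comp_def] using h1.mul_const |K|
      have h0 : Y 1 ω = 0 := abs_eq_zero.1 (le_antisymm (ge_of_tendsto' hpow fun n => (hmem n).1)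
        (abs_nonneg _))
      obtain ⟨t, ht⟩ := hne
      refine ht (eq_zero_of_denseRange (TopologicalSpace.denseRange_denseSeq I) (fun i => ?_) ?_ t)
      · have := (hmem i).2 (unitInterval.toNNReal (d i))
          (Finset.mem_image_of_mem _ (Finset.self_mem_range_succ i)) (d i).2.2
        rw [hpath, this, h0, mul_zero]
      · rw [hpath, e1, h0]
    exact measure_eq_zero_iff_ae_notMem.2 hae
  rw [hzero] at hlim
  exact le_antisymm (ge_of_tendsto' hlim hle) zero_le

lemma FunctionalLimit.ae_limitSqNorm_pos (h : FunctionalLimit P P' X μ H ℓ Y path) :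
    ∀ᵐ ω ∂P', 0 < limitSqNorm (path ω) := by
  have h0 : ∀ᵐ ω ∂P', ∀ K : ℕ, ¬ (|Y 1 ω| ≤ K ∧ ∀ s ≤ (1 : ℝ≥0), Y s ω = s * Y 1 ω) := by
    rw [ae_all_iff]
    intro K
    rw [ae_iff]
    simpa only [not_not] using h.measure_linear_eq_zero K
  filter_upwards [h0, h.path_eq] with ω hω hpath
  refine lt_of_le_of_ne (limitSqNorm_nonneg _) fun h1 => ?_
  obtain ⟨K, hK⟩ := exists_nat_ge |Y 1 ω|
  refine hω K ⟨hK, fun s hs => ?_⟩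
  have h2 := eq_linear_of_limitSqNorm_eq_zero h1.symm ⟨s, s.2, hs⟩
  rw [hpath, hpath] at h2
  have e1 : unitInterval.toNNReal 1 = 1 := by ext; simp
  rw [e1] at h2
  exact h2

end FunctionalLimit

/-! ### Slow variation -/

/-- An Egorov-type statement: the sets increase to `[0, 2]`, of length `2`. The threshold `3 / 2` is
chosen so that two such sets, one translated by at most `1`, must meet inside `[0, 3]`. -/
lemma eventually_volume_gt_of_tendsto_sub {f : ℝ → ℝ} (hf : Measurable f)
    (h : ∀ v, Tendsto (fun u => f (u + v) - f u) atTop (𝓝 0)) {w : ℕ → ℝ}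
    (hw : Tendsto w atTop atTop) {ε : ℝ} (hε : 0 < ε) :
    (∀ n, MeasurableSet {t | t ∈ Icc (0 : ℝ) 2 ∧ ∀ m ≥ n, |f (w m + t) - f (w m)| ≤ ε}) ∧
    ∀ᶠ n in atTop, ENNReal.ofReal (3 / 2) <
      volume {t | t ∈ Icc (0 : ℝ) 2 ∧ ∀ m ≥ n, |f (w m + t) - f (w m)| ≤ ε} := by
  set A : ℕ → Set ℝ := fun n => {t | t ∈ Icc (0 : ℝ) 2 ∧ ∀ m ≥ n, |f (w m + t) - f (w m)| ≤ ε}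
  have hA : ∀ n, MeasurableSet (A n) := by
    intro n
    have e : A n = Icc (0 : ℝ) 2 ∩ ⋂ m, ⋂ (_ : m ≥ n), {t | |f (w m + t) - f (w m)| ≤ ε} := by
      ext t; simp [A]
    rw [e]
    exact measurableSet_Icc.inter (MeasurableSet.iInter fun m => MeasurableSet.iInter fun _ =>
      measurableSet_le (by fun_prop) measurable_const)
  refine ⟨hA, ?_⟩
  have hmono : Monotone A := fun i j hij t ht => ⟨ht.1, fun m hm => ht.2 m (le_trans hij hm)⟩
  have hU : ⋃ n, A n = Icc (0 : ℝ) 2 := by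
    ext t
    rw [mem_iUnion]
    constructor
    · rintro ⟨n, hn⟩; exact hn.1
    · intro ht
      have h1 := ((h t).comp hw).abs
      rw [abs_zero] at h1
      obtain ⟨N, hN⟩ := eventually_atTop.1 (h1.eventually_le_const hε)
      exact ⟨N, ht, hN⟩
  have hlim := tendsto_measure_iUnion_atTop (μ := volume) hmono
  rw [hU, Real.volume_Icc] at hlim
  exact hlim.eventually_const_lt ((ENNReal.ofReal_lt_ofReal_iff (by norm_num)).2 (by norm_num))

/-- The uniform convergence theorem for slowly varying functions, in additive form. -/
lemma exists_forall_abs_sub_le_of_tendsto_sub {f : ℝ → ℝ} (hf : Measurable f)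
    (h : ∀ v, Tendsto (fun u => f (u + v) - f u) atTop (𝓝 0)) {δ : ℝ} (hδ : 0 < δ) :
    ∃ u₀, ∀ u ≥ u₀, ∀ v ∈ Icc (0 : ℝ) 1, |f (u + v) - f u| ≤ δ := by
  by_contra! hcon
  choose u hu v hv hlt using fun n : ℕ => hcon n
  have hu' : Tendsto u atTop atTop := tendsto_atTop_mono hu tendsto_natCast_atTop_atTop
  have huv' : Tendsto (fun n => u n + v n) atTop atTop :=
    tendsto_atTop_mono (fun n => (hu n).trans (by linarith [(hv n).1])) tendsto_natCast_atTop_atTop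
  obtain ⟨hA, hA'⟩ := eventually_volume_gt_of_tendsto_sub hf h hu' (half_pos hδ)
  obtain ⟨hB, hB'⟩ := eventually_volume_gt_of_tendsto_sub hf h huv' (half_pos hδ)
  obtain ⟨n, hn1, hn2⟩ := (hA'.and hB').exists
  set A := {t | t ∈ Icc (0 : ℝ) 2 ∧ ∀ m ≥ n, |f (u m + t) - f (u m)| ≤ δ / 2}
  set B := {t | t ∈ Icc (0 : ℝ) 2 ∧ ∀ m ≥ n, |f (u m + v m + t) - f (u m + v m)| ≤ δ / 2}
  have hBv : volume ((fun t => -v n + t) ⁻¹' B) = volume B := measure_preimage_add _ _ _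
  -- A common point of `A` and of `B` translated by `v n` makes `f (u n + t)` within `δ / 2` of both
  -- `f (u n)` and `f (u n + v n)`, contrary to the choice of `v n`.
  obtain ⟨t, ht1, ht2⟩ := nonempty_inter_of_measure_lt_add volume
    ((measurable_const_add (-v n)) (hB n)) (s := A) (u := Icc (0 : ℝ) 3)
    (fun t ht => ⟨ht.1.1, ht.1.2.trans (by norm_num)⟩)
    (fun t ht => ⟨by linarith [ht.1.1, (hv n).1], by linarith [ht.1.2, (hv n).2]⟩) (by
      rw [hBv, Real.volume_Icc]
      calc ENNReal.ofReal (3 - 0) = ENNReal.ofReal (3 / 2) + ENNReal.ofReal (3 / 2) := by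
            rw [← ENNReal.ofReal_add (by norm_num) (by norm_num)]; norm_num
        _ < _ := ENNReal.add_lt_add hn1 hn2)
  have h1 := ht1.2 n le_rfl
  have h2 := ht2.2 n le_rfl
  rw [show u n + v n + (-v n + t) = u n + t by ring] at h2
  have h3 := hlt n
  rw [abs_le] at h1 h2
  rw [lt_abs] at h3
  rcases h3 with h3 | h3 <;> linarith

/-- Potter's upper bound for slowly varying functions. -/
lemma IsSlowlyVarying.exists_potter_bound {ℓ : ℝ → ℝ} (hℓ : IsSlowlyVarying ℓ) {δ : ℝ}
    (hδ : 0 < δ) :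
    ∃ x₀ > 0, ∀ x ≥ x₀, ∀ y ≥ x, 0 < ℓ x ∧ ℓ y ≤ Real.exp δ * (y / x) ^ δ * ℓ x := by
  set f : ℝ → ℝ := fun u => Real.log (ℓ (Real.exp u)) with hf
  have hfm : Measurable f := Real.measurable_log.comp (hℓ.measurable.comp Real.measurable_exp)
  have hpos : ∀ᶠ u in atTop, 0 < ℓ (Real.exp u) := Real.tendsto_exp_atTop.eventually hℓ.eventually_pos
  have hlim : ∀ v, Tendsto (fun u => f (u + v) - f u) atTop (𝓝 0) := by
    intro v
    have h1 := (hℓ.tendsto_ratio (Real.exp v) (Real.exp_pos v)).comp Real.tendsto_exp_atTop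
    have h2 := (Real.continuousAt_log one_ne_zero).tendsto.comp h1
    rw [Real.log_one] at h2
    refine h2.congr' ?_
    filter_upwards [hpos, (tendsto_atTop_add_const_right _ v tendsto_id).eventually hpos]
      with u hu hu'
    simp only [Function.comp_apply, id] at hu' ⊢
    rw [mul_comm, ← Real.exp_add, Real.log_div hu'.ne' hu.ne']
  obtain ⟨u₀, hu₀⟩ := exists_forall_abs_sub_le_of_tendsto_sub hfm hlim hδ
  obtain ⟨u₁, hu₁⟩ := eventually_atTop.1 hpos
  -- On the logarithmic scale, `k` unit steps and one fractional step cost `δ` each; with `k = ⌊log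
  -- (y / x)⌋` this yields the exponent `δ` and the extra factor `exp δ`.
  have hstep : ∀ k : ℕ, ∀ u ≥ u₀, ∀ v ∈ Icc (0 : ℝ) 1, f (u + k + v) - f u ≤ (k + 1) * δ := by
    intro k
    induction k with
    | zero =>
      intro u hu v hv
      simpa using (le_abs_self _).trans (hu₀ u hu v hv)
    | succ k ih =>
      intro u hu v hv
      have h1 := ih (u + 1) (hu.trans (by linarith)) v hv
      have h2 := (le_abs_self _).trans (hu₀ u hu 1 ⟨zero_le_one, le_rfl⟩)
      push_cast
      rw [show u + ((k : ℝ) + 1) + v = u + 1 + k + v by ring]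
      linarith
  refine ⟨Real.exp (max u₀ u₁), Real.exp_pos _, fun x hx y hy => ?_⟩
  have hx0 : 0 < x := (Real.exp_pos _).trans_le hx
  have hy0 : 0 < y := hx0.trans_le hy
  have hlx : max u₀ u₁ ≤ Real.log x := (Real.le_log_iff_exp_le hx0).2 hx
  have hly : Real.log x ≤ Real.log y := Real.log_le_log hx0 hy
  have hpx : 0 < ℓ x := by
    have := hu₁ (Real.log x) ((le_max_right _ _).trans hlx); rwa [Real.exp_log hx0] at this
  have hpy : 0 < ℓ y := by
    have := hu₁ (Real.log y) (((le_max_right _ _).trans hlx).trans hly)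
    rwa [Real.exp_log hy0] at this
  refine ⟨hpx, ?_⟩
  set d := Real.log y - Real.log x with hd
  have hd0 : 0 ≤ d := by linarith
  have h1 := hstep ⌊d⌋₊ (Real.log x) ((le_max_left _ _).trans hlx) (d - ⌊d⌋₊)
    ⟨by linarith [Nat.floor_le hd0], by linarith [Nat.lt_floor_add_one d]⟩
  rw [show Real.log x + ⌊d⌋₊ + (d - ⌊d⌋₊) = Real.log y by rw [hd]; ring] at h1
  simp only [hf, Real.exp_log hx0, Real.exp_log hy0] at h1
  have h2 : Real.log (ℓ y) ≤ δ + d * δ + Real.log (ℓ x) := by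
    have := mul_le_mul_of_nonneg_right (Nat.floor_le hd0) hδ.le
    linarith
  rw [← Real.exp_log hpy, ← Real.exp_log hpx, Real.rpow_def_of_pos (by positivity),
    ← Real.exp_add, ← Real.exp_add, Real.exp_le_exp, Real.log_div hy0.ne' hx0.ne']
  exact h2

/-- This ratio compares the error of centering a block at the sample mean with the scale of a block
sum. It equals `(b/n)^(1 - H) ℓ(n)/ℓ(b)`; Potter's bound with exponent `(1 - H) / 2` spends half of
the available power and leaves a positive one. -/
lemma IsSlowlyVarying.tendsto_norming_ratio {ℓ : ℝ → ℝ} (hℓ : IsSlowlyVarying ℓ) {H : ℝ}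
    (hH : H < 1) {b : ℕ → ℕ} (hb : Tendsto b atTop atTop)
    (hbn : (fun n : ℕ => (b n : ℝ)) =o[atTop] (fun n : ℕ => (n : ℝ))) :
    Tendsto (fun n : ℕ => (b n : ℝ) / n * (((n : ℝ) ^ H * ℓ n) / ((b n : ℝ) ^ H * ℓ (b n))))
      atTop (𝓝 0) := by
  set δ := (1 - H) / 2 with hδ
  have hδ0 : 0 < δ := by rw [hδ]; linarith
  obtain ⟨x₀, hx₀, hpot⟩ := hℓ.exists_potter_bound hδ0
  have hratio : Tendsto (fun n : ℕ => (b n : ℝ) / n) atTop (𝓝 0) := hbn.tendsto_div_nhds_zero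
  have hbR : Tendsto (fun n => (b n : ℝ)) atTop atTop := tendsto_natCast_atTop_atTop.comp hb
  have hlim : Tendsto (fun n : ℕ => Real.exp δ * ((b n : ℝ) / n) ^ δ) atTop (𝓝 0) := by
    have := (hratio.rpow_const (p := δ) (Or.inr hδ0.le)).const_mul (Real.exp δ)
    rwa [Real.zero_rpow hδ0.ne', mul_zero] at this
  have hle : ∀ᶠ n : ℕ in atTop, (b n : ℝ) ≤ n := by
    filter_upwards [hbn.bound one_pos] with n hn
    simpa using hn
  have hbd : ∀ᶠ n : ℕ in atTop, 0 ≤ (b n : ℝ) / n * (((n : ℝ) ^ H * ℓ n) / ((b n : ℝ) ^ H * ℓ (b n)))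
      ∧ (b n : ℝ) / n * (((n : ℝ) ^ H * ℓ n) / ((b n : ℝ) ^ H * ℓ (b n))) ≤
        Real.exp δ * ((b n : ℝ) / n) ^ δ := by
    filter_upwards [hle, hbR.eventually_ge_atTop x₀] with n hn hbx
    have hb0 : (0 : ℝ) < b n := hx₀.trans_le hbx
    have hn0 : (0 : ℝ) < n := hb0.trans_le hn
    obtain ⟨hp1, hp2⟩ := hpot _ hbx _ hn
    obtain ⟨hp3, -⟩ := hpot _ (hbx.trans hn) _ le_rfl
    refine ⟨by positivity, ?_⟩
    have e : (b n : ℝ) / n * (((n : ℝ) ^ H * ℓ n) / ((b n : ℝ) ^ H * ℓ (b n)))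
        = ((b n : ℝ) / n) ^ (1 - H) * (ℓ n / ℓ (b n)) := by
      rw [Real.rpow_sub (by positivity), Real.rpow_one, Real.div_rpow hb0.le hn0.le]
      have := (Real.rpow_pos_of_pos hb0 H).ne'
      have := (Real.rpow_pos_of_pos hn0 H).ne'
      field_simp
    rw [e]
    calc ((b n : ℝ) / n) ^ (1 - H) * (ℓ n / ℓ (b n))
        ≤ ((b n : ℝ) / n) ^ (1 - H) * (Real.exp δ * ((n : ℝ) / b n) ^ δ) := by
          gcongr
          rw [div_le_iff₀ hp1]; exact hp2
      _ = Real.exp δ * ((b n : ℝ) / n) ^ δ := by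
          rw [← inv_div (b n : ℝ) n, Real.inv_rpow (by positivity),
            show 1 - H = δ + δ by rw [hδ]; ring, Real.rpow_add (by positivity)]
          have := (Real.rpow_pos_of_pos (div_pos hb0 hn0) δ).ne'
          field_simp
  exact tendsto_of_tendsto_of_tendsto_of_le_of_le' tendsto_const_nhds hlim
    (hbd.mono fun _ h => h.1) (hbd.mono fun _ h => h.2)

/-! ### Block statistics as functions of Gaussian blocks -/

lemma partialSum_congr_shift {X : ℤ → Ω → ℝ} {X' : ℤ → Ω' → ℝ} {ω : Ω} {ω' : Ω'} {i d N : ℤ}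
    (h : ∀ k, i ≤ k → k ≤ N → X k ω = X' (k + d) ω') {k : ℤ} (hk : k ≤ N) :
    partialSum X i k ω = partialSum X' (i + d) (k + d) ω' := by
  rw [partialSum, partialSum, ← Finset.image_add_right_Icc, Finset.sum_image (by simp)]
  refine Finset.sum_congr rfl fun j hj => ?_
  rw [Finset.mem_Icc] at hj
  exact h j hj.1 (hj.2.trans hk)

lemma normalizer_congr_shift {X : ℤ → Ω → ℝ} {X' : ℤ → Ω' → ℝ} {ω : Ω} {ω' : Ω'} {i d : ℤ} {b : ℕ}
    (h : ∀ k, i ≤ k → k ≤ i + b - 1 → X k ω = X' (k + d) ω') :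
    normalizer X i b ω = normalizer X' (i + d) b ω' := by
  rw [normalizer, normalizer, show i + d + (b : ℤ) - 1 = i + b - 1 + d by ring,
    ← Finset.image_add_right_Icc, Finset.sum_image (by simp)]
  congr 2
  refine Finset.sum_congr rfl fun k hk => ?_
  rw [Finset.mem_Icc] at hk
  rw [partialSum_congr_shift h hk.2, partialSum_congr_shift h le_rfl]
  push_cast
  ring

lemma blockStat_congr_shift {X : ℤ → Ω → ℝ} {X' : ℤ → Ω' → ℝ} {ω : Ω} {ω' : Ω'} {i d : ℤ} {b : ℕ}
    (h : ∀ k, i ≤ k → k ≤ i + b - 1 → X k ω = X' (k + d) ω') (c : ℝ) :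
    blockStat X c i b ω = blockStat X' c (i + d) b ω' := by
  rw [blockStat, blockStat, normalizer_congr_shift h, partialSum_congr_shift h le_rfl,
    show i + d + (b : ℤ) - 1 = i + b - 1 + d by ring]

section Measurability

variable [MeasurableSpace Ω] {X : ℤ → Ω → ℝ}

lemma measurable_partialSum (hX : ∀ i, Measurable (X i)) (j k : ℤ) :
    Measurable (partialSum X j k) :=
  Finset.measurable_fun_sum _ fun i _ => hX i

lemma measurable_normalizer (hX : ∀ i, Measurable (X i)) (i : ℤ) (b : ℕ) :
    Measurable (normalizer X i b) := by
  have := measurable_partialSum hX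
  unfold normalizer
  fun_prop

lemma measurable_blockStat (hX : ∀ i, Measurable (X i)) (c : ℝ) (i : ℤ) (b : ℕ) :
    Measurable (blockStat X c i b) := by
  have := measurable_partialSum hX
  have := measurable_normalizer hX i b
  unfold blockStat
  fun_prop

end Measurability

/-- The `k`-th vector (counted from `0`) of a block, and `0` beyond its ends. -/
def blockCoord {J m : ℕ} (k : ℤ) (u : Fin m × Fin J → ℝ) (j : Fin J) : ℝ :=
  if h : k.toNat < m then u (⟨k.toNat, h⟩, j) else 0

lemma measurable_blockCoord {J m : ℕ} (k : ℤ) :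
    Measurable (blockCoord k : (Fin m × Fin J → ℝ) → Fin J → ℝ) := by
  refine measurable_pi_lambda _ fun j => ?_
  unfold blockCoord
  split_ifs with h
  · exact measurable_pi_apply _
  · exact measurable_const

lemma blockCoord_block {J m : ℕ} (Z : ℤ → Ω → Fin J → ℝ) (p : ℤ) (ω : Ω) {k : ℤ} (h0 : 0 ≤ k)
    (hk : k < m) : blockCoord k (block Z p m ω) = Z (p + 1 + k) ω := by
  ext j
  have h : k.toNat < m := by omega
  simp [blockCoord, h, block, h0]

/-- The subordinated process computed from a block whose `l`-th vector has time `1`. -/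
def blockSequence {J m : ℕ} (l : ℕ) (G : (Fin (l + 1) → Fin J → ℝ) → ℝ) (r : ℤ)
    (u : Fin m × Fin J → ℝ) : ℝ := G fun s => blockCoord (r - 1 + l - (s : ℕ)) u

lemma measurable_blockSequence {J m l : ℕ} {G : (Fin (l + 1) → Fin J → ℝ) → ℝ} (hG : Measurable G)
    (r : ℤ) : Measurable (blockSequence l G r : (Fin m × Fin J → ℝ) → ℝ) :=
  hG.comp (measurable_pi_lambda _ fun _ => measurable_blockCoord _)

section GaussianBlocks

variable [MeasurableSpace Ω] {P : Measure Ω} {J l : ℕ}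
  {Z : ℤ → Ω → Fin J → ℝ} {G : (Fin (l + 1) → Fin J → ℝ) → ℝ} {X : ℤ → Ω → ℝ} {μ : ℝ}

lemma GaussianSubordination.eq_blockSequence (h : GaussianSubordination P Z l G X μ) (b : ℕ)
    (i : ℤ) (ω : Ω) (k : ℤ) (hk : i ≤ k) (hk' : k ≤ i + b - 1) :
    X k ω = blockSequence l G (k + (1 - i)) (block Z (i - l - 1) (l + b) ω) := by
  rw [h.eq_G, blockSequence]
  congr 1
  ext1 s
  have hs : (s : ℕ) ≤ l := Nat.lt_succ_iff.1 s.2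
  rw [blockCoord_block Z _ ω (by omega) (by push_cast; omega)]
  congr 1
  ring

/-- A block of `X` starting at `i` reads `Z` at times `i - l, …, i + b - 1`. The function on the
right is the same for every `i`, so stationarity and Gebelein's inequality apply; this requires a
deterministic centering `c`. -/
lemma GaussianSubordination.blockStat_eq (h : GaussianSubordination P Z l G X μ) (c : ℝ) (b : ℕ)
    (i : ℤ) (ω : Ω) :
    blockStat X c i b ω = blockStat (blockSequence l G) c 1 b (block Z (i - l - 1) (l + b) ω) := by
  rw [blockStat_congr_shift (h.eq_blockSequence b i ω)]
  congr 1
  ring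

lemma GaussianSubordination.normalizer_eq (h : GaussianSubordination P Z l G X μ) (b : ℕ)
    (i : ℤ) (ω : Ω) :
    normalizer X i b ω = normalizer (blockSequence l G) 1 b (block Z (i - l - 1) (l + b) ω) := by
  rw [normalizer_congr_shift (h.eq_blockSequence b i ω)]
  congr 1
  ring

/-- The linear map extracting a block from the values at a finite set of times. -/
def blockMap {J : ℕ} (S : Finset ℤ) (p : ℤ) (m : ℕ) (hS : ∀ r : Fin m, p + 1 + (r : ℕ) ∈ S) :
    (S → Fin J → ℝ) →L[ℝ] (Fin m × Fin J → ℝ) :=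
  ContinuousLinearMap.pi fun r => (ContinuousLinearMap.proj (R := ℝ) (φ := fun _ : Fin J => ℝ) r.2).comp
    (ContinuousLinearMap.proj (R := ℝ) (φ := fun _ : S => Fin J → ℝ) (⟨p + 1 + ((r.1 : Fin m) : ℕ), hS r.1⟩ : S))

/-- A finite set of times containing two blocks. -/
def blockTimes (p q : ℤ) (m : ℕ) : Finset ℤ := Finset.Icc (p + 1) (p + m) ∪ Finset.Icc (q + 1) (q + m)

lemma mem_blockTimes_left (p q : ℤ) (m : ℕ) (r : Fin m) : p + 1 + (r : ℕ) ∈ blockTimes p q m := by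
  have := r.2
  simp only [blockTimes, Finset.mem_union, Finset.mem_Icc]
  left; omega

lemma mem_blockTimes_right (p q : ℤ) (m : ℕ) (r : Fin m) : q + 1 + (r : ℕ) ∈ blockTimes p q m := by
  have := r.2
  simp only [blockTimes, Finset.mem_union, Finset.mem_Icc]
  right; omega

lemma hasGaussianLaw_block_prod (h : IsGaussianProcess Z P) (p q : ℤ) (m : ℕ) :
    HasGaussianLaw (fun ω => (block Z p m ω, block Z q m ω)) P :=
  (h.hasGaussianLaw (blockTimes p q m)).map_fun
    ((blockMap _ p m (mem_blockTimes_left p q m)).prod (blockMap _ q m (mem_blockTimes_right p q m)))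

lemma identDistrib_block_prod (h : IsStationary Z P) (p q d : ℤ) (m : ℕ) :
    IdentDistrib (fun ω => (block Z (p + d) m ω, block Z (q + d) m ω))
      (fun ω => (block Z p m ω, block Z q m ω)) P P := by
  have h1 := (h d (blockTimes p q m)).comp (((blockMap _ p m (mem_blockTimes_left p q m)).prod
    (blockMap _ q m (mem_blockTimes_right p q m))).continuous.measurable)
  refine (congrArg₂ (fun f g => IdentDistrib f g P P) (funext fun ω => ?_) rfl).mpr h1
  refine Prod.ext (funext fun r => ?_) (funext fun r => ?_)
  · show Z (p + d + 1 + (r.1 : ℕ)) ω r.2 = Z (p + 1 + (r.1 : ℕ) + d) ω r.2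
    rw [show p + d + 1 + ((r.1 : ℕ) : ℤ) = p + 1 + (r.1 : ℕ) + d by ring]
  · show Z (q + d + 1 + (r.1 : ℕ)) ω r.2 = Z (q + 1 + (r.1 : ℕ) + d) ω r.2
    rw [show q + d + 1 + ((r.1 : ℕ) : ℤ) = q + 1 + (r.1 : ℕ) + d by ring]

/-- The covariance depends only on the joint law of the two blocks, so stationarity moves the first
block to the origin, where Gebelein's inequality applies. -/
lemma GaussianSubordination.abs_cov_indicator_block_le (h : GaussianSubordination P Z l G X μ)
    (p : ℤ) (k m : ℕ) {A B : Set (Fin m × Fin J → ℝ)} (hA : MeasurableSet A)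
    (hB : MeasurableSet B) :
    |cov[(block Z p m ⁻¹' A).indicator (1 : Ω → ℝ),
      (block Z (p + k) m ⁻¹' B).indicator (1 : Ω → ℝ); P]| ≤ blockCorr Z P k m := by
  have hid := identDistrib_block_prod h.stationary 0 (k : ℤ) p m
  rw [zero_add, add_comm (k : ℤ)] at hid
  have e : ∀ q r : ℤ, cov[(block Z q m ⁻¹' A).indicator (1 : Ω → ℝ),
      (block Z r m ⁻¹' B).indicator (1 : Ω → ℝ); P]
      = cov[fun u : (Fin m × Fin J → ℝ) × (Fin m × Fin J → ℝ) => A.indicator (1 : (Fin m × Fin J → ℝ) → ℝ) u.1,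
        fun u => B.indicator (1 : (Fin m × Fin J → ℝ) → ℝ) u.2;
        P.map (fun ω => (block Z q m ω, block Z r m ω))] := by
    intro q r
    exact (covariance_map
      (((measurable_one.indicator hA).comp measurable_fst).aestronglyMeasurable)
      (((measurable_one.indicator hB).comp measurable_snd).aestronglyMeasurable)
      (hasGaussianLaw_block_prod h.gaussian q r m).aemeasurable).symm
  rw [e, hid.map_eq, ← e]
  exact abs_cov_indicator_le_canonicalCorr (hasGaussianLaw_block_prod h.gaussian 0 k m)
    (fun i => h.centered _ _) (fun i => h.centered _ _) hA hB

end GaussianBlocks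

/-! ### Variance of block averages -/

/-- The average of `ξ_i` over the `n - b + 1` blocks of length `b` in `{1, …, n}`. -/
def blockAverage (n b : ℕ) (ξ : ℤ → ℝ) : ℝ :=
  ((n : ℝ) - b + 1)⁻¹ * ∑ i ∈ Finset.Icc (1 : ℤ) ((n : ℤ) - b + 1), ξ i

/-- For fixed `i`, each lag occurs at most once with `j ≤ i` and at most once with `j > i`. -/
lemma sum_natAbs_sub_le {r : ℕ → ℝ} (hr : ∀ k, 0 ≤ r k) {n : ℕ} {N : ℤ} (hN : N ≤ n + 1) {i : ℤ}
    (hi : i ∈ Finset.Icc 1 N) :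
    ∑ j ∈ Finset.Icc 1 N, r (i - j).natAbs ≤ 2 * ∑ k ∈ Finset.range (n + 1), r k := by
  rw [Finset.mem_Icc] at hi
  have key : ∀ s ⊆ Finset.Icc 1 N, (∀ x ∈ s, ∀ y ∈ s, (i - x).natAbs = (i - y).natAbs → x = y) →
      ∑ j ∈ s, r (i - j).natAbs ≤ ∑ k ∈ Finset.range (n + 1), r k := by
    intro s hs hinj
    rw [← Finset.sum_image (f := r) (g := fun j : ℤ => (i - j).natAbs)
      (fun x hx y hy hxy => hinj x hx y hy hxy)]
    refine Finset.sum_le_sum_of_subset_of_nonneg (fun k hk => ?_) fun k _ _ => hr k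
    obtain ⟨j, hj, rfl⟩ := Finset.mem_image.1 hk
    have := Finset.mem_Icc.1 (hs hj)
    rw [Finset.mem_range]; omega
  rw [← Finset.sum_filter_add_sum_filter_not _ (fun j => j ≤ i), two_mul]
  refine add_le_add (key _ (Finset.filter_subset _ _) ?_) (key _ (Finset.filter_subset _ _) ?_)
  · intro x hx y hy hxy
    have := (Finset.mem_filter.1 hx).2
    have := (Finset.mem_filter.1 hy).2
    omega
  · intro x hx y hy hxy
    have := (Finset.mem_filter.1 hx).2
    have := (Finset.mem_filter.1 hy).2
    omega

lemma integral_blockAverage [MeasurableSpace Ω] {P : Measure Ω} {ξ : ℤ → Ω → ℝ} {n b : ℕ}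
    (hb : b ≤ n) {p : ℝ} (hξ : ∀ i, Integrable (ξ i) P) (hp : ∀ i, ∫ ω, ξ i ω ∂P = p) :
    ∫ ω, blockAverage n b (fun i => ξ i ω) ∂P = p := by
  have hbR : (b : ℝ) ≤ n := by exact_mod_cast hb
  unfold blockAverage
  rw [integral_const_mul, integral_finsetSum _ fun i _ => hξ i]
  simp only [hp, Finset.sum_const, Int.card_Icc, nsmul_eq_mul]
  have e : ((((n : ℤ) - b + 1 + 1 - 1).toNat : ℕ) : ℝ) = (n : ℝ) - b + 1 := by
    have : ((n : ℤ) - b + 1 + 1 - 1).toNat = n - b + 1 := by omega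
    rw [this]; push_cast [Nat.cast_sub hb]; ring
  rw [e, ← mul_assoc, inv_mul_cancel₀ (by linarith), one_mul]

lemma variance_blockAverage_le [MeasurableSpace Ω] {P : Measure Ω} [IsFiniteMeasure P]
    {ξ : ℤ → Ω → ℝ} {n b : ℕ} (hb : b ≤ n) (hξ : ∀ i, MemLp (ξ i) 2 P) {r : ℕ → ℝ}
    (hr : ∀ k, 0 ≤ r k) (hcov : ∀ i j, |cov[ξ i, ξ j; P]| ≤ r (i - j).natAbs) :
    Var[fun ω => blockAverage n b (fun i => ξ i ω); P] ≤
      ((n : ℝ) - b + 1)⁻¹ * (2 * ∑ k ∈ Finset.range (n + 1), r k) := by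
  have hbR : (b : ℝ) ≤ n := by exact_mod_cast hb
  have hN : 0 < (n : ℝ) - b + 1 := by linarith
  unfold blockAverage
  rw [variance_const_mul, variance_fun_sum' fun i _ => hξ i]
  have e : ((((n : ℤ) - b + 1 + 1 - 1).toNat : ℕ) : ℝ) = (n : ℝ) - b + 1 := by
    have : ((n : ℤ) - b + 1 + 1 - 1).toNat = n - b + 1 := by omega
    rw [this]; push_cast [Nat.cast_sub hb]; ring
  have h1 : ∑ i ∈ Finset.Icc (1 : ℤ) ((n : ℤ) - b + 1), ∑ j ∈ Finset.Icc (1 : ℤ) ((n : ℤ) - b + 1),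
      cov[ξ i, ξ j; P] ≤ ((n : ℝ) - b + 1) * (2 * ∑ k ∈ Finset.range (n + 1), r k) := by
    refine (Finset.sum_le_sum fun i hi => (Finset.sum_le_sum fun j _ =>
      (le_abs_self _).trans (hcov i j)).trans (sum_natAbs_sub_le (n := n) hr (by omega) hi)).trans ?_
    rw [Finset.sum_const, Int.card_Icc, nsmul_eq_mul, e]
  calc _ ≤ ((n : ℝ) - b + 1)⁻¹ ^ 2 *
        (((n : ℝ) - b + 1) * (2 * ∑ k ∈ Finset.range (n + 1), r k)) := by gcongr
    _ = _ := by field_simp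

/-! ### The self-normalized statistic as a functional of the partial sum path -/

lemma integral_floor_mul (φ : ℤ → ℝ) {n : ℕ} (hn : 0 < n) :
    ∫ s : I, φ ⌊(n : ℝ) * (s : ℝ)⌋ = (n : ℝ)⁻¹ * ∑ k ∈ Finset.range n, φ k := by
  have hnR : (0 : ℝ) < n := by exact_mod_cast hn
  have h1 : ∫ s : I, φ ⌊(n : ℝ) * (s : ℝ)⌋ = ∫ s in (0 : ℝ)..1, φ ⌊(n : ℝ) * s⌋ := by
    rw [integral_subtype measurableSet_Icc (fun s : ℝ => φ ⌊(n : ℝ) * s⌋),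
      intervalIntegral.integral_of_le zero_le_one, integral_Icc_eq_integral_Ioc]
  have hle : ∀ k : ℕ, (k : ℝ) / n ≤ ((k + 1 : ℕ) : ℝ) / n := fun k => by
    gcongr; exact_mod_cast k.le_succ
  have hae : ∀ k : ℕ, ∀ᵐ s ∂volume.restrict (uIoc ((k : ℝ) / n) (((k + 1 : ℕ) : ℝ) / n)),
      φ ⌊(n : ℝ) * s⌋ = φ k := by
    intro k
    rw [uIoc_of_le (hle k), ← restrict_Ico_eq_restrict_Ioc, ae_restrict_iff' measurableSet_Ico]
    refine ae_of_all _ fun s hs => ?_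
    congr 1
    rw [Int.floor_eq_iff]
    have h2 := (div_le_iff₀ hnR).1 hs.1
    have h3 := (lt_div_iff₀ hnR).1 hs.2
    push_cast at h3 ⊢
    constructor <;> linarith
  have hint : ∀ k < n, IntervalIntegrable (fun s : ℝ => φ ⌊(n : ℝ) * s⌋) volume ((k : ℝ) / n)
      (((k + 1 : ℕ) : ℝ) / n) := fun k _ =>
    (intervalIntegrable_const (c := φ k)).congr_ae ((hae k).mono fun s hs => hs.symm)
  have h4 := intervalIntegral.sum_integral_adjacent_intervals
    (a := fun k : ℕ => (k : ℝ) / n) hint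
  rw [h1]
  simp only [Nat.cast_zero, zero_div, div_self hnR.ne'] at h4
  rw [← h4, Finset.mul_sum]
  refine Finset.sum_congr rfl fun k _ => ?_
  rw [intervalIntegral.integral_congr_ae_restrict (hae k), intervalIntegral.integral_const,
    smul_eq_mul]
  push_cast
  rw [add_div, add_sub_cancel_left, one_div]

lemma sum_Icc_int_eq_sum_range (ψ : ℤ → ℝ) (n : ℕ) :
    ∑ k ∈ Finset.Icc (1 : ℤ) n, ψ k = ∑ k ∈ Finset.range n, ψ (k + 1) := by
  induction n with
  | zero => simp
  | succ n ih =>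
    rw [Finset.sum_range_succ, ← ih]
    have : Finset.Icc (1 : ℤ) ((n + 1 : ℕ) : ℤ) = insert ((n : ℤ) + 1) (Finset.Icc (1 : ℤ) n) := by
      ext k; simp only [Finset.mem_insert, Finset.mem_Icc]; push_cast; omega
    rw [this, Finset.sum_insert (by simp), add_comm]

/-- The normalizer sums over `1, …, n`, whereas the integral of a step path produces `0, …, n - 1`.
The two agree because the bridge vanishes at both ends. -/
lemma sum_Icc_int_eq_sum_range_of_eq {ψ : ℤ → ℝ} {n : ℕ} (h : ψ 0 = ψ n) :
    ∑ k ∈ Finset.Icc (1 : ℤ) n, ψ k = ∑ k ∈ Finset.range n, ψ k := by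
  rw [sum_Icc_int_eq_sum_range]
  have h1 := Finset.sum_range_succ' (fun k : ℕ => ψ k) n
  have h2 := Finset.sum_range_succ (fun k : ℕ => ψ k) n
  push_cast at h1 h2
  linarith

section PathIdentities

variable (X : ℤ → Ω → ℝ) (μ H : ℝ) (ℓ : ℝ → ℝ) {n : ℕ}

lemma partialSumPath_one (ω : Ω) :
    partialSumPath X μ H ℓ n ω 1 = ((n : ℝ) ^ H * ℓ n)⁻¹ * (partialSum X 1 n ω - n * μ) := by
  simp [partialSumPath, stepPath]

lemma sqrt_discreteSqNorm_partialSumPath (hn : 0 < n) (hc : 0 < (n : ℝ) ^ H * ℓ n) (ω : Ω) :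
    √(discreteSqNorm n (partialSumPath X μ H ℓ n ω)) =
      ((n : ℝ) ^ H * ℓ n)⁻¹ * normalizer X 1 n ω := by
  have hnR : (0 : ℝ) < n := by exact_mod_cast hn
  set c := (n : ℝ) ^ H * ℓ n with hcdef
  set ψ : ℤ → ℝ := fun k => (partialSum X 1 k ω - (n : ℝ)⁻¹ * k * partialSum X 1 n ω) ^ 2 with hψ
  have h1 : discreteSqNorm n (partialSumPath X μ H ℓ n ω) =
      ∫ s : I, c⁻¹ ^ 2 * ψ ⌊(n : ℝ) * (s : ℝ)⌋ := by
    unfold discreteSqNorm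
    congr 1
    ext s
    rw [partialSumPath_one]
    simp only [partialSumPath, stepPath, hψ, ← hcdef]
    field_simp
    ring
  have h2 : ψ 0 = ψ n := by
    simp [hψ, partialSum, inv_mul_cancel₀ hnR.ne']
  have h3 : normalizer X 1 n ω = √((n : ℝ)⁻¹ * ∑ k ∈ Finset.Icc (1 : ℤ) n, ψ k) := by
    rw [normalizer, show (1 : ℤ) + n - 1 = n by ring]
    congr 2
    refine Finset.sum_congr rfl fun k _ => ?_
    simp [hψ]
  rw [h1, integral_floor_mul (fun k => c⁻¹ ^ 2 * ψ k) hn, h3, sum_Icc_int_eq_sum_range_of_eq h2,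
    ← Finset.mul_sum, mul_left_comm, Real.sqrt_mul (sq_nonneg _), Real.sqrt_sq (inv_pos.2 hc).le]

lemma discreteFunctional_partialSumPath (hn : 0 < n) (hc : 0 < (n : ℝ) ^ H * ℓ n) (ω : Ω) :
    discreteFunctional n (partialSumPath X μ H ℓ n ω) = selfNormStat X μ n ω := by
  rw [discreteFunctional, sqrt_discreteSqNorm_partialSumPath X μ H ℓ hn hc, partialSumPath_one,
    mul_div_mul_left _ _ (inv_pos.2 hc).ne', selfNormStat, blockStat,
    show (1 : ℤ) + n - 1 = n by ring]

end PathIdentities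

lemma IsSlowlyVarying.eventually_norming_pos {ℓ : ℝ → ℝ} (h : IsSlowlyVarying ℓ) (H : ℝ) :
    ∀ᶠ n : ℕ in atTop, 0 < (n : ℝ) ^ H * ℓ n := by
  filter_upwards [tendsto_natCast_atTop_atTop.eventually h.eventually_pos, eventually_gt_atTop 0]
    with n hn hn0
  exact mul_pos (Real.rpow_pos_of_pos (by exact_mod_cast hn0) _) hn

/-! ### Stationarity and concentration of block averages -/

section Subordinated

variable [MeasurableSpace Ω] {P : Measure Ω} {J l : ℕ}
  {Z : ℤ → Ω → Fin J → ℝ} {G : (Fin (l + 1) → Fin J → ℝ) → ℝ} {X : ℤ → Ω → ℝ} {μ : ℝ}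

lemma GaussianSubordination.aemeasurable_block (h : GaussianSubordination P Z l G X μ) (p : ℤ)
    (m : ℕ) : AEMeasurable (block Z p m) P :=
  (hasGaussianLaw_block_prod h.gaussian p p m).fst.aemeasurable

lemma GaussianSubordination.isProbabilityMeasure (h : GaussianSubordination P Z l G X μ) :
    IsProbabilityMeasure P := h.gaussian.isProbabilityMeasure

lemma GaussianSubordination.aemeasurable_blockStat (h : GaussianSubordination P Z l G X μ) (c : ℝ)
    (i : ℤ) (b : ℕ) : AEMeasurable (blockStat X c i b) P := by
  have := (measurable_blockStat (measurable_blockSequence h.measurable_G) c 1 b).comp_aemeasurable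
    (h.aemeasurable_block (i - l - 1) (l + b))
  exact this.congr (ae_of_all _ fun ω => (h.blockStat_eq c b i ω).symm)

lemma GaussianSubordination.measureReal_block_preimage (h : GaussianSubordination P Z l G X μ)
    (p q : ℤ) {m : ℕ} {A : Set (Fin m × Fin J → ℝ)} (hA : MeasurableSet A) :
    P.real (block Z p m ⁻¹' A) = P.real (block Z q m ⁻¹' A) := by
  have h1 := ((identDistrib_block_prod h.stationary q q (p - q) m).comp
    measurable_fst).measure_mem_eq hA
  rw [add_sub_cancel] at h1
  rw [measureReal_def, measureReal_def]
  exact congrArg _ h1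

lemma GaussianSubordination.measureReal_blockStat_le (h : GaussianSubordination P Z l G X μ) (c : ℝ)
    (i : ℤ) (b : ℕ) (x : ℝ) :
    P.real {ω | blockStat X c i b ω ≤ x} = P.real {ω | blockStat X c 1 b ω ≤ x} := by
  simp_rw [h.blockStat_eq c b]
  exact h.measureReal_block_preimage (i - l - 1) (1 - l - 1) (m := l + b)
    (A := {u | blockStat (blockSequence l G) c 1 b u ≤ x})
    (measurableSet_le (measurable_blockStat (measurable_blockSequence h.measurable_G) c 1 b)
      measurable_const)

lemma GaussianSubordination.measureReal_normalizer_le (h : GaussianSubordination P Z l G X μ)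
    (i : ℤ) (b : ℕ) (x : ℝ) :
    P.real {ω | normalizer X i b ω ≤ x} = P.real {ω | normalizer X 1 b ω ≤ x} := by
  simp_rw [h.normalizer_eq b]
  exact h.measureReal_block_preimage (i - l - 1) (1 - l - 1) (m := l + b)
    (A := {u | normalizer (blockSequence l G) 1 b u ≤ x})
    (measurableSet_le (measurable_normalizer (measurable_blockSequence h.measurable_G) 1 b)
      measurable_const)

lemma GaussianSubordination.nullMeasurableSet_normalizer_le
    (h : GaussianSubordination P Z l G X μ) (i : ℤ) (b : ℕ) (x : ℝ) :
    NullMeasurableSet {ω | normalizer X i b ω ≤ x} P := by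
  simp_rw [h.normalizer_eq b]
  exact (h.aemeasurable_block (i - l - 1) (l + b)).nullMeasurableSet_preimage
    (measurableSet_le (measurable_normalizer (measurable_blockSequence h.measurable_G) 1 b)
      measurable_const)

lemma integral_indicator_one_eq {s : Set Ω} (hs : NullMeasurableSet s P) :
    ∫ ω, s.indicator (1 : Ω → ℝ) ω ∂P = P.real s := by
  rw [integral_indicator₀ hs]
  simp [measureReal_def]

lemma integrable_indicator_one [IsFiniteMeasure P] {s : Set Ω} (hs : NullMeasurableSet s P) :
    Integrable (s.indicator (1 : Ω → ℝ)) P :=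
  (integrable_const (1 : ℝ)).indicator₀ hs

lemma memLp_indicator_one [IsFiniteMeasure P] {s : Set Ω} (hs : NullMeasurableSet s P) :
    MemLp (s.indicator (1 : Ω → ℝ)) 2 P := by
  refine MemLp.of_bound (C := 1) (integrable_indicator_one hs).aestronglyMeasurable
    (ae_of_all _ fun ω => ?_)
  by_cases h : ω ∈ s <;> simp [h]

/-- Chebyshev's inequality. Stationarity identifies the mean, and Gebelein's inequality bounds the
covariances in the variance of the average. -/
lemma GaussianSubordination.measureReal_blockAverage_ge_le (h : GaussianSubordination P Z l G X μ)
    {n b : ℕ} (hb : b ≤ n) (x : ℝ) {ε : ℝ} (hε : 0 < ε) :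
    P.real {ω | ε ≤ |blockAverage n b (fun i => {ω | blockStat X μ i b ω ≤ x}.indicator 1 ω)
        - P.real {ω | selfNormStat X μ b ω ≤ x}|} ≤
      ((n : ℝ) - b + 1)⁻¹ * (2 * ∑ k ∈ Finset.range (n + 1), blockCorr Z P k (l + b)) / ε ^ 2 := by
  have hp := h.isProbabilityMeasure
  have hm : ∀ i, NullMeasurableSet {ω | blockStat X μ i b ω ≤ x} P := fun i =>
    nullMeasurableSet_le (h.aemeasurable_blockStat μ i b) aemeasurable_const
  have hnn : ∀ k, 0 ≤ blockCorr Z P k (l + b) := fun k => canonicalCorr_nonneg _ _ _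
  have hmean := integral_blockAverage (P := P) (n := n) hb (fun i => integrable_indicator_one (hm i))
    (p := P.real {ω | selfNormStat X μ b ω ≤ x}) (fun i => by
      rw [integral_indicator_one_eq (hm i), h.measureReal_blockStat_le]; rfl)
  have hA : MeasurableSet {u : Fin (l + b) × Fin J → ℝ |
      blockStat (blockSequence l G) μ 1 b u ≤ x} :=
    measurableSet_le (measurable_blockStat (measurable_blockSequence h.measurable_G) μ 1 b)
      measurable_const
  have hset : ∀ i : ℤ, {ω | blockStat X μ i b ω ≤ x} = block Z (i - l - 1) (l + b) ⁻¹'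
      {u : Fin (l + b) × Fin J → ℝ | blockStat (blockSequence l G) μ 1 b u ≤ x} := by
    intro i
    ext ω
    show blockStat X μ i b ω ≤ x ↔ _
    rw [h.blockStat_eq]
    rfl
  have hcov : ∀ i j : ℤ, i ≤ j → |cov[{ω | blockStat X μ i b ω ≤ x}.indicator (1 : Ω → ℝ),
      {ω | blockStat X μ j b ω ≤ x}.indicator (1 : Ω → ℝ); P]| ≤
      blockCorr Z P (i - j).natAbs (l + b) := by
    intro i j hij
    rw [hset, hset]
    have e : j - l - 1 = i - l - 1 + ((i - j).natAbs : ℤ) := by omega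
    rw [e]
    exact h.abs_cov_indicator_block_le _ _ _ hA hA
  have hvar := variance_blockAverage_le (n := n) hb (fun i => memLp_indicator_one (hm i)) hnn
    (fun i j => by
      rcases le_total i j with hij | hij
      · exact hcov i j hij
      · rw [covariance_comm, ← Int.natAbs_neg, neg_sub]
        exact hcov j i hij)
  have hL2 : MemLp (fun ω => blockAverage n b
      (fun i => {ω | blockStat X μ i b ω ≤ x}.indicator (1 : Ω → ℝ) ω)) 2 P :=
    (memLp_finsetSum _ fun i _ => memLp_indicator_one (hm i)).const_mul _
  have hch := meas_ge_le_variance_div_sq hL2 hε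
  rw [hmean] at hch
  refine (ENNReal.toReal_le_of_le_ofReal (div_nonneg (variance_nonneg _ _) (sq_nonneg _)) hch).trans ?_
  gcongr

end Subordinated

/-! ### Uniform convergence of distribution functions -/

lemma exists_measureReal_le_abs_lt [MeasurableSpace Ω'] {P' : Measure Ω'} [IsProbabilityMeasure P']
    {W : Ω' → ℝ} (hW : AEMeasurable W P') {κ : ℝ} (hκ : 0 < κ) :
    ∃ K > 0, P'.real {ω | K ≤ |W ω|} < κ := by
  have := Measure.isProbabilityMeasure_map hW.abs
  have h1 := (tendsto_cdf_atTop (P'.map fun ω => |W ω|)).eventually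
    (lt_mem_nhds (show 1 - κ < 1 by linarith))
  obtain ⟨K, hK, hK0⟩ := (h1.and (eventually_ge_atTop 0)).exists
  refine ⟨K + 1, by linarith, ?_⟩
  have e : P'.real {ω | |W ω| ≤ K} = cdf (P'.map fun ω => |W ω|) K := by
    rw [cdf_eq_real, map_measureReal_apply_of_aemeasurable hW.abs measurableSet_Iic]; rfl
  rw [← e] at hK
  have h2 := probReal_compl_eq_one_sub₀ (μ := P') (s := {ω | |W ω| ≤ K})
    (nullMeasurableSet_le hW.abs aemeasurable_const)
  have h3 : P'.real {ω | K + 1 ≤ |W ω|} ≤ P'.real {ω | |W ω| ≤ K}ᶜ :=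
    measureReal_mono fun ω (hω : K + 1 ≤ |W ω|) (h : |W ω| ≤ K) => by linarith
  linarith

lemma exists_measureReal_le_lt [MeasurableSpace Ω'] {P' : Measure Ω'} [IsProbabilityMeasure P']
    {W : Ω' → ℝ} (hW : AEMeasurable W P') (hpos : ∀ᵐ ω ∂P', 0 < W ω) {κ : ℝ} (hκ : 0 < κ) :
    ∃ δ > 0, P'.real {ω | W ω ≤ δ} < κ := by
  have := Measure.isProbabilityMeasure_map hW
  have e : ∀ x, P'.real {ω | W ω ≤ x} = cdf (P'.map W) x := fun x => by
    rw [cdf_eq_real, map_measureReal_apply_of_aemeasurable hW measurableSet_Iic]; rfl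
  have h0 : cdf (P'.map W) 0 = 0 := by
    rw [← e, measureReal_def, ENNReal.toReal_eq_zero_iff]
    left
    rw [← ae_iff.1 hpos]
    simp
  have h1 : Tendsto (cdf (P'.map W)) (𝓝[>] 0) (𝓝 0) := by
    have := ((cdf (P'.map W)).right_continuous 0).mono_left (nhdsWithin_mono _ Ioi_subset_Ici_self)
    rwa [h0] at this
  obtain ⟨δ, hδ, hδ0⟩ := ((h1.eventually (gt_mem_nhds hκ)).and self_mem_nhdsWithin).exists
  exact ⟨δ, hδ0, by rwa [e]⟩

/-- Closeness of a monotone function to a continuous distribution function on a suitable finite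
set implies uniform closeness. -/
lemma exists_finset_forall_abs_sub_le {F : ℝ → ℝ} (hc : Continuous F) (hmono : Monotone F)
    (h0 : Tendsto F atBot (𝓝 0)) (h1 : Tendsto F atTop (𝓝 1)) {γ : ℝ} (hγ : 0 < γ) :
    ∃ S : Finset ℝ, ∀ g : ℝ → ℝ, Monotone g → (∀ x, 0 ≤ g x) → (∀ x, g x ≤ 1) →
      (∀ y ∈ S, |g y - F y| ≤ γ) → ∀ x, |g x - F x| ≤ 2 * γ := by
  classical
  -- The finite set consists of points where `F` takes the levels `j / K`, `0 < j < K`; the spacing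
  -- `1 / K ≤ γ` adds to the error `γ` at these points.
  obtain ⟨K, hK⟩ := exists_nat_gt γ⁻¹
  have hKpos : (0 : ℝ) < K := (inv_pos.2 hγ).trans hK
  have hKγ : 1 / (K : ℝ) ≤ γ := by
    rw [one_div]; exact inv_le_of_inv_le₀ hγ hK.le
  have hex : ∀ j : ℤ, 0 < j → j < K → ∃ x, F x = j / K := by
    intro j hj hjK
    have hj' : (0 : ℝ) < j := by exact_mod_cast hj
    have hjK' : (j : ℝ) < K := by exact_mod_cast hjK
    obtain ⟨a, ha⟩ := (h0.eventually (gt_mem_nhds (div_pos hj' hKpos))).exists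
    obtain ⟨c, hc'⟩ := (h1.eventually (lt_mem_nhds ((div_lt_one hKpos).2 hjK'))).exists
    exact mem_range_of_exists_le_of_exists_ge hc ⟨a, ha.le⟩ ⟨c, hc'.le⟩
  have hF0 : ∀ x, 0 ≤ F x := hmono.le_of_tendsto h0
  have hF1 : ∀ x, F x ≤ 1 := hmono.ge_of_tendsto h1
  choose! q hq using hex
  refine ⟨(Finset.Ioo (0 : ℤ) K).image q, fun g hg hg0 hg1 hS x => ?_⟩
  have hS' : ∀ j : ℤ, 0 < j → j < K → |g (q j) - j / K| ≤ γ := fun j hj hjK => by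
    rw [← hq j hj hjK]
    exact hS _ (Finset.mem_image_of_mem _ (Finset.mem_Ioo.2 ⟨hj, hjK⟩))
  have hup := Int.lt_floor_add_one (K * F x)
  have hlo := Int.floor_le (K * F x)
  have hup' := Int.ceil_lt_add_one (K * F x)
  have hlo' := Int.le_ceil (K * F x)
  rw [abs_le]
  constructor
  -- The largest level strictly below `F x`: strictness places `q j` to the left of `x` although `F`
  -- may have flat pieces. If `j ≤ 0`, nonnegativity of `g` suffices.
  · set j := ⌈(K : ℝ) * F x⌉ - 1 with hj
    have hjr : (j : ℝ) = (⌈(K : ℝ) * F x⌉ : ℝ) - 1 := by rw [hj]; push_cast; ring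
    have h2 : F x - j / K ≤ γ := by
      refine le_trans ?_ hKγ
      rw [sub_le_iff_le_add, ← add_div, le_div_iff₀ hKpos]; linarith
    rcases le_or_gt j 0 with h | h
    · have : (j : ℝ) / K ≤ 0 := div_nonpos_of_nonpos_of_nonneg (by exact_mod_cast h) hKpos.le
      linarith [hg0 x]
    · have h3 : (j : ℝ) < K * F x := by linarith
      have hjK : j < K := by
        have : (j : ℝ) < K := h3.trans_le (mul_le_of_le_one_right hKpos.le (hF1 x))
        exact_mod_cast this
      have hqx : q j ≤ x := by
        refine (hmono.reflect_lt ?_).le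
        rw [hq j h hjK, div_lt_iff₀ hKpos]; linarith
      linarith [hg hqx, (abs_le.1 (hS' j h hjK)).1]
  · set j := ⌊(K : ℝ) * F x⌋ + 1 with hj
    have hjr : (j : ℝ) = (⌊(K : ℝ) * F x⌋ : ℝ) + 1 := by rw [hj]; push_cast; ring
    have h2 : j / K - F x ≤ γ := by
      refine le_trans ?_ hKγ
      rw [sub_le_iff_le_add, ← sub_le_iff_le_add', ← sub_div, div_le_iff₀ hKpos]; linarith
    have hjpos : 0 < j := by
      have : (0 : ℤ) ≤ ⌊(K : ℝ) * F x⌋ := Int.floor_nonneg.2 (mul_nonneg hKpos.le (hF0 x))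
      omega
    rcases le_or_gt (K : ℤ) j with h | h
    · have : 1 ≤ (j : ℝ) / K := by
        rw [le_div_iff₀ hKpos, one_mul]; exact_mod_cast h
      linarith [hg1 x]
    · have hqx : x ≤ q j := by
        refine (hmono.reflect_lt ?_).le
        rw [hq j hjpos h, lt_div_iff₀ hKpos]; linarith
      linarith [hg hqx, (abs_le.1 (hS' j hjpos h)).2]

/-! ### Replacing the centering of the block statistics -/

/-- Changing the center from `c` to `c'` adds `b (c - c')` over the normalizer, at most `ε` when the
normalizer exceeds `η`. The remaining blocks, including those with zero normalizer, are absorbed by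
the last indicator. -/
lemma indicator_blockStat_le (X : ℤ → Ω → ℝ) {c c' : ℝ} (i : ℤ) (b : ℕ) (ω : Ω) {x ε η : ℝ}
    (hε : 0 < ε) (hη : 0 < η) (hcc : |b * (c - c')| ≤ ε * η) :
    (Iic x).indicator (fun _ => (1 : ℝ)) (blockStat X c i b ω) ≤
      (Iic (x + ε)).indicator (fun _ => (1 : ℝ)) (blockStat X c' i b ω) +
        (Iic η).indicator (fun _ => (1 : ℝ)) (normalizer X i b ω) := by
  have hnn : ∀ (y z : ℝ), 0 ≤ (Iic y).indicator (fun _ => (1 : ℝ)) z := fun y z =>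
    indicator_nonneg (fun _ _ => zero_le_one) _
  by_cases hD : normalizer X i b ω ≤ η
  · rw [indicator_of_mem (show normalizer X i b ω ∈ Iic η from hD)]
    have := hnn (x + ε) (blockStat X c' i b ω)
    have h1 : (Iic x).indicator (fun _ => (1 : ℝ)) (blockStat X c i b ω) ≤ 1 :=
      indicator_le_self' (fun _ _ => zero_le_one) _
    linarith
  · push Not at hD
    by_cases hx : blockStat X c i b ω ≤ x
    · have hDpos : 0 < normalizer X i b ω := hη.trans hD
      have e : blockStat X c' i b ω =
          blockStat X c i b ω + b * (c - c') / normalizer X i b ω := by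
        unfold blockStat; field_simp; ring
      have h1 : b * (c - c') / normalizer X i b ω ≤ ε := by
        rw [div_le_iff₀ hDpos]
        exact (le_abs_self _).trans (hcc.trans (mul_le_mul_of_nonneg_left hD.le hε.le))
      have h2 : blockStat X c' i b ω ∈ Iic (x + ε) := by
        rw [mem_Iic, e]; linarith
      rw [indicator_of_mem h2]
      linarith [hnn η (normalizer X i b ω),
        indicator_le_self' (s := Iic x) (f := fun _ => (1 : ℝ)) (fun _ _ => zero_le_one)
          (blockStat X c i b ω)]
    · rw [indicator_of_notMem (show blockStat X c i b ω ∉ Iic x from hx)]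
      exact add_nonneg (hnn _ _) (hnn _ _)

lemma blockAverage_mono {n b : ℕ} (hb : b ≤ n) {ξ ζ : ℤ → ℝ} (h : ∀ i, ξ i ≤ ζ i) :
    blockAverage n b ξ ≤ blockAverage n b ζ := by
  have : (b : ℝ) ≤ n := by exact_mod_cast hb
  exact mul_le_mul_of_nonneg_left (Finset.sum_le_sum fun i _ => h i)
    (inv_nonneg.2 (by linarith))

lemma blockAverage_add (n b : ℕ) (ξ ζ : ℤ → ℝ) :
    blockAverage n b (fun i => ξ i + ζ i) = blockAverage n b ξ + blockAverage n b ζ := by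
  simp only [blockAverage, Finset.sum_add_distrib, mul_add]

lemma blockAverage_const {n b : ℕ} (hb : b ≤ n) (c : ℝ) : blockAverage n b (fun _ => c) = c := by
  have h : (b : ℝ) ≤ n := by exact_mod_cast hb
  have e : (((n : ℤ) - b + 1).toNat : ℝ) = (n : ℝ) - b + 1 := by
    rw [← Int.cast_natCast, Int.toNat_of_nonneg (by omega)]; push_cast; ring
  simp only [blockAverage, Finset.sum_const, Int.card_Icc, nsmul_eq_mul, add_sub_cancel_right, e]
  rw [inv_mul_cancel_left₀ (by linarith)]

lemma blockCDF_eq_blockAverage (X : ℤ → Ω → ℝ) (n b : ℕ) (x : ℝ) (ω : Ω) :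
    blockCDF X n b x ω = blockAverage n b fun i =>
      (Iic x).indicator (fun _ => (1 : ℝ)) (blockStat X (sampleMean X n ω) i b ω) := rfl

lemma blockCDF_nonneg (X : ℤ → Ω → ℝ) {n b : ℕ} (hb : b ≤ n) (x : ℝ) (ω : Ω) :
    0 ≤ blockCDF X n b x ω := by
  rw [blockCDF_eq_blockAverage]
  refine (blockAverage_const hb 0).symm.trans_le (blockAverage_mono hb fun i => ?_)
  exact indicator_nonneg (fun _ _ => zero_le_one) _

lemma blockCDF_le_one (X : ℤ → Ω → ℝ) {n b : ℕ} (hb : b ≤ n) (x : ℝ) (ω : Ω) :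
    blockCDF X n b x ω ≤ 1 := by
  rw [blockCDF_eq_blockAverage]
  refine (blockAverage_mono hb fun i => ?_).trans_eq (blockAverage_const hb 1)
  exact indicator_le_self' (fun _ _ => zero_le_one) _

lemma monotone_blockCDF (X : ℤ → Ω → ℝ) {n b : ℕ} (hb : b ≤ n) (ω : Ω) :
    Monotone fun x => blockCDF X n b x ω := by
  intro x y hxy
  simp only [blockCDF_eq_blockAverage]
  refine blockAverage_mono hb fun i => ?_
  exact indicator_le_indicator_of_subset (Iic_subset_Iic.2 hxy) (fun _ => zero_le_one) _

/-! ### Consistency of the block-sampling distribution -/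

section Consistency

variable [MeasurableSpace Ω] {P : Measure Ω}
  [MeasurableSpace Ω'] {P' : Measure Ω'} {J l : ℕ}
  {Z : ℤ → Ω → Fin J → ℝ} {G : (Fin (l + 1) → Fin J → ℝ) → ℝ} {X : ℤ → Ω → ℝ} {μ H : ℝ}
  {ℓ : ℝ → ℝ} {Y : ℝ≥0 → Ω' → ℝ} {path : Ω' → CadlagSpace} {b : ℕ → ℕ}

lemma monotone_limitCDF [IsFiniteMeasure P'] : Monotone (limitCDF P' path) := fun _ _ hxy =>
  measureReal_mono fun _ hω => le_trans hω hxy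

lemma BlockSizeCondition.eventually_le_half (h : BlockSizeCondition P Z l b) :
    ∀ᶠ n in atTop, (b n : ℝ) ≤ n / 2 := by
  filter_upwards [h.isLittleO.bound (show (0 : ℝ) < 1 / 2 by norm_num)] with n hn
  rw [Real.norm_of_nonneg (by positivity), Real.norm_of_nonneg (by positivity)] at hn
  linarith

lemma BlockSizeCondition.eventually_le (h : BlockSizeCondition P Z l b) :
    ∀ᶠ n in atTop, b n ≤ n := by
  filter_upwards [h.eventually_le_half] with n hn
  have : (b n : ℝ) ≤ n := by linarith [(n.cast_nonneg : (0 : ℝ) ≤ n)]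
  exact_mod_cast this

lemma tendsto_measureReal_blockAverage (h1 : GaussianSubordination P Z l G X μ)
    (h3 : BlockSizeCondition P Z l b) (x : ℝ) {ε : ℝ} (hε : 0 < ε) :
    Tendsto (fun n => P.real {ω | ε ≤ |blockAverage n (b n)
        (fun i => {ω | blockStat X μ i (b n) ω ≤ x}.indicator 1 ω)
        - P.real {ω | selfNormStat X μ (b n) ω ≤ x}|}) atTop (𝓝 0) := by
  -- The constant `4` combines the `2` from counting lags with `n - b + 1 ≥ n / 2`.
  have hlim : Tendsto (fun n : ℕ => 4 / ε ^ 2 *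
      ((∑ k ∈ Finset.range (n + 1), blockCorr Z P k (l + b n)) / n)) atTop (𝓝 0) := by
    simpa using h3.sum_blockCorr.tendsto_div_nhds_zero.const_mul (4 / ε ^ 2)
  refine squeeze_zero' (Eventually.of_forall fun n => measureReal_nonneg) ?_ hlim
  filter_upwards [h3.eventually_le_half, h3.eventually_le, eventually_gt_atTop 0]
    with n hn hbn hn0
  have hnR : (0 : ℝ) < n := by exact_mod_cast hn0
  refine (h1.measureReal_blockAverage_ge_le hbn x hε).trans ?_
  have hs : 0 ≤ ∑ k ∈ Finset.range (n + 1), blockCorr Z P k (l + b n) :=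
    Finset.sum_nonneg fun k _ => canonicalCorr_nonneg _ _ _
  calc ((n : ℝ) - b n + 1)⁻¹ * (2 * ∑ k ∈ Finset.range (n + 1), blockCorr Z P k (l + b n)) / ε ^ 2
      ≤ ((n : ℝ) / 2)⁻¹ * (2 * ∑ k ∈ Finset.range (n + 1), blockCorr Z P k (l + b n)) / ε ^ 2 := by
        gcongr
        linarith
    _ = _ := by field_simp; ring

variable [IsProbabilityMeasure P] [IsProbabilityMeasure P']

/-- The normalized partial sum at time `1` is tight, as it converges in law to `Y(1)`. The centering
error of a block, measured in units of `b^H ℓ(b)`, is this tight quantity times a ratio tending to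
zero. -/
lemma tendsto_measureReal_sampleMean (h2 : FunctionalLimit P P' X μ H ℓ Y path)
    (h3 : BlockSizeCondition P Z l b) {η : ℝ} (hη : 0 < η) :
    Tendsto (fun n => P.real {ω | η * ((b n : ℝ) ^ H * ℓ (b n)) <
      |(b n : ℝ) * (μ - sampleMean X n ω)|}) atTop (𝓝 0) := by
  rw [tendsto_order]
  refine ⟨fun c hc => Eventually.of_forall fun n => hc.trans_le measureReal_nonneg,
    fun κ hκ => ?_⟩
  obtain ⟨K, hK, hPK⟩ := exists_measureReal_le_abs_lt (h2.aemeasurable_eval 1) hκ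
  have hev := eventually_measureReal_lt_of_tendstoInDistribution h2.weakLimit
    (φ := fun _ f => f 1) (ψ := fun f => f 1) (F := {y | K ≤ |y|}) (by
      filter_upwards [h2.ae_continuousAt_one] with ω hω
      exact (tendsto_eval_of_continuousAt hω).comp tendsto_snd)
    (isClosed_le continuous_const continuous_abs) hPK
  have hr := (h2.slowlyVarying.tendsto_norming_ratio h2.H_lt_one h3.tendsto_atTop
    h3.isLittleO).eventually (gt_mem_nhds (div_pos hη hK))
  filter_upwards [hev, hr, h2.slowlyVarying.eventually_norming_pos H,
    h3.tendsto_atTop.eventually (h2.slowlyVarying.eventually_norming_pos H),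
    eventually_gt_atTop 0] with n hn hrn hcn hcb hn0
  have hnR : (0 : ℝ) < n := by exact_mod_cast hn0
  refine (measureReal_mono fun ω (hω : η * ((b n : ℝ) ^ H * ℓ (b n)) <
    |(b n : ℝ) * (μ - sampleMean X n ω)|) => ?_).trans_lt hn
  show K ≤ |partialSumPath X μ H ℓ n ω 1|
  by_contra hlt
  push Not at hlt
  set c := (n : ℝ) ^ H * ℓ n
  set d := (b n : ℝ) ^ H * ℓ (b n)
  have e : (b n : ℝ) * (μ - sampleMean X n ω) =
      -((b n : ℝ) / n * (c / d) * (d * partialSumPath X μ H ℓ n ω 1)) := by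
    rw [partialSumPath_one, sampleMean]
    change _ = -((b n : ℝ) / n * (c / d) * (d * (c⁻¹ * _)))
    field_simp
    ring
  have hr0 : 0 ≤ (b n : ℝ) / n * (c / d) := by positivity
  rw [e, abs_neg, abs_mul, abs_of_nonneg hr0, abs_mul, abs_of_pos hcb] at hω
  have h4 : (b n : ℝ) / n * (c / d) * (d * |partialSumPath X μ H ℓ n ω 1|) ≤
      η / K * (d * K) := by gcongr
  have h5 : η / K * (d * K) = η * d := by field_simp
  linarith

/-- The rescaled normalizer has an almost surely positive limit, which puts little mass near zero.
-/
lemma exists_eventually_measureReal_normalizer_lt (h2 : FunctionalLimit P P' X μ H ℓ Y path)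
    {κ : ℝ} (hκ : 0 < κ) :
    ∃ δ > 0, ∀ᶠ n : ℕ in atTop,
      P.real {ω | normalizer X 1 n ω ≤ δ * ((n : ℝ) ^ H * ℓ n)} < κ := by
  have hm : AEMeasurable (fun ω => √(limitSqNorm (path ω))) P' := by
    refine aemeasurable_comp_of_ae_continuousAt (ψ := fun f => √(limitSqNorm f))
      h2.weakLimit.aemeasurable_limit ?_
    filter_upwards [h2.ae_continuousAt_one] with ω hω
    exact (continuousAt_limitSqNorm hω).sqrt
  obtain ⟨δ, hδ, hPδ⟩ := exists_measureReal_le_lt hm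
    (h2.ae_limitSqNorm_pos.mono fun ω hω => Real.sqrt_pos.2 hω) hκ
  refine ⟨δ, hδ, ?_⟩
  have hev := eventually_measureReal_lt_of_tendstoInDistribution h2.weakLimit
    (φ := fun n f => √(discreteSqNorm n f)) (ψ := fun f => √(limitSqNorm f)) (F := Iic δ) (by
      filter_upwards [h2.ae_continuousAt_one] with ω hω
      exact (tendsto_discreteSqNorm hω).sqrt) isClosed_Iic hPδ
  filter_upwards [hev, h2.slowlyVarying.eventually_norming_pos H, eventually_gt_atTop 0]
    with n hn hc hn0
  refine (measureReal_mono fun ω (hω : normalizer X 1 n ω ≤ δ * ((n : ℝ) ^ H * ℓ n)) => ?_).trans_lt hn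
  show √(discreteSqNorm n (partialSumPath X μ H ℓ n ω)) ≤ δ
  rw [sqrt_discreteSqNorm_partialSumPath X μ H ℓ hn0 hc, inv_mul_le_iff₀ hc]
  linarith

/-- Markov's inequality for the proportion of blocks with a small normalizer, whose mean is the
probability for a single block by stationarity. -/
lemma GaussianSubordination.measureReal_blockAverage_normalizer_ge_le
    (h : GaussianSubordination P Z l G X μ) {n m : ℕ} (hm : m ≤ n) (η : ℝ) {ε : ℝ} (hε : 0 < ε) :
    P.real {ω | ε ≤ blockAverage n m (fun i => {ω | normalizer X i m ω ≤ η}.indicator 1 ω)} ≤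
      P.real {ω | normalizer X 1 m ω ≤ η} / ε := by
  have hint : ∀ i, Integrable ({ω | normalizer X i m ω ≤ η}.indicator (1 : Ω → ℝ)) P := fun i =>
    integrable_indicator_one (h.nullMeasurableSet_normalizer_le i m η)
  have hmean := integral_blockAverage (P := P) (n := n) hm hint
    (p := P.real {ω | normalizer X 1 m ω ≤ η}) (fun i => by
      rw [integral_indicator_one_eq (h.nullMeasurableSet_normalizer_le i m η),
        h.measureReal_normalizer_le])
  rw [le_div_iff₀' hε, ← hmean]
  refine mul_meas_ge_le_integral_of_nonneg (ae_of_all _ fun ω => ?_) ?_ ε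
  · refine (blockAverage_const hm 0).symm.trans_le (blockAverage_mono hm fun i => ?_)
    exact indicator_nonneg (fun _ _ => zero_le_one) _
  · exact (integrable_finsetSum _ fun i _ => hint i).const_mul _

end Consistency

section Consistency

variable [MeasurableSpace Ω] {P : Measure Ω} [IsProbabilityMeasure P]
  [MeasurableSpace Ω'] {P' : Measure Ω'} [IsProbabilityMeasure P'] {J l : ℕ}
  {Z : ℤ → Ω → Fin J → ℝ} {G : (Fin (l + 1) → Fin J → ℝ) → ℝ} {X : ℤ → Ω → ℝ} {μ H : ℝ}
  {ℓ : ℝ → ℝ} {Y : ℝ≥0 → Ω' → ℝ} {path : Ω' → CadlagSpace} {b : ℕ → ℕ}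

lemma FunctionalLimit.aemeasurable_limitFunctional (h2 : FunctionalLimit P P' X μ H ℓ Y path) :
    AEMeasurable (fun ω => limitFunctional (path ω)) P' := by
  refine aemeasurable_comp_of_ae_continuousAt h2.weakLimit.aemeasurable_limit ?_
  filter_upwards [h2.ae_continuousAt_one, h2.ae_limitSqNorm_pos] with ω hω hpos
  exact continuousAt_limitFunctional hω hpos

lemma tendsto_measureReal_selfNormStat (h1 : GaussianSubordination P Z l G X μ)
    (h2 : FunctionalLimit P P' X μ H ℓ Y path) {x : ℝ} (hx : ContinuousAt (limitCDF P' path) x) :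
    Tendsto (fun n : ℕ => P.real {ω | selfNormStat X μ n ω ≤ x}) atTop
      (𝓝 (limitCDF P' path x)) := by
  have he : ∀ᶠ n : ℕ in atTop, ∀ ω,
      discreteFunctional n (partialSumPath X μ H ℓ n ω) = selfNormStat X μ n ω := by
    filter_upwards [h2.slowlyVarying.eventually_norming_pos H, eventually_gt_atTop 0] with n hc hn
    exact discreteFunctional_partialSumPath X μ H ℓ hn hc
  have h := tendsto_cdf_of_tendstoInDistribution h2.weakLimit (φ := discreteFunctional)
    (ψ := limitFunctional) (by
      filter_upwards [h2.ae_continuousAt_one, h2.ae_limitSqNorm_pos] with ω hω hpos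
      exact tendsto_discreteFunctional hω hpos) (by
      filter_upwards [he] with n hn
      simp_rw [hn]
      exact h1.aemeasurable_blockStat μ 1 n) h2.aemeasurable_limitFunctional hx
  refine h.congr' ?_
  filter_upwards [he] with n hn
  simp_rw [hn]

theorem tendsto_measureReal_blockCDF_sub (h1 : GaussianSubordination P Z l G X μ)
    (h2 : FunctionalLimit P P' X μ H ℓ Y path) (h3 : BlockSizeCondition P Z l b) {x : ℝ}
    (hx : ContinuousAt (limitCDF P' path) x) {γ : ℝ} (hγ : 0 < γ) :
    Tendsto (fun n => P.real {ω | γ ≤ |blockCDF X n (b n) x ω - limitCDF P' path x|})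
      atTop (𝓝 0) := by
  set F := limitCDF P' path
  have hγ4 : 0 < γ / 4 := by positivity
  obtain ⟨ε₀, hε₀, hF⟩ := Metric.continuousAt_iff.1 hx (γ / 4) hγ4
  -- A monotone function has countably many discontinuities, so continuity points `y₁ < x < y₂`
  -- exist as close to `x` as needed. The convergence of the `μ`-centered averages is used at these
  -- points.
  have hdense : Dense {y | ContinuousAt F y} := by
    simpa [compl_ofPred] using (monotone_limitCDF (P' := P')
      (path := path)).countable_not_continuousAt.dense_compl ℝ
  obtain ⟨y₁, hy₁, hy₁x⟩ := hdense.exists_between (show x - ε₀ < x by linarith)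
  obtain ⟨y₂, hy₂, hy₂x⟩ := hdense.exists_between (show x < x + ε₀ by linarith)
  have hF₁ : |F y₁ - F x| < γ / 4 := hF (by
    rw [Real.dist_eq, abs_lt]; constructor <;> linarith [hy₁x.1, hy₁x.2])
  have hF₂ : |F y₂ - F x| < γ / 4 := hF (by
    rw [Real.dist_eq, abs_lt]; constructor <;> linarith [hy₂x.1, hy₂x.2])
  set ε := min (x - y₁) (y₂ - x) with hε
  have hεpos : 0 < ε := lt_min (by linarith [hy₁x.2]) (by linarith [hy₂x.1])
  rw [tendsto_order]
  refine ⟨fun c hc => Eventually.of_forall fun n => hc.trans_le measureReal_nonneg,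
    fun κ hκ => ?_⟩
  -- The factor `γ / 4` compensates for the division in Markov's inequality, leaving probability `κ
  -- / 4`.
  obtain ⟨δ, hδ, hPδ⟩ := exists_eventually_measureReal_normalizer_lt h2
    (show 0 < κ / 4 * (γ / 4) by positivity)
  have hκ4 : 0 < κ / 4 := by positivity
  have hp : ∀ y, ContinuousAt F y → ∀ᶠ n in atTop,
      |P.real {ω | selfNormStat X μ (b n) ω ≤ y} - F y| < γ / 4 := fun y hy =>
    h3.tendsto_atTop.eventually (Metric.tendsto_nhds.1
      (tendsto_measureReal_selfNormStat h1 h2 hy) _ hγ4)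
  filter_upwards [h3.eventually_le, h3.tendsto_atTop.eventually hPδ,
    h3.tendsto_atTop.eventually (h2.slowlyVarying.eventually_norming_pos H), hp y₁ hy₁, hp y₂ hy₂,
    (tendsto_measureReal_blockAverage h1 h3 y₁ hγ4).eventually (gt_mem_nhds hκ4),
    (tendsto_measureReal_blockAverage h1 h3 y₂ hγ4).eventually (gt_mem_nhds hκ4),
    (tendsto_measureReal_sampleMean h2 h3 (mul_pos hεpos hδ)).eventually (gt_mem_nhds hκ4)]
    with n hbn hD hc hp₁ hp₂ hE₁ hE₂ hA
  set η := δ * ((b n : ℝ) ^ H * ℓ (b n)) with hη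
  have hηpos : 0 < η := mul_pos hδ hc
  have hR : P.real {ω | γ / 4 ≤
      blockAverage n (b n) (fun i => {ω | normalizer X i (b n) ω ≤ η}.indicator 1 ω)} < κ / 4 :=
    (h1.measureReal_blockAverage_normalizer_ge_le hbn η hγ4).trans_lt (by
      rwa [div_lt_iff₀ hγ4])
  set E₁ := {ω | γ / 4 ≤ |blockAverage n (b n)
        (fun i => {ω | blockStat X μ i (b n) ω ≤ y₁}.indicator 1 ω)
        - P.real {ω | selfNormStat X μ (b n) ω ≤ y₁}|}
  set E₂ := {ω | γ / 4 ≤ |blockAverage n (b n)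
        (fun i => {ω | blockStat X μ i (b n) ω ≤ y₂}.indicator 1 ω)
        - P.real {ω | selfNormStat X μ (b n) ω ≤ y₂}|}
  set A := {ω | ε * δ * ((b n : ℝ) ^ H * ℓ (b n)) < |(b n : ℝ) * (μ - sampleMean X n ω)|}
  set R := {ω | γ / 4 ≤
      blockAverage n (b n) (fun i => {ω | normalizer X i (b n) ω ≤ η}.indicator 1 ω)}
  -- Outside the four bad events, the sandwich loses less than `γ / 4` to each of four sources:
  -- fluctuation of the average, small normalizers, the distance of the law of `T_b^*` from `F`, and
  -- the variation of `F` between `x` and `y₁` or `y₂`.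
  have hsub : {ω | γ ≤ |blockCDF X n (b n) x ω - F x|} ⊆ (E₁ ∪ E₂) ∪ (A ∪ R) := by
    intro ω hω
    by_contra hn
    simp only [E₁, E₂, A, R, mem_union, not_or, mem_ofPred_eq, not_le, not_lt] at hn
    obtain ⟨⟨hn₁, hn₂⟩, hnA, hnR⟩ := hn
    have k₁ := abs_lt.1 hn₁
    have k₂ := abs_lt.1 hn₂
    have kR := hnR
    have kA : |(b n : ℝ) * (μ - sampleMean X n ω)| ≤ ε * η := by
      rw [hη, ← mul_assoc]; exact hnA
    have kA' : |(b n : ℝ) * (sampleMean X n ω - μ)| ≤ ε * η := by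
      rwa [← neg_sub, mul_neg, abs_neg]
    have hup := blockAverage_mono hbn fun i => indicator_blockStat_le X i (b n) ω (x := x)
      (ε := y₂ - x) (by linarith [hy₂x.1]) hηpos (kA'.trans (by gcongr; exact min_le_right _ _))
    have hlo := blockAverage_mono hbn fun i => indicator_blockStat_le X i (b n) ω (x := y₁)
      (ε := x - y₁) (by linarith [hy₁x.2]) hηpos (kA.trans (by gcongr; exact min_le_left _ _))
    rw [blockAverage_add, add_sub_cancel, ← blockCDF_eq_blockAverage] at hup hlo
    change _ ≤ blockAverage n (b n)
      (fun i => {ω | blockStat X μ i (b n) ω ≤ y₂}.indicator 1 ω) + blockAverage n (b n)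
      (fun i => {ω | normalizer X i (b n) ω ≤ η}.indicator 1 ω) at hup
    change blockAverage n (b n)
      (fun i => {ω | blockStat X μ i (b n) ω ≤ y₁}.indicator 1 ω) ≤ _ + blockAverage n (b n)
      (fun i => {ω | normalizer X i (b n) ω ≤ η}.indicator 1 ω) at hlo
    have j₁ := abs_lt.1 hp₁
    have j₂ := abs_lt.1 hp₂
    have i₁ := abs_lt.1 hF₁
    have i₂ := abs_lt.1 hF₂
    refine absurd (show γ ≤ |blockCDF X n (b n) x ω - F x| from hω) (not_le.2 (abs_lt.2 ⟨?_, ?_⟩))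
    · linarith [k₁.1, j₁.1, i₁.1]
    · linarith [k₂.2, j₂.2, i₂.2]
  have hle : P.real {ω | γ ≤ |blockCDF X n (b n) x ω - F x|} ≤
      (P.real E₁ + P.real E₂) + (P.real A + P.real R) :=
    (measureReal_mono hsub).trans ((measureReal_union_le _ _).trans
      (add_le_add (measureReal_union_le _ _) (measureReal_union_le _ _)))
  linarith

lemma tendsto_limitCDF_atTop (hm : AEMeasurable (fun ω => limitFunctional (path ω)) P') :
    Tendsto (limitCDF P' path) atTop (𝓝 1) := by
  have := Measure.isProbabilityMeasure_map hm
  refine (tendsto_cdf_atTop (P'.map fun ω => limitFunctional (path ω))).congr fun x => ?_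
  rw [cdf_eq_real, map_measureReal_apply_of_aemeasurable hm measurableSet_Iic]; rfl

lemma tendsto_limitCDF_atBot (hm : AEMeasurable (fun ω => limitFunctional (path ω)) P') :
    Tendsto (limitCDF P' path) atBot (𝓝 0) := by
  have := Measure.isProbabilityMeasure_map hm
  refine (tendsto_cdf_atBot (P'.map fun ω => limitFunctional (path ω))).congr fun x => ?_
  rw [cdf_eq_real, map_measureReal_apply_of_aemeasurable hm measurableSet_Iic]; rfl

theorem tendsto_measureReal_blockCDF_sub_selfNormStat (h1 : GaussianSubordination P Z l G X μ)
    (h2 : FunctionalLimit P P' X μ H ℓ Y path) (h3 : BlockSizeCondition P Z l b) {x : ℝ}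
    (hx : ContinuousAt (limitCDF P' path) x) {γ : ℝ} (hγ : 0 < γ) :
    Tendsto (fun n => P.real {ω | γ ≤ |blockCDF X n (b n) x ω -
      P.real {ω' | selfNormStat X μ n ω' ≤ x}|}) atTop (𝓝 0) := by
  refine squeeze_zero' (Eventually.of_forall fun n => measureReal_nonneg) ?_
    (tendsto_measureReal_blockCDF_sub h1 h2 h3 hx (half_pos hγ))
  filter_upwards [Metric.tendsto_nhds.1 (tendsto_measureReal_selfNormStat h1 h2 hx) _
    (half_pos hγ)] with n hn
  refine measureReal_mono fun ω hω => ?_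
  have hω' : γ ≤ |blockCDF X n (b n) x ω - P.real {ω' | selfNormStat X μ n ω' ≤ x}| := hω
  show γ / 2 ≤ |blockCDF X n (b n) x ω - limitCDF P' path x|
  rw [Real.dist_eq, abs_sub_comm] at hn
  linarith [abs_sub_le (blockCDF X n (b n) x ω) (limitCDF P' path x)
    (P.real {ω' | selfNormStat X μ n ω' ≤ x})]

theorem tendsto_measureReal_iSup_blockCDF_sub (h1 : GaussianSubordination P Z l G X μ)
    (h2 : FunctionalLimit P P' X μ H ℓ Y path) (h3 : BlockSizeCondition P Z l b)
    (hc : Continuous (limitCDF P' path)) {γ : ℝ} (hγ : 0 < γ) :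
    Tendsto (fun n => P.real {ω | γ ≤ ⨆ x, |blockCDF X n (b n) x ω -
      P.real {ω' | selfNormStat X μ n ω' ≤ x}|}) atTop (𝓝 0) := by
  set F := limitCDF P' path
  have hm := h2.aemeasurable_limitFunctional
  -- Both the empirical distribution function and that of `T_n^*` are compared with `F` on the same
  -- finite set; each is then uniformly within `γ / 4`, so they differ by at most `γ / 2 < γ`.
  obtain ⟨S, hS⟩ := exists_finset_forall_abs_sub_le hc monotone_limitCDF
    (tendsto_limitCDF_atBot hm) (tendsto_limitCDF_atTop hm) (show 0 < γ / 8 by positivity)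
  have hlim : Tendsto (fun n => ∑ y ∈ S, P.real {ω | γ / 8 ≤ |blockCDF X n (b n) y ω - F y|})
      atTop (𝓝 0) := by
    simpa using tendsto_finsetSum S fun y _ =>
      tendsto_measureReal_blockCDF_sub h1 h2 h3 (x := y) hc.continuousAt
        (show 0 < γ / 8 by positivity)
  refine squeeze_zero' (Eventually.of_forall fun n => measureReal_nonneg) ?_ hlim
  have hp : ∀ᶠ n : ℕ in atTop, ∀ y ∈ S, |P.real {ω | selfNormStat X μ n ω ≤ y} - F y| ≤ γ / 8 :=
    (Filter.eventually_all_finset S).2 fun y _ => (Metric.tendsto_nhds.1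
      (tendsto_measureReal_selfNormStat h1 h2 hc.continuousAt) _
        (show 0 < γ / 8 by positivity)).mono fun n hn => le_of_lt hn
  filter_upwards [h3.eventually_le, hp] with n hbn hpn
  refine le_trans (measureReal_mono (s₂ := ⋃ y ∈ S,
    {ω | γ / 8 ≤ |blockCDF X n (b n) y ω - F y|}) (h₂ := measure_ne_top _ _) fun ω hω => ?_)
    (measureReal_biUnion_finset_le S _)
  by_contra hn
  simp only [mem_iUnion, not_exists] at hn
  have hg := hS _ (monotone_blockCDF X hbn ω) (fun x => blockCDF_nonneg X hbn x ω)
    (fun x => blockCDF_le_one X hbn x ω) fun y hy => (not_le.1 (hn y hy)).le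
  have hq := hS (fun x => P.real {ω | selfNormStat X μ n ω ≤ x})
    (fun _ _ hxy => measureReal_mono fun _ hω => le_trans hω hxy) (fun _ => measureReal_nonneg)
    (fun _ => measureReal_le_one) hpn
  have hω' : γ ≤ ⨆ x, |blockCDF X n (b n) x ω - P.real {ω' | selfNormStat X μ n ω' ≤ x}| := hω
  have : ⨆ x, |blockCDF X n (b n) x ω - P.real {ω' | selfNormStat X μ n ω' ≤ x}| ≤ γ / 2 := by
    refine ciSup_le fun x => ?_
    have h4 := abs_sub_le (blockCDF X n (b n) x ω) (F x) (P.real {ω' | selfNormStat X μ n ω' ≤ x})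
    have h5 := hq x
    rw [abs_sub_comm] at h5
    have h6 : |blockCDF X n (b n) x ω - F x| ≤ 2 * (γ / 8) := hg x
    linarith
  linarith

end Consistency

end

end BlockSampling

theorem corollary1 {Ω Ω' : Type*} [MeasurableSpace Ω] [MeasurableSpace Ω']
    (P : Measure Ω) [IsProbabilityMeasure P] (P' : Measure Ω') [IsProbabilityMeasure P']
    (J l : ℕ) (Z : ℤ → Ω → Fin J → ℝ) (G : (Fin (l + 1) → Fin J → ℝ) → ℝ)
    (X : ℤ → Ω → ℝ) (μ H : ℝ) (ℓ : ℝ → ℝ)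
    (Y : ℝ≥0 → Ω' → ℝ) (path : Ω' → BlockSampling.CadlagSpace) (b : ℕ → ℕ)
    (hA1 : BlockSampling.GaussianSubordination P Z l G X μ)
    (hA2 : BlockSampling.FunctionalLimit P P' X μ H ℓ Y path)
    (hA3 : BlockSampling.BlockSizeCondition P Z l b) :
    (∀ x : ℝ, ContinuousAt (BlockSampling.limitCDF P' path) x →
      TendstoInMeasure P
        (fun (n : ℕ) ω => |BlockSampling.blockCDF X n (b n) x ω
          - P.real {ω' | BlockSampling.selfNormStat X μ n ω' ≤ x}|)
        atTop (fun _ => (0 : ℝ))) ∧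
    (Continuous (BlockSampling.limitCDF P' path) →
      TendstoInMeasure P
        (fun (n : ℕ) ω => ⨆ x : ℝ, |BlockSampling.blockCDF X n (b n) x ω
          - P.real {ω' | BlockSampling.selfNormStat X μ n ω' ≤ x}|)
        atTop (fun _ => (0 : ℝ))) := by
  refine ⟨fun x hx => ?_, fun hc => ?_⟩
  · rw [tendstoInMeasure_iff_measureReal_norm]
    intro γ hγ
    simpa using BlockSampling.tendsto_measureReal_blockCDF_sub_selfNormStat hA1 hA2 hA3 hx hγ
  · rw [tendstoInMeasure_iff_measureReal_norm]
    intro γ hγ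
    have hnn : ∀ (n : ℕ) ω, 0 ≤ ⨆ x : ℝ, |BlockSampling.blockCDF X n (b n) x ω
        - P.real {ω' | BlockSampling.selfNormStat X μ n ω' ≤ x}| := fun n ω =>
      Real.iSup_nonneg fun x => abs_nonneg _
    simp only [sub_zero, Real.norm_eq_abs, abs_of_nonneg (hnn _ _)]
    exact BlockSampling.tendsto_measureReal_iSup_blockCDF_sub hA1 hA2 hA3 hc hγ
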